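/- Let $p$ be a prime number, $L$ a finite extension of $\mathbf{Q}_p$ with its $p$-adic topology, and $\mathbf{A}=\mathbf{R}\times\mathbf{A}_f$ the ring of adeles of $\mathbf{Q}$, where $\mathbf{A}_f$ is the restricted product over all primes $\ell$ of the $\mathbf{Q}_\ell$ with respect to the $\mathbf{Z}_\ell$. Let $G=\mathbf{GL}_2$, let $B\subset G$ be the subgroup of upper triangular matrices and $\mathbb{L}\subset B$ the diagonal torus. Let $M=\mathcal{C}(G(\mathbf{A}),L)$ be the space of continuous functions $G(\mathbf{A})\to L$, with the commuting actions $(\gamma*\phi)(x)=\phi(\gamma^{-1}x)$ of $\gamma\in G(\mathbf{Q})$ and $(g\star\phi)(x)=\phi(xg)$ of $g\in G(\mathbf{A})$. Put $H^i(G,\mathcal{C})=H^i(G(\mathbf{Q}),M)$ (group cohomology of the discrete group $G(\mathbf{Q})$), and let $H^i_c(G,\mathcal{C})$ be the cohomology of the (shifted) cone of the restriction $\mathrm{R}\Gamma(G(\mathbf{Q}),M)\to\mathrm{R}\Gamma(B(\mathbf{Q}),M)$, i.e. the $i$-th cohomology of the complex with term $C^n(G(\mathbf{Q}),M)\oplus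 C^{n-1}(B(\mathbf{Q}),M)$ in degree $n\ge 0$ (inhomogeneous cochains, $C^{-1}=0$) and differential $(c,b)\mapsto(dc,\,c|_{B(\mathbf{Q})}-db)$. Both carry the action of $G(\mathbf{A})$ induced by $\star$, and $(c,b)\mapsto c$ induces a natural $G(\mathbf{A})$-equivariant map $H^i_c(G,\mathcal{C})\to H^i(G,\mathcal{C})$. Let $\widehat{\mathbf{Z}}=\prod_\ell\mathbf{Z}_\ell$. The inclusion $\widehat{\mathbf{Z}}^*\hookrightarrow\mathbf{A}^*$ induces an isomorphism of topological groups $\widehat{\mathbf{Z}}^*\cong\mathbf{A}^*/\mathbf{R}_+^*\mathbf{Q}^*$, by which the two are identified; thus $\mathbb{L}(\widehat{\mathbf{Z}})=(\widehat{\mathbf{Z}}^*)^2\cong(\mathbf{A}^*/\mathbf{R}_+^*\mathbf{Q}^*)^2$. Let $G(\mathbf{A})$ act on $\mathcal{C}(\widehat{\mathbf{Z}}^*)$, the space of continuous functions $\widehat{\mathbf{Z}}^*\to L$, by $(g\star h)(x)=h(x\det g)$, and let $b\in B(\mathbf{A})$ with diagonal entries $a,d$ act on $\mathcal{C}(\mathbb{L}(\widehat{\mathbf{Z}}))$,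 the space of continuous functions $\mathbb{L}(\widehat{\mathbf{Z}})\to L$ (with the compact-open topology), by $(b\star h)(s,t)=h(sa,td)$. Let $\mathrm{Ind}_{B(\mathbf{A})}^{G(\mathbf{A})}\mathcal{C}(\mathbb{L}(\widehat{\mathbf{Z}}))$ be the space of continuous maps $\Phi:G(\mathbf{A})\to\mathcal{C}(\mathbb{L}(\widehat{\mathbf{Z}}))$ with $\Phi(bx)=b\star\Phi(x)$ for $b\in B(\mathbf{A})$ and $x\in G(\mathbf{A})$, with $G(\mathbf{A})$ acting by $(g\star\Phi)(x)=\Phi(xg)$. Then $H^i_c(G,\mathcal{C})=0$ for every $i\neq 1$, and there is an exact sequence of $L$-linear representations of $G(\mathbf{A})$ $$0\to\mathcal{C}(\widehat{\mathbf{Z}}^*)\to\mathrm{Ind}_{B(\mathbf{A})}^{G(\mathbf{A})}\mathcal{C}(\mathbb{L}(\widehat{\mathbf{Z}}))\to H^1_c(G,\mathcal{C})\to H^1(G,\mathcal{C})\to 0$$ whose map $H^1_c(G,\mathcal{C})\to H^1(G,\mathcal{C})$ is the natural one. -/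

import Mathlib

open CategoryTheory
open scoped RestrictedProduct Matrix

noncomputable section

namespace AdelicCohomology

/-! ### Compactly supported cohomology relative to a subgroup -/

section Relative

universe u

variable {k G : Type u} [CommRing k] [Group G] (B : Subgroup G)

/-- Restriction of cochains from `G` to the subgroup `B`. -/
def restrictCochains (A : Rep.{u} k G) :
    groupCohomology.inhomogeneousCochains A ⟶
      groupCohomology.inhomogeneousCochains (Rep.res B.subtype A) :=
  groupCohomology.cochainsMap B.subtype (𝟙 (Rep.res B.subtype A))

/-- Degree `n` part `Cⁿ(G, A) ⊕ Cⁿ⁻¹(B, A)` (with `C⁻¹(B, A) = 0`) of the shifted cone of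
restriction. -/
def relX (A : Rep.{u} k G) : ℕ → ModuleCat.{u} k
  | 0 => ModuleCat.of k ((Fin 0 → G) → A)
  | n + 1 => ModuleCat.of k (((Fin (n + 1) → G) → A) × ((Fin n → B) → A))

/-- The differential `(c, b) ↦ (d c, res c - d b)`. -/
def relD (A : Rep.{u} k G) : (n : ℕ) → (relX B A n ⟶ relX B A (n + 1))
  | 0 => ModuleCat.ofHom
      (LinearMap.prod (inhomogeneousCochains.d A 0).hom ((restrictCochains B A).f 0).hom)
  | n + 1 => ModuleCat.ofHom
      (LinearMap.prod
        ((inhomogeneousCochains.d A (n + 1)).hom ∘ₗ LinearMap.fst k _ _)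
        (((restrictCochains B A).f (n + 1)).hom ∘ₗ LinearMap.fst k _ _ -
          (inhomogeneousCochains.d (Rep.res B.subtype A) n).hom ∘ₗ LinearMap.snd k _ _))

lemma restrictCochains_d (A : Rep.{u} k G) (n : ℕ) (c : (Fin n → G) → A) :
    ((restrictCochains B A).f (n + 1)).hom ((inhomogeneousCochains.d A n).hom c) =
      (inhomogeneousCochains.d (Rep.res B.subtype A) n).hom
        (((restrictCochains B A).f n).hom c) := by
  have h := (restrictCochains B A).comm n (n + 1)
  rw [groupCohomology.inhomogeneousCochains.d_def, groupCohomology.inhomogeneousCochains.d_def] at h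
  exact (congrArg (fun f => f.hom c) h).symm

lemma d_d_apply (A : Rep.{u} k G) (n : ℕ) (c : (Fin n → G) → A) :
    (inhomogeneousCochains.d A (n + 1)).hom ((inhomogeneousCochains.d A n).hom c) = 0 :=
  congrArg (fun f => f.hom c) (groupCohomology.inhomogeneousCochains.d_comp_d n A)

lemma relD_comp_relD (A : Rep.{u} k G) (n : ℕ) : relD B A n ≫ relD B A (n + 1) = 0 := by
  apply ModuleCat.hom_ext
  cases n with
  | zero =>
    refine LinearMap.ext fun c => Prod.ext (d_d_apply A 0 c) ?_
    exact sub_eq_zero.2 (restrictCochains_d B A 0 c)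
  | succ n =>
    refine LinearMap.ext fun c => Prod.ext (d_d_apply A (n + 1) c.1) ?_
    change ((restrictCochains B A).f (n + 2)).hom ((inhomogeneousCochains.d A (n + 1)).hom c.1) -
      (inhomogeneousCochains.d (Rep.res B.subtype A) (n + 1)).hom
        (((restrictCochains B A).f (n + 1)).hom c.1 -
          (inhomogeneousCochains.d (Rep.res B.subtype A) n).hom c.2) = 0
    rw [map_sub, d_d_apply (Rep.res B.subtype A) n c.2, sub_zero, restrictCochains_d, sub_self]

/-- The complex
`C⁰(G, A) → C¹(G, A) ⊕ C⁰(B, A) → C²(G, A) ⊕ C¹(B, A) → ⋯`, which is the cone of the restriction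
`RΓ(G, A) → RΓ(B, A)` shifted by one. -/
def relCochains (A : Rep.{u} k G) : CochainComplex (ModuleCat.{u} k) ℕ :=
  CochainComplex.of (relX B A) (relD B A) (relD_comp_relD B A)

/-- The map on `Cⁿ(G, -) ⊕ Cⁿ⁻¹(B, -)` induced by a morphism of representations. -/
def relMapX {A A' : Rep.{u} k G} (φ : A ⟶ A') : (n : ℕ) → (relX B A n ⟶ relX B A' n)
  | 0 => ModuleCat.ofHom (φ.hom.toLinearMap.compLeft (Fin 0 → G))
  | n + 1 => ModuleCat.ofHom
      (LinearMap.prodMap (φ.hom.toLinearMap.compLeft (Fin (n + 1) → G))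
        (φ.hom.toLinearMap.compLeft (Fin n → B)))

lemma d_compLeft {H : Type u} [Group H] {A A' : Rep.{u} k H} (φ : A ⟶ A') (n : ℕ)
    (c : (Fin n → H) → A) :
    (inhomogeneousCochains.d A' n).hom (φ.hom.toLinearMap.compLeft (Fin n → H) c) =
      φ.hom.toLinearMap.compLeft (Fin (n + 1) → H) ((inhomogeneousCochains.d A n).hom c) := by
  have h := (groupCohomology.cochainsMap (MonoidHom.id H) φ).comm n (n + 1)
  rw [groupCohomology.inhomogeneousCochains.d_def, groupCohomology.inhomogeneousCochains.d_def] at h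
  exact congrArg (fun f => f.hom c) h

lemma relMapX_comm {A A' : Rep.{u} k G} (φ : A ⟶ A') (n : ℕ) :
    relMapX B φ n ≫ relD B A' n = relD B A n ≫ relMapX B φ (n + 1) := by
  apply ModuleCat.hom_ext
  cases n with
  | zero => exact LinearMap.ext fun c => Prod.ext (d_compLeft φ 0 c) rfl
  | succ n =>
    refine LinearMap.ext fun c => Prod.ext (d_compLeft φ (n + 1) c.1) ?_
    have h := d_compLeft (Rep.resMap B.subtype φ) n c.2
    refine (congrArg (fun z => ((restrictCochains B A').f (n + 1)).hom
      (φ.hom.toLinearMap.compLeft (Fin (n + 1) → G) c.1) - z) h).trans ?_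
    exact (map_sub (φ.hom.toLinearMap.compLeft (Fin (n + 1) → B)) _ _).symm

/-- The complex of relative cochains as a functor of the representation. -/
def relCochainsFunctor : Rep.{u} k G ⥤ CochainComplex (ModuleCat.{u} k) ℕ where
  obj A := relCochains B A
  map {A A'} φ := CochainComplex.ofHom (X := relCochains B A) (Y := relCochains B A')
    (relMapX B φ) fun n => by
      simpa [relCochains] using relMapX_comm B φ n
  map_id A := by
    ext n : 1
    cases n <;> rfl
  map_comp φ ψ := by
    ext n : 1
    cases n <;> rfl

/-- Compactly supported cohomology `Hⁿ_c(G, A)`, relative to `B`, as a functor of `A`. -/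
def compactCohomologyFunctor (n : ℕ) : Rep.{u} k G ⥤ ModuleCat.{u} k :=
  relCochainsFunctor B ⋙ HomologicalComplex.homologyFunctor (ModuleCat.{u} k) _ n

/-- The projection `(c, b) ↦ c` in degree `n`. -/
def relFst (A : Rep.{u} k G) :
    (n : ℕ) → (relX B A n ⟶ (groupCohomology.inhomogeneousCochains A).X n)
  | 0 => 𝟙 _
  | n + 1 => ModuleCat.ofHom (LinearMap.fst k ((Fin (n + 1) → G) → A) ((Fin n → B) → A))

lemma relFst_comm (A : Rep.{u} k G) (n : ℕ) :
    relFst B A n ≫ inhomogeneousCochains.d A n = relD B A n ≫ relFst B A (n + 1) := by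
  cases n <;> rfl

/-- The projection of complexes `(c, b) ↦ c`. -/
def forgetCochains :
    relCochainsFunctor B ⟶ groupCohomology.cochainsFunctor k G where
  app A := CochainComplex.ofHom (X := relCochains B A)
    (Y := groupCohomology.inhomogeneousCochains A) (relFst B A) fun n => by
      simpa [relCochains] using relFst_comm B A n
  naturality A A' φ := by
    ext n : 1
    cases n <;> rfl

/-- The canonical map `Hⁿ_c(G, A) → Hⁿ(G, A)`, natural in `A`. -/
def forgetSupports (n : ℕ) :
    compactCohomologyFunctor (k := k) B n ⟶ groupCohomology.functor k G n :=
  Functor.whiskerRight (forgetCochains B)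
    (HomologicalComplex.homologyFunctor (ModuleCat.{u} k) _ n)

/-- If a group `H` acts on `A` by automorphisms of representations of `G`, then it acts on `F A`
for every functor `F` from representations of `G` to modules. -/
def inducedRep (F : Rep.{u} k G ⥤ ModuleCat.{u} k) (A : Rep.{u} k G) {H : Type u} [Group H]
    (act : H →* End A) : Rep.{u} k H :=
  Rep.of (X := F.obj A)
    (((ModuleCat.endRingEquiv (F.obj A)).toMonoidHom.comp (F.mapEnd (X := A))).comp act)

/-- A natural transformation gives an equivariant map between the induced representations. -/
def inducedRepMap {F F' : Rep.{u} k G ⥤ ModuleCat.{u} k} (τ : F ⟶ F') (A : Rep.{u} k G)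
    {H : Type u} [Group H] (act : H →* End A) : inducedRep F A act ⟶ inducedRep F' A act :=
  Rep.ofHom ⟨(τ.app A).hom, fun h => congrArg ModuleCat.Hom.hom (τ.naturality (act h))⟩

end Relative

/-! ### Adeles of `ℚ` -/

instance factPrime (ℓ : Nat.Primes) : Fact (ℓ : ℕ).Prime := ⟨ℓ.2⟩

/-- The finite adeles of `ℚ`: the restricted product of the `ℚ_ℓ` with respect to the `ℤ_ℓ`. -/
abbrev FinAdele : Type := Πʳ ℓ : Nat.Primes, [ℚ_[ℓ], PadicInt.subring ℓ]

instance factOpen : Fact (∀ ℓ : Nat.Primes, IsOpen (PadicInt.subring ℓ : Set ℚ_[ℓ])) := by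
  refine ⟨fun ℓ => ?_⟩
  have h := (PadicInt.isOpenEmbedding_coe (p := ℓ)).isOpen_range
  rwa [Subtype.range_coe_subtype] at h

/-- The adeles of `ℚ`: the product of the real numbers and the finite adeles. -/
abbrev Adele : Type := ℝ × FinAdele

lemma rat_integral (q : ℚ) :
    ∀ᶠ ℓ : Nat.Primes in Filter.cofinite, (q : ℚ_[ℓ]) ∈ PadicInt.subring ℓ := by
  refine Filter.eventually_cofinite.2 ?_
  have hfin : {ℓ : Nat.Primes | (ℓ : ℕ) ∈ q.den.primeFactors}.Finite :=
    q.den.primeFactors.finite_toSet.preimage Nat.Primes.coe_nat_injective.injOn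
  refine hfin.subset fun ℓ hℓ => ?_
  by_contra hn
  have hd : ¬ (ℓ : ℕ) ∣ q.den := fun hd => hn (Nat.mem_primeFactors.2 ⟨ℓ.2, hd, q.den_nz⟩)
  exact hℓ (Padic.norm_rat_le_one (p := (ℓ : ℕ)) hd)

/-- The diagonal embedding `ℚ → 𝔸` at the finite places. -/
def ratToFinAdele : ℚ →+* FinAdele where
  toFun q := ⟨fun ℓ => (q : ℚ_[ℓ]), rat_integral q⟩
  map_zero' := Subtype.ext <| funext fun _ => Rat.cast_zero
  map_one' := Subtype.ext <| funext fun _ => Rat.cast_one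
  map_add' q r := Subtype.ext <| funext fun _ => Rat.cast_add q r
  map_mul' q r := Subtype.ext <| funext fun _ => Rat.cast_mul q r

/-- The diagonal embedding `ℚ → 𝔸`. -/
def ratToAdele : ℚ →+* Adele := (Rat.castHom ℝ).prod ratToFinAdele

/-- The profinite completion `∏ ℤ_ℓ` of `ℤ`. -/
abbrev ZHat : Type := (ℓ : Nat.Primes) → ℤ_[ℓ]

/-- The inclusion of `∏ ℤ_ℓ` into the finite adeles. -/
def zHatToFinAdele : ZHat →+* FinAdele where
  toFun x := ⟨fun ℓ => (x ℓ : ℚ_[ℓ]), .of_forall fun ℓ => (x ℓ).2⟩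
  map_zero' := rfl
  map_one' := rfl
  map_add' _ _ := rfl
  map_mul' _ _ := rfl

/-- The inclusion of the units of `∏ ℤ_ℓ` into the ideles, with component `1` at infinity. -/
def zHatUnitsToIdele : ZHatˣ →* Adeleˣ :=
  (MulEquiv.prodUnits (M := ℝ) (N := FinAdele)).symm.toMonoidHom.comp
    ((MonoidHom.inr ℝˣ FinAdeleˣ).comp (Units.map zHatToFinAdele.toMonoidHom))

/-- The subgroup of ideles that are a positive real number at infinity and `1` elsewhere. -/
def posReal : Subgroup Adeleˣ where
  carrier := {x | 0 < (x : Adele).1 ∧ (x : Adele).2 = 1}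
  one_mem' := ⟨zero_lt_one, rfl⟩
  mul_mem' {x y} hx hy := by
    refine ⟨mul_pos hx.1 hy.1, ?_⟩
    change (x : Adele).2 * (y : Adele).2 = 1
    rw [hx.2, hy.2, one_mul]
  inv_mem' {x} hx := by
    have h1 : (x : Adele).1 * ((x⁻¹ : Adeleˣ) : Adele).1 = 1 := congrArg Prod.fst x.mul_inv
    have h2 : (x : Adele).2 * ((x⁻¹ : Adeleˣ) : Adele).2 = 1 := congrArg Prod.snd x.mul_inv
    rw [hx.2, one_mul] at h2
    exact ⟨pos_of_mul_pos_right (h1 ▸ zero_lt_one) hx.1.le, h2⟩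

/-- The quotient `𝔸ˣ / ℝ₊ˣ ℚˣ` of the ideles, with the quotient topology. -/
abbrev IdeleQuot : Type :=
  Adeleˣ ⧸ (posReal ⊔ (Units.map ratToAdele.toMonoidHom).range)

/-- The homomorphism from the units of `∏ ℤ_ℓ` to `𝔸ˣ / ℝ₊ˣ ℚˣ` induced by the inclusion. -/
def zHatUnitsToIdeleQuot : ZHatˣ →* IdeleQuot :=
  (QuotientGroup.mk' _).comp zHatUnitsToIdele

/-! ### The upper triangular subgroup of `GL₂` -/

section Borel

variable (R : Type*) [CommRing R]

/-- The subgroup of upper triangular matrices in `GL₂(R)`. -/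
def borel : Subgroup (GL (Fin 2) R) where
  carrier := {g | g 1 0 = 0}
  one_mem' := by simp
  mul_mem' {g h} hg hh := by
    simp only [Set.mem_ofPred_eq] at hg hh ⊢
    simp [Matrix.mul_apply, Fin.sum_univ_two, hg, hh]
  inv_mem' {g} hg := by
    simp only [Set.mem_ofPred_eq] at hg ⊢
    simp [Matrix.inv_def, Matrix.adjugate_fin_two, hg]

variable {R}

lemma borel_mul_zero_zero (g h : borel R) :
    (g * h : borel R).1 0 0 = g.1 0 0 * h.1 0 0 := by
  have hh : h.1 1 0 = 0 := h.2
  simp [Matrix.mul_apply, Fin.sum_univ_two, hh]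

lemma borel_mul_one_one (g h : borel R) :
    (g * h : borel R).1 1 1 = g.1 1 1 * h.1 1 1 := by
  have hg : g.1 1 0 = 0 := g.2
  simp [Matrix.mul_apply, Fin.sum_univ_two, hg]

/-- The upper left entry of an upper triangular matrix. -/
def borelFst : borel R →* Rˣ where
  toFun g := ⟨g.1 0 0, (g⁻¹).1 0 0,
    by rw [← borel_mul_zero_zero, mul_inv_cancel]; simp,
    by rw [← borel_mul_zero_zero, inv_mul_cancel]; simp⟩
  map_one' := by ext; simp
  map_mul' g h := Units.ext (borel_mul_zero_zero g h)

/-- The lower right entry of an upper triangular matrix. -/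
def borelSnd : borel R →* Rˣ where
  toFun g := ⟨g.1 1 1, (g⁻¹).1 1 1,
    by rw [← borel_mul_one_one, mul_inv_cancel]; simp,
    by rw [← borel_mul_one_one, inv_mul_cancel]; simp⟩
  map_one' := by ext; simp
  map_mul' g h := Units.ext (borel_mul_one_one g h)

end Borel

/-! ### Function spaces and their actions -/

section Functions

variable (L : Type) [NormedField L]

/-- The linear endomorphism `φ ↦ φ ∘ f` of `C(X, V)`. -/
def precomp {X V : Type} [TopologicalSpace X] [TopologicalSpace V] [AddCommGroup V] [Module L V]
    [IsTopologicalAddGroup V] [ContinuousConstSMul L V] (f : C(X, X)) : C(X, V) →ₗ[L] C(X, V) where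
  toFun φ := φ.comp f
  map_add' _ _ := rfl
  map_smul' _ _ := rfl

/-- Right multiplication on a topological group (or monoid). -/
def mulRightMap {X : Type} [TopologicalSpace X] [Mul X] [ContinuousMul X] (g : X) : C(X, X) :=
  ⟨fun x => x * g, by fun_prop⟩

/-- Left multiplication on a topological group (or monoid). -/
def mulLeftMap {X : Type} [TopologicalSpace X] [Mul X] [ContinuousMul X] (g : X) : C(X, X) :=
  ⟨fun x => g * x, by fun_prop⟩

/-- The action `(g ⋆ φ)(x) = φ(x g)` of a topological group `X` on `C(X, V)`. -/
def rightTranslation (X V : Type) [TopologicalSpace X] [Group X] [ContinuousMul X]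
    [TopologicalSpace V] [AddCommGroup V] [Module L V]
    [IsTopologicalAddGroup V] [ContinuousConstSMul L V] : Representation L X C(X, V) where
  toFun g := precomp L (mulRightMap g)
  map_one' := by ext φ x; simp [precomp, mulRightMap]
  map_mul' g h := by ext φ x; simp [precomp, mulRightMap, mul_assoc]

/-- The space of continuous functions `GL₂(𝔸) → L`, as a representation of `GL₂(ℚ)`
for `(γ * φ)(x) = φ(γ⁻¹ x)`. -/
def contFun : Rep.{0} L (GL (Fin 2) ℚ) :=
  Rep.of (X := C(GL (Fin 2) Adele, L))
    { toFun := fun γ => precomp L (mulLeftMap (Matrix.GeneralLinearGroup.map ratToAdele γ⁻¹))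
      map_one' := by ext φ x; simp [precomp, mulLeftMap]
      map_mul' := fun γ δ => by ext φ x; simp [precomp, mulLeftMap, mul_assoc] }

/-- The action `(g ⋆ φ)(x) = φ(x g)` of `GL₂(𝔸)` on the representation of `GL₂(ℚ)` on continuous
functions `GL₂(𝔸) → L`. -/
def adelicAction : GL (Fin 2) Adele →* End (contFun L) where
  toFun g := Rep.ofHom
    ⟨rightTranslation L (GL (Fin 2) Adele) L g, fun γ => by
      ext φ x
      simp [rightTranslation, precomp, mulLeftMap, mulRightMap, mul_assoc]⟩
  map_one' := by
    apply Rep.hom_ext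
    apply Representation.IntertwiningMap.ext
    exact map_one (rightTranslation L (GL (Fin 2) Adele) L)
  map_mul' g h := by
    apply Rep.hom_ext
    apply Representation.IntertwiningMap.ext
    exact map_mul (rightTranslation L (GL (Fin 2) Adele) L) g h

/-- `Hⁿ(GL₂(ℚ), C(GL₂(𝔸), L))` with its action of `GL₂(𝔸)`. -/
def cohomology (n : ℕ) : Rep.{0} L (GL (Fin 2) Adele) :=
  inducedRep (groupCohomology.functor L (GL (Fin 2) ℚ) n) (contFun L) (adelicAction L)

/-- `Hⁿ_c(GL₂(ℚ), C(GL₂(𝔸), L))` with its action of `GL₂(𝔸)`; supports are taken relative to the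
upper triangular subgroup of `GL₂(ℚ)`. -/
def compactCohomology (n : ℕ) : Rep.{0} L (GL (Fin 2) Adele) :=
  inducedRep (compactCohomologyFunctor (borel ℚ) n) (contFun L) (adelicAction L)

/-- The canonical map `Hⁿ_c(GL₂(ℚ), C(GL₂(𝔸), L)) → Hⁿ(GL₂(ℚ), C(GL₂(𝔸), L))`. -/
def compactToCohomology (n : ℕ) : compactCohomology L n ⟶ cohomology L n :=
  inducedRepMap (forgetSupports (borel ℚ) n) (contFun L) (adelicAction L)

/-- The space of continuous functions `𝔸ˣ / ℝ₊ˣ ℚˣ → L`, on which `GL₂(𝔸)` acts through the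
determinant, by `(g ⋆ h)(x) = h(x det g)`. -/
def detRep : Rep.{0} L (GL (Fin 2) Adele) :=
  Rep.of (X := C(IdeleQuot, L))
    ((rightTranslation L IdeleQuot L).comp
      ((QuotientGroup.mk' _).comp Matrix.GeneralLinearGroup.det))

/-- The action of `B(𝔸)` on continuous functions on `(𝔸ˣ / ℝ₊ˣ ℚˣ)²`, through the diagonal
torus: if `b` has diagonal entries `a`, `d`, then `(b ⋆ h)(s, t) = h(s a, t d)`. -/
def leviRep : Representation L (borel Adele) C(IdeleQuot × IdeleQuot, L) :=
  (rightTranslation L (IdeleQuot × IdeleQuot) L).comp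
    (((QuotientGroup.mk' _).comp borelFst).prod ((QuotientGroup.mk' _).comp borelSnd))

/-- The space of continuous `Φ : GL₂(𝔸) → C((𝔸ˣ / ℝ₊ˣ ℚˣ)², L)` with `Φ(b x) = b ⋆ Φ(x)` for all
`b ∈ B(𝔸)`. -/
def inducedSpace : Submodule L C(GL (Fin 2) Adele, C(IdeleQuot × IdeleQuot, L)) where
  carrier := {Φ | ∀ (b : borel Adele) (x : GL (Fin 2) Adele),
    Φ ((b : GL (Fin 2) Adele) * x) = leviRep L b (Φ x)}
  zero_mem' b x := by simp
  add_mem' {Φ Ψ} hΦ hΨ b x := by simp [hΦ b x, hΨ b x]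
  smul_mem' c Φ hΦ b x := by simp [hΦ b x]

instance : AddCommGroup (inducedSpace L) := Submodule.addCommGroup _

instance : Module L (inducedSpace L) := Submodule.module _

/-- The continuous induction from `B(𝔸)` to `GL₂(𝔸)` of the space of continuous functions on
`(𝔸ˣ / ℝ₊ˣ ℚˣ)²`; the group `GL₂(𝔸)` acts by `(g ⋆ Φ)(x) = Φ(x g)`. -/
def boundaryRep : Rep.{0} L (GL (Fin 2) Adele) :=
  Rep.of (X := inducedSpace L)
    { toFun := fun g =>
        (rightTranslation L (GL (Fin 2) Adele) C(IdeleQuot × IdeleQuot, L) g).restrict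
          (p := inducedSpace L) (q := inducedSpace L) fun Φ hΦ b x => by
            simpa [rightTranslation, precomp, mulRightMap, mul_assoc] using hΦ b (x * g)
      map_one' := LinearMap.ext fun Φ => Subtype.ext <| DFunLike.congr_fun
        (map_one (rightTranslation L (GL (Fin 2) Adele) C(IdeleQuot × IdeleQuot, L))) Φ.1
      map_mul' := fun g h => LinearMap.ext fun Φ => Subtype.ext <| DFunLike.congr_fun
        (map_mul (rightTranslation L (GL (Fin 2) Adele) C(IdeleQuot × IdeleQuot, L)) g h) Φ.1 }

end Functions

end AdelicCohomology

end

open AdelicCohomology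

/-! The cone gives a long exact sequence relating `H^i_c(G)`, `H^i(G)` and `H^i(B)`. The restriction
from `H^0(G)` to `H^0(B)` is an inclusion of invariants, so everything follows from the vanishing of
`H^i(G)` for `i ≥ 2` and of `H^i(B)` for `i ≥ 1`, and from the computation of the two spaces of
invariants.

Vanishing for `G`: by strong approximation the `GL₂(ℚ)`-translates of the open subgroup `sanovOpen`
cover `GL₂(𝔸)`, so `C(GL₂(𝔸), L)` is coinduced from `sanovGroup` and Shapiro's lemma
(`isZero_leftRep_iff`) applies. The congruence condition at 2 makes this group free on two
generators (Sanov), and free groups have no cohomology above degree 1.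

Vanishing for `B`: the same argument with the open set `borelOpen`, whose condition at 3 rejects
`-1`, leaves the infinite cyclic group of integral unipotent matrices. Only `H^1` remains, and it
vanishes if `φ(x + 1) - φ(x) = f(x)` is solvable in continuous functions. On `∏ ℤ_ℓ` a solution
interpolates the partial sums of `f` over the natural numbers. These are uniformly continuous
because if `f` is nearly `N`-periodic, then going from `n` to `n + p^k N` changes the sum by nearly
`p^k` times a constant, which is small in `L`. The coordinate `slope` carries this over to
`borelOpen`.

Invariants: `L` is totally disconnected, `ℝ` is connected and `ℚ` is dense in the finite adeles, so
a continuous function invariant under rational unipotents is invariant under adelic ones, and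
positive real scalars act trivially. Hence `B(ℚ)`-invariant functions are functions of the induced
representation evaluated at `(1, 1)` (`exists_evalOne_eq`), and `GL₂(ℚ)`-invariant functions depend
only on the class of the determinant (`exists_detClass_eq`). -/

namespace AdelicCohomology

/-! ### Cohomology of free groups and of cyclic groups -/

section Free

universe u

variable {k : Type u} {Γ : Type u} [CommRing k] [Group Γ]

open groupCohomology

/-- Over a free group, every `1`-cocycle lifts along a surjection of coefficients. -/
lemma exists_cocycles₁_lift {ι : Type*} (e : FreeGroup ι ≃* Γ) {A B : Rep.{u} k Γ} (f : A ⟶ B)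
    (hf : Function.Surjective f.hom) (z : cocycles₁ B) :
    ∃ w : cocycles₁ A, ∀ g, f.hom (w g) = z g := by
  have hz := (mem_cocycles₁_iff (A := B) z).1 z.2
  choose y hy using fun i => hf (z (e (FreeGroup.of i)))
  -- A cocycle is the translation part of an action by affine maps `x ↦ ρ(g) x + t`. Freeness allows
  -- the translation parts of the generators to be any lifts `y i`.
  let T : FreeGroup ι →* Equiv.Perm A := FreeGroup.lift fun i =>
    { toFun := fun x => A.ρ (e (FreeGroup.of i)) x + y i
      invFun := fun x => A.ρ (e (FreeGroup.of i))⁻¹ (x - y i)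
      left_inv := fun x => by simp
      right_inv := fun x => by simp }
  have key : ∀ g : FreeGroup ι, ∃ t : A, f.hom t = z (e g) ∧ ∀ x, T g x = A.ρ (e g) x + t := by
    have hinv : ∀ g : FreeGroup ι, (∃ t : A, f.hom t = z (e g) ∧ ∀ x, T g x = A.ρ (e g) x + t) →
        ∃ t : A, f.hom t = z (e g⁻¹) ∧ ∀ x, T g⁻¹ x = A.ρ (e g⁻¹) x + t := by
      rintro g ⟨t, ht, h⟩
      refine ⟨-A.ρ (e g)⁻¹ t, ?_, fun x => ?_⟩
      · have h1 := hz (e g)⁻¹ (e g)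
        rw [inv_mul_cancel, cocycles₁_map_one] at h1
        rw [map_neg, Rep.hom_comm_apply, ht, map_inv e, neg_eq_iff_add_eq_zero]
        exact h1.symm
      · rw [map_inv, Equiv.Perm.inv_eq_iff_eq, h]
        simp
    intro g
    induction g using FreeGroup.induction_on with
    | C1 => exact ⟨0, by simp, fun x => by simp⟩
    | of i => exact ⟨y i, hy i, fun x => by simp [T]⟩
    | inv_of i h => exact hinv _ h
    | mul g h hg hh =>
      obtain ⟨t, ht, htx⟩ := hg
      obtain ⟨s, hs, hsx⟩ := hh
      refine ⟨A.ρ (e g) s + t, ?_, fun x => ?_⟩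
      · rw [map_add, Rep.hom_comm_apply, ht, hs, map_mul]
        exact (hz _ _).symm
      · rw [map_mul, Equiv.Perm.mul_apply, hsx, htx]
        simp [add_assoc]
  choose w hw hT using fun g => key (e.symm g)
  refine ⟨⟨w, (mem_cocycles₁_iff w).2 fun g h => ?_⟩, fun g => by simpa using hw g⟩
  -- The cocycle identity is the composition law of affine maps evaluated at `0`.
  have h1 := hT (g * h) 0
  rw [map_mul, map_mul, Equiv.Perm.mul_apply, hT, hT] at h1
  simpa using h1.symm

lemma isZero_coind_bot (A : Rep.{u} k (⊥ : Subgroup Γ)) (n : ℕ) :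
    Limits.IsZero (groupCohomology (Rep.coind (⊥ : Subgroup Γ).subtype A) (n + 1)) :=
  (isZero_groupCohomology_succ_of_subsingleton A n).of_iso (coindIso A (n + 1))

/-- The embedding of a representation in the one coinduced from the trivial group. -/
noncomputable def toCoindBot (A : Rep.{u} k Γ) :
    A ⟶ Rep.coind (⊥ : Subgroup Γ).subtype (Rep.res (⊥ : Subgroup Γ).subtype A) :=
  Rep.resCoindToHom _ _ _ (𝟙 _)

instance (A : Rep.{u} k Γ) : Mono (toCoindBot A) := by
  refine (Rep.mono_iff_injective _).2 fun x y h => ?_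
  have := congrFun (congrArg Subtype.val h) 1
  simpa [toCoindBot] using this

/-- The short exact sequence embedding a representation in an acyclic one. -/
lemma shortExact_toCoindBot (A : Rep.{u} k Γ) :
    (ShortComplex.mk (toCoindBot A) (Limits.cokernel.π (toCoindBot A))
      (Limits.cokernel.condition _)).ShortExact :=
  { exact := ShortComplex.exact_cokernel _
    mono_f := inferInstanceAs (Mono (toCoindBot A))
    epi_g := inferInstanceAs (Epi (Limits.cokernel.π (toCoindBot A))) }

/-- The cohomology of a free group vanishes in degrees at least `2`. -/
theorem isZero_groupCohomology_of_free {ι : Type*} (e : FreeGroup ι ≃* Γ) (n : ℕ) :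
    ∀ A : Rep.{u} k Γ, Limits.IsZero (groupCohomology A (n + 2)) := by
  induction n with
  | zero =>
    intro A
    have hX := shortExact_toCoindBot A
    -- Dimension shifting: the connecting map onto `H²` is surjective since the middle term is
    -- acyclic, and it is zero because cocycles lift from the quotient.
    have hepi : Epi (δ hX 1 2 rfl) := epi_δ_of_isZero hX 1 (isZero_coind_bot _ 1)
    have hsurj : Epi ((functor k Γ 1).map (Limits.cokernel.π (toCoindBot A))) := by
      refine (ModuleCat.epi_iff_surjective _).2 fun x => ?_
      induction x using H1_induction_on with
      | h z =>
        obtain ⟨w, hw⟩ := exists_cocycles₁_lift e (Limits.cokernel.π (toCoindBot A))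
          ((Rep.epi_iff_surjective _).1 inferInstance) z
        refine ⟨H1π _ w, ?_⟩
        have := H1π_comp_map_apply (MonoidHom.id Γ) (Limits.cokernel.π (toCoindBot A)) w
        refine this.trans (congrArg _ (Subtype.ext (funext hw)))
    have h0 : (functor k Γ 1).map (Limits.cokernel.π (toCoindBot A)) ≫ δ hX 1 2 rfl = 0 :=
      (mapShortComplex₃ hX (i := 1) (j := 2) rfl).zero
    have : δ hX 1 2 rfl = 0 := hsurj.left_cancellation _ _ (h0.trans Limits.comp_zero.symm)
    exact Limits.IsZero.of_epi_eq_zero _ this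
  | succ n ih =>
    intro A
    have hX := shortExact_toCoindBot A
    have : IsIso (δ hX (n + 2) (n + 3) rfl) :=
      isIso_δ_of_isZero hX (n + 2) (isZero_coind_bot _ (n + 1)) (isZero_coind_bot _ (n + 2))
    exact (ih _).of_iso (asIso (δ hX (n + 2) (n + 3) rfl)).symm

/-- If `u` generates `Γ` and `u - 1` is surjective on `A`, then `H¹(Γ, A) = 0`. -/
theorem isZero_groupCohomology_one_of_zpowers (u : Γ) (hu : ∀ g, g ∈ Subgroup.zpowers u)
    (A : Rep.{u} k Γ) (hA : ∀ a : A, ∃ b : A, A.ρ u b - b = a) :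
    Limits.IsZero (groupCohomology A 1) := by
  rw [ModuleCat.isZero_iff_subsingleton]
  refine subsingleton_of_forall_eq 0 fun x => ?_
  induction x using H1_induction_on with
  | h z =>
    obtain ⟨b, hb⟩ := hA (z u)
    refine (H1π_eq_zero_iff _).2 ⟨b, funext fun g => ?_⟩
    have hz := (mem_cocycles₁_iff (A := A) z).1 z.2
    -- The elements at which the cocycle agrees with the coboundary of `b` form a subgroup, so
    -- agreement at the generator `u` suffices.
    let S : Subgroup Γ :=
      { carrier := {g | A.ρ g b - b = z g}
        one_mem' := by simp
        mul_mem' := fun {g h} hg hh => by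
          simp only [Set.mem_ofPred_eq] at hg hh ⊢
          rw [hz, ← hg, ← hh]
          simp
        inv_mem' := fun {g} hg => by
          simp only [Set.mem_ofPred_eq] at hg ⊢
          have h1 := hz g⁻¹ g
          rw [inv_mul_cancel, cocycles₁_map_one, ← hg] at h1
          have h2 := eq_neg_of_add_eq_zero_right h1.symm
          rw [h2]
          simp }
    have : g ∈ S := (Subgroup.zpowers_le.2 (show u ∈ S from hb)) (hu g)
    exact this

end Free

/-! ### Shapiro's lemma for spaces of continuous functions -/

section Shapiro

variable (L : Type) [NormedField L] {X : Type} [TopologicalSpace X] [Group X] [ContinuousMul X]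
  {H : Type} [Group H] (j : H →* X)

/-- The space of continuous functions on `X`, as a representation of a group `H` that maps
to `X`, for `(h * φ)(x) = φ(h⁻¹ x)`. -/
noncomputable def leftRep : Rep.{0} L H :=
  Rep.of (X := C(X, L))
    { toFun := fun h => precomp L (mulLeftMap (j h⁻¹))
      map_one' := by ext φ x; simp [precomp, mulLeftMap]
      map_mul' := fun γ δ => by ext φ x; simp [precomp, mulLeftMap, mul_assoc] }

variable {j}
variable {U : Set X} {Γ : Subgroup H} (hΓ : ∀ h x, x ∈ U → (j h * x ∈ U ↔ h ∈ Γ))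

/-- Left multiplication on a subset. -/
def mulLeftOn (h : Γ) : C(U, U) :=
  ⟨fun x => ⟨j h * x, (hΓ h x x.2).2 h.2⟩, by fun_prop⟩

/-- The space of continuous functions on a `Γ`-stable subset, for `(h * φ)(x) = φ(h⁻¹ x)`. -/
noncomputable def leftRepOn : Rep.{0} L Γ :=
  Rep.of (X := C(U, L))
    { toFun := fun h => precomp L (mulLeftOn hΓ h⁻¹)
      map_one' := by ext φ x; simp [precomp, mulLeftOn]
      map_mul' := fun γ δ => by ext φ x; simp [precomp, mulLeftOn, mul_assoc] }

/-- Restriction of functions to a subset. -/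
noncomputable def leftRepRestrict : Rep.res Γ.subtype (leftRep L j) ⟶ leftRepOn L hΓ :=
  Rep.ofHom (ρ := (leftRep L j).ρ.comp Γ.subtype)
    { toFun := fun φ : C(X, L) => φ.restrict U
      map_add' := fun _ _ => rfl
      map_smul' := fun _ _ => rfl
      isIntertwining' := fun _ => rfl }

/-- A function on `X` gives a function on `H` with values in the functions on `U`. -/
noncomputable def leftRepToCoind : leftRep L j ⟶ Rep.coind Γ.subtype (leftRepOn L hΓ) :=
  Rep.resCoindToHom _ _ _ (leftRepRestrict L hΓ)

lemma leftRepToCoind_apply (φ : C(X, L)) (h : H) (x : U) :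
    DFunLike.coe (F := C(U, L)) (((leftRepToCoind L hΓ).hom φ).1 h) x = φ (j h⁻¹ * x) := rfl

/-- By `hΓ` and `hcov` the space `X` is the disjoint union of the translates of `U`, indexed by
cosets of `Γ`. Since these are open, a continuous function on `X` is an arbitrary family of
continuous functions on them. -/
lemma isIso_leftRepToCoind (hU : IsOpen U) (hcov : ∀ x, ∃ h, j h * x ∈ U) :
    IsIso (leftRepToCoind L hΓ) := by
  have : Mono (leftRepToCoind L hΓ) := by
    refine (Rep.mono_iff_injective _).2 fun (φ : C(X, L)) (ψ : C(X, L)) h => ?_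
    refine ContinuousMap.ext fun x => ?_
    obtain ⟨g, hg⟩ := hcov x
    have h1 := DFunLike.congr_fun (F := C(U, L)) (congrFun (congrArg Subtype.val h) g)
      (⟨_, hg⟩ : U)
    rw [leftRepToCoind_apply, leftRepToCoind_apply] at h1
    simpa using h1
  have : Epi (leftRepToCoind L hΓ) := by
    refine (Rep.epi_iff_surjective _).2 fun f => ?_
    choose s hs using hcov
    let F : H → C(U, L) := f.1
    -- Two elements moving `x` into `U` differ by an element of `Γ`, and `F` is `Γ`-equivariant; so
    -- the value does not depend on the choice `s x`.
    have hF : ∀ (g : H) (x : X) (hg : j g * x ∈ U), F g ⟨_, hg⟩ = F (s x) ⟨_, hs x⟩ := by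
      intro g x hg
      have hm : s x * g⁻¹ ∈ Γ := by
        rw [← hΓ _ _ hg, ← mul_assoc, ← map_mul, inv_mul_cancel_right]
        exact hs x
      have h1 : F (s x * g⁻¹ * g) = precomp L (mulLeftOn hΓ (⟨_, hm⟩ : Γ)⁻¹) (F g) :=
        f.2 ⟨_, hm⟩ g
      rw [inv_mul_cancel_right] at h1
      rw [h1]
      refine congrArg (F g) (Subtype.ext ?_)
      simp [mulLeftOn, ← mul_assoc]
    refine ⟨(⟨fun x => F (s x) ⟨_, hs x⟩, ?_⟩ : C(X, L)), Subtype.ext (funext fun g =>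
      ContinuousMap.ext fun x => ?_)⟩
    · refine continuous_iff_continuousAt.2 fun x => ?_
      -- Near `x` the fixed element `s x` still moves points into `U`, so locally the function is `F
      -- (s x)` after a translation.
      have hopen : IsOpen {y | j (s x) * y ∈ U} := hU.preimage (continuous_const_mul _)
      refine ContinuousOn.continuousAt (s := {y | j (s x) * y ∈ U}) ?_ (hopen.mem_nhds (hs x))
      rw [continuousOn_iff_continuous_domRestrict]
      have h2 : Continuous fun y : {y | j (s x) * y ∈ U} => F (s x) ⟨j (s x) * y, y.2⟩ := by
        fun_prop
      exact h2.congr fun y => hF _ _ y.2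
    · refine (leftRepToCoind_apply L hΓ _ g x).trans ?_
      have h3 : j g * (j g⁻¹ * x) = x := by simp
      have h4 : j g * (j g⁻¹ * (x : X)) ∈ U := h3.symm ▸ x.2
      refine (hF g _ h4).symm.trans (congrArg (F g) (Subtype.ext h3))
  exact isIso_of_mono_of_epi _

/-- Shapiro's lemma for functions on a space which is induced from an open subset. -/
theorem isZero_leftRep_iff (hU : IsOpen U) (hcov : ∀ x, ∃ h, j h * x ∈ U) (n : ℕ) :
    Limits.IsZero (groupCohomology (leftRep L j) n) ↔
      Limits.IsZero (groupCohomology (leftRepOn L hΓ) n) :=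
  have := isIso_leftRepToCoind L hΓ hU hcov
  ((groupCohomology.functor L H n).mapIso (asIso (leftRepToCoind L hΓ)) ≪≫
    groupCohomology.coindIso (leftRepOn L hΓ) n).isZero_iff

end Shapiro

end AdelicCohomology

namespace AdelicCohomology

/-! ### Cohomology classes represented by explicit cocycles -/

section Classes

universe u

variable {k : Type u} [CommRing k] {K K' : CochainComplex (ModuleCat.{u} k) ℕ}

/-- A cocycle as an element of the module of cycles. -/
noncomputable def toCycle (K : CochainComplex (ModuleCat.{u} k) ℕ) (n : ℕ) :
    LinearMap.ker (K.d n (n + 1)).hom →ₗ[k] K.cycles n :=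
  (K.liftCycles (ModuleCat.ofHom (LinearMap.ker (K.d n (n + 1)).hom).subtype) (n + 1) (by simp)
    (by ext x; exact x.2)).hom

lemma iCycles_toCycle (n : ℕ) (z : LinearMap.ker (K.d n (n + 1)).hom) :
    (K.iCycles n).hom (toCycle K n z) = z.1 :=
  congrArg (fun f => f.hom z) (K.liftCycles_i (ModuleCat.ofHom
    (LinearMap.ker (K.d n (n + 1)).hom).subtype) (n + 1) (by simp) (by ext x; exact x.2))

lemma iCycles_injective (n : ℕ) : Function.Injective (K.iCycles n).hom :=
  (ModuleCat.mono_iff_injective (K.iCycles n)).1 inferInstance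

/-- The class in homology of a cocycle. -/
noncomputable def cocycleClass (K : CochainComplex (ModuleCat.{u} k) ℕ) (n : ℕ) :
    LinearMap.ker (K.d n (n + 1)).hom →ₗ[k] K.homology n :=
  (K.homologyπ n).hom ∘ₗ toCycle K n

lemma cocycleClass_surjective (n : ℕ) : Function.Surjective (cocycleClass K n) := by
  intro x
  obtain ⟨z, rfl⟩ := (ModuleCat.epi_iff_surjective (K.homologyπ n)).1 inferInstance x
  have hz : (K.d n (n + 1)).hom ((K.iCycles n).hom z) = 0 :=
    congrArg (fun f => f.hom z) (K.iCycles_d n (n + 1))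
  exact ⟨⟨_, hz⟩, congrArg (K.homologyπ n).hom (iCycles_injective n (iCycles_toCycle n ⟨_, hz⟩))⟩

lemma cocycleClass_eq_zero_iff (n : ℕ) (z : LinearMap.ker (K.d (n + 1) (n + 1 + 1)).hom) :
    cocycleClass K (n + 1) z = 0 ↔ ∃ y, (K.d n (n + 1)).hom y = z.1 := by
  have hex : (ShortComplex.mk (K.toCycles n (n + 1)) (K.homologyπ (n + 1)) (by simp)).Exact :=
    ShortComplex.exact_of_g_is_cokernel _ (K.homologyIsCokernel n (n + 1) (by simp))
  have hi : ∀ y, (K.iCycles (n + 1)).hom ((K.toCycles n (n + 1)).hom y) = (K.d n (n + 1)).hom y :=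
    fun y => congrArg (fun f => f.hom y) (K.toCycles_i n (n + 1))
  constructor
  · intro h
    obtain ⟨y, hy⟩ := (ShortComplex.moduleCat_exact_iff _).1 hex _ h
    exact ⟨y, (hi y).symm.trans ((congrArg (K.iCycles (n + 1)).hom hy).trans
      (iCycles_toCycle _ z))⟩
  · rintro ⟨y, hy⟩
    have : toCycle K (n + 1) z = (K.toCycles n (n + 1)).hom y :=
      iCycles_injective _ ((iCycles_toCycle _ z).trans (hy.symm.trans (hi y).symm))
    exact (congrArg (K.homologyπ (n + 1)).hom this).trans
      (congrArg (fun f => f.hom y) (K.toCycles_comp_homologyπ n (n + 1)))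

/-- A morphism of complexes maps cocycles to cocycles. -/
noncomputable def mapCocycle (f : K ⟶ K') (n : ℕ) (z : LinearMap.ker (K.d n (n + 1)).hom) :
    LinearMap.ker (K'.d n (n + 1)).hom :=
  ⟨(f.f n).hom z.1, (congrArg (fun g => g.hom z.1) (f.comm n (n + 1))).trans
    ((congrArg (f.f (n + 1)).hom z.2).trans (map_zero _))⟩

lemma homologyMap_cocycleClass (f : K ⟶ K') (n : ℕ) (z : LinearMap.ker (K.d n (n + 1)).hom) :
    (HomologicalComplex.homologyMap f n).hom (cocycleClass K n z) =
      cocycleClass K' n (mapCocycle f n z) := by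
  refine (congrArg (fun g => g.hom (toCycle K n z))
    (HomologicalComplex.homologyπ_naturality f n)).trans ?_
  refine congrArg (K'.homologyπ n).hom (iCycles_injective n ?_)
  refine (congrArg (fun g => g.hom (toCycle K n z)) (HomologicalComplex.cyclesMap_i f n)).trans ?_
  exact (congrArg (f.f n).hom (iCycles_toCycle n z)).trans
    (iCycles_toCycle n (mapCocycle f n z)).symm

lemma subsingleton_homology_of_exact (n : ℕ)
    (h : ∀ z, (K.d (n + 1) (n + 1 + 1)).hom z = 0 → ∃ y, (K.d n (n + 1)).hom y = z) :
    Subsingleton (K.homology (n + 1)) := by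
  refine subsingleton_of_forall_eq 0 fun x => ?_
  obtain ⟨z, rfl⟩ := cocycleClass_surjective _ x
  exact (cocycleClass_eq_zero_iff _ _).2 (h z.1 z.2)

lemma exists_d_eq_of_isZero (n : ℕ) (h : Limits.IsZero (K.homology (n + 1)))
    (z : K.X (n + 1)) (hz : (K.d (n + 1) (n + 1 + 1)).hom z = 0) :
    ∃ y, (K.d n (n + 1)).hom y = z := by
  have := ModuleCat.subsingleton_of_isZero h
  exact (cocycleClass_eq_zero_iff _ ⟨z, hz⟩).1 (Subsingleton.elim _ _)

end Classes

/-! ### The long exact sequence of the cone, on cochains -/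

section Relative

universe u

variable {k G : Type u} [CommRing k] [Group G] {B : Subgroup G} {A : Rep.{u} k G}

lemma relCochains_d_apply (n : ℕ) (z : relX B A n) :
    ((relCochains B A).d n (n + 1)).hom z = (relD B A n).hom z :=
  congrArg (fun f => f.hom z) (show (relCochains B A).d n (n + 1) = relD B A n by
    simp [relCochains])

lemma inhomogeneousCochains_d_apply (n : ℕ) (c : (Fin n → G) → A) :
    ((groupCohomology.inhomogeneousCochains A).d n (n + 1)).hom c =
      (inhomogeneousCochains.d A n).hom c :=
  congrArg (fun f => f.hom c) (groupCohomology.inhomogeneousCochains.d_def A n)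

lemma exists_inhomogeneousCochains_d_eq {H : Type u} [Group H] {A : Rep.{u} k H} (n : ℕ)
    (h : Limits.IsZero (groupCohomology A (n + 1))) (c : (Fin (n + 1) → H) → A)
    (hc : (inhomogeneousCochains.d A (n + 1)).hom c = 0) :
    ∃ c', (inhomogeneousCochains.d A n).hom c' = c := by
  obtain ⟨y, hy⟩ := exists_d_eq_of_isZero (K := groupCohomology.inhomogeneousCochains A) n h c
    ((inhomogeneousCochains_d_apply _ c).trans hc)
  exact ⟨y, (inhomogeneousCochains_d_apply _ y).symm.trans hy⟩

lemma relD_succ_eq_zero_iff (n : ℕ) (c : (Fin (n + 1) → G) → A) (b : (Fin n → B) → A) :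
    (relD B A (n + 1)).hom (c, b) = 0 ↔ (inhomogeneousCochains.d A (n + 1)).hom c = 0 ∧
      ((restrictCochains B A).f (n + 1)).hom c =
        (inhomogeneousCochains.d (Rep.res B.subtype A) n).hom b :=
  Prod.mk_eq_zero.trans (and_congr_right' sub_eq_zero)

/-- In degree 0 restriction is already injective on cochains, both sides being copies of `A`. In
degree at least 2 a cocycle `(c, b)` is removed in two stages: `hG` writes `c` as a coboundary, and
what is left of `b` is a cocycle on `B`, which `hB` makes a coboundary. -/
theorem subsingleton_compactCohomology
    (hG : ∀ n, Limits.IsZero (groupCohomology A (n + 2)))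
    (hB : ∀ n, Limits.IsZero (groupCohomology (Rep.res B.subtype A) (n + 1)))
    (i : ℕ) (hi : i ≠ 1) : Subsingleton ((compactCohomologyFunctor B i).obj A) := by
  match i, hi with
  | 0, _ =>
    refine subsingleton_of_forall_eq (0 : (relCochains B A).homology 0) fun x => ?_
    obtain ⟨⟨z, hz⟩, rfl⟩ := cocycleClass_surjective (K := relCochains B A) _ x
    have hz0 : z = 0 := by
      have h2 : ((restrictCochains B A).f 0).hom z = 0 :=
        congrArg Prod.snd ((relCochains_d_apply 0 z).symm.trans hz)
      refine funext fun g => ?_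
      refine Eq.trans (congrArg z (Subsingleton.elim _ _))
        (congrFun h2 (fun i => Fin.elim0 i))
    subst hz0
    exact map_zero (cocycleClass (relCochains B A) 0)
  | n + 2, _ =>
    refine subsingleton_homology_of_exact (K := relCochains B A) (n + 1) fun z hz => ?_
    obtain ⟨hc, hb⟩ := (relD_succ_eq_zero_iff _ z.1 z.2).1 ((relCochains_d_apply _ z).symm.trans hz)
    obtain ⟨c', hc'⟩ := exists_inhomogeneousCochains_d_eq _ (hG n) _ hc
    rw [← hc', restrictCochains_d, eq_comm, ← sub_eq_zero, ← map_sub] at hb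
    obtain ⟨b', hb'⟩ := exists_inhomogeneousCochains_d_eq _ (hB n) _ hb
    -- The sign compensates for the minus in the differential: `res c' - d(-b') = res c' + (b - res
    -- c') = b`.
    refine ⟨(c', -b'), (relCochains_d_apply _ _).trans (Prod.ext hc' ?_)⟩
    refine Eq.trans (congrArg (fun y => _ - y) ((map_neg _ b').trans (congrArg _ hb'))) ?_
    exact (sub_neg_eq_add _ _).trans (add_sub_cancel _ _)

/-- The obstruction to completing a cocycle `c` to a pair `(c, b)` is the class of its restriction
in `H¹(B, A)`. -/
theorem forgetSupports_surjective
    (hB : Limits.IsZero (groupCohomology (Rep.res B.subtype A) 1)) :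
    Function.Surjective ((forgetSupports B 1).app A).hom := by
  intro x
  obtain ⟨⟨c, hc⟩, rfl⟩ :=
    cocycleClass_surjective (K := groupCohomology.inhomogeneousCochains A) _ x
  have hc' := (inhomogeneousCochains_d_apply _ c).symm.trans hc
  obtain ⟨b, hb⟩ := exists_inhomogeneousCochains_d_eq 0 hB (((restrictCochains B A).f 1).hom c)
    ((restrictCochains_d B A 1 c).symm.trans ((congrArg _ hc').trans (map_zero _)))
  have hz : ((relCochains B A).d 1 2).hom (c, b) = 0 :=
    (relCochains_d_apply _ _).trans ((relD_succ_eq_zero_iff 0 c b).2 ⟨hc', hb.symm⟩)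
  exact ⟨cocycleClass (relCochains B A) 1 ⟨(c, b), hz⟩,
    homologyMap_cocycleClass ((forgetCochains B).app A) 1 ⟨(c, b), hz⟩⟩

lemma inhomogeneousCochains_d_zero_eq_zero_iff {H : Type u} [Group H] {A : Rep.{u} k H}
    (c : (Fin 0 → H) → A) :
    (inhomogeneousCochains.d A 0).hom c = 0 ↔ ∀ g, A.ρ g (c default) = c default := by
  have h1 : ∀ g, (inhomogeneousCochains.d A 0).hom c g = A.ρ (g 0) (c default) - c default := by
    intro g
    rw [inhomogeneousCochains.d_hom_apply, sub_eq_add_neg]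
    refine congrArg₂ _ (congrArg _ (congrArg c (Subsingleton.elim _ _))) ?_
    simpa using congrArg c (Subsingleton.elim _ _)
  constructor
  · intro h g
    exact sub_eq_zero.1 ((h1 fun _ => g).symm.trans (congrFun h _))
  · intro h
    exact funext fun g => (h1 g).trans (sub_eq_zero.2 (h _))

/-- The cocycles `(0, b)` for `b` invariant under `B`. -/
noncomputable def boundaryCocycle :
    (Rep.res B.subtype A).ρ.invariants →ₗ[k] LinearMap.ker ((relCochains B A).d 1 2).hom where
  toFun b := ⟨((0, fun _ => b.1) : ((Fin 1 → G) → A) × ((Fin 0 → B) → A)),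
    (relCochains_d_apply _ _).trans ((relD_succ_eq_zero_iff 0 _ _).2 ⟨map_zero _,
      (map_zero _).trans ((inhomogeneousCochains_d_zero_eq_zero_iff (H := B)
        (A := Rep.res B.subtype A) fun _ => b.1).2 b.2).symm⟩)⟩
  map_add' _ _ := Subtype.ext (Prod.ext (add_zero _).symm rfl)
  map_smul' r _ := Subtype.ext (Prod.ext (smul_zero r).symm rfl)

/-- The boundary map `H⁰(B, A) → H¹_c(G, A)`. -/
noncomputable def boundaryClass :
    (Rep.res B.subtype A).ρ.invariants →ₗ[k] (compactCohomologyFunctor B 1).obj A :=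
  cocycleClass (relCochains B A) 1 ∘ₗ boundaryCocycle

/-- A coboundary in degree 1 is `(d c, res c)` with `c` an element of `A`; it equals `(0, b)`
exactly when `c = b` and `b` is `G`-invariant. -/
lemma boundaryClass_eq_zero_iff (b : (Rep.res B.subtype A).ρ.invariants) :
    boundaryClass b = 0 ↔ ∀ g, A.ρ g b.1 = b.1 := by
  refine (cocycleClass_eq_zero_iff (K := relCochains B A) 0 (boundaryCocycle b)).trans ?_
  constructor
  · rintro ⟨c, hc⟩
    have hc' := (relCochains_d_apply 0 c).symm.trans hc
    have h2 : c default = b.1 := by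
      refine Eq.trans (congrArg c (Subsingleton.elim _ _))
        (congrFun (congrArg Prod.snd hc') default)
    rw [← h2]
    exact (inhomogeneousCochains_d_zero_eq_zero_iff c).1 (congrArg Prod.fst hc')
  · intro h
    exact ⟨fun _ => b.1, (relCochains_d_apply 0 _).trans
      (Prod.ext ((inhomogeneousCochains_d_zero_eq_zero_iff _).2 h) rfl)⟩

/-- If `c = d y`, subtracting the coboundary of `y` turns `(c, b)` into `(0, b - res y)`, and the
cocycle condition says that `b - res y` is `B`-invariant. -/
lemma forgetSupports_eq_zero_iff (x : (compactCohomologyFunctor B 1).obj A) :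
    ((forgetSupports B 1).app A).hom x = 0 ↔ x ∈ Set.range (boundaryClass (B := B) (A := A)) := by
  have hf : ∀ z, ((forgetSupports B 1).app A).hom (cocycleClass (relCochains B A) 1 z) =
      cocycleClass (groupCohomology.inhomogeneousCochains A) 1
        (mapCocycle ((forgetCochains B).app A) 1 z) := fun z =>
    homologyMap_cocycleClass ((forgetCochains B).app A) 1 z
  constructor
  · intro h
    obtain ⟨z, rfl⟩ := cocycleClass_surjective (K := relCochains B A) _ x
    obtain ⟨y, hy⟩ := (cocycleClass_eq_zero_iff (K := groupCohomology.inhomogeneousCochains A) 0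
      _).1 ((hf z).symm.trans h)
    have hy' : (inhomogeneousCochains.d A 0).hom y = z.1.1 :=
      (inhomogeneousCochains_d_apply 0 y).symm.trans hy
    obtain ⟨-, hb⟩ := (relD_succ_eq_zero_iff 0 z.1.1 z.1.2).1
      ((relCochains_d_apply _ z.1).symm.trans z.2)
    rw [← hy', restrictCochains_d, eq_comm, ← sub_eq_zero, ← map_sub,
      inhomogeneousCochains_d_zero_eq_zero_iff] at hb
    refine ⟨⟨_, hb⟩, ?_⟩
    refine sub_eq_zero.1 ((map_sub (cocycleClass (relCochains B A) 1) _ _).symm.trans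
      ((cocycleClass_eq_zero_iff (K := relCochains B A) 0 _).2 ⟨-y, ?_⟩))
    refine (relCochains_d_apply 0 _).trans (Prod.ext ?_ ?_)
    · exact (map_neg _ y).trans ((congrArg _ hy').trans (zero_sub _).symm)
    · refine funext fun g => ?_
      obtain rfl : g = default := Subsingleton.elim _ _
      refine Eq.trans ?_ (sub_sub_cancel_left (z.1.2 default) _).symm
      rfl
  · rintro ⟨b, rfl⟩
    refine (hf (boundaryCocycle b)).trans (Eq.trans (congrArg _ (Subtype.ext ?_)) (map_zero _))
    rfl

/-- Applied to the endomorphisms given by right translations, this is the `GL₂(𝔸)`-equivariance of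
the boundary map. -/
lemma boundaryClass_naturality {A' : Rep.{u} k G} (φ : A ⟶ A')
    (b : (Rep.res B.subtype A).ρ.invariants) (b' : (Rep.res B.subtype A').ρ.invariants)
    (h : φ.hom b.1 = b'.1) :
    ((compactCohomologyFunctor B 1).map φ).hom (boundaryClass b) = boundaryClass b' := by
  refine (homologyMap_cocycleClass ((relCochainsFunctor B).map φ) 1 _).trans ?_
  refine congrArg _ (Subtype.ext (Prod.ext ?_ ?_))
  · exact funext fun g => map_zero φ.hom
  · exact funext fun g => h

end Relative

end AdelicCohomology

namespace AdelicCohomology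

open Topology Filter

/-! ### The topology of `∏ ℤ_ℓ` -/

section ZHat

/-- In `ℤ_ℓ` the integer `N` is a unit times the power of `ℓ` dividing it. -/
lemma padicInt_natCast_dvd_iff {ℓ : ℕ} [Fact ℓ.Prime] {N : ℕ} (hN : N ≠ 0) (z : ℤ_[ℓ]) :
    (N : ℤ_[ℓ]) ∣ z ↔ ‖z‖ ≤ (ℓ : ℝ) ^ (-(padicValNat ℓ N : ℤ)) := by
  rw [PadicInt.norm_le_pow_iff_mem_span_pow, Ideal.mem_span_singleton]
  have hN' : (N : ℤ_[ℓ]) ≠ 0 := Nat.cast_ne_zero.2 hN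
  have h := PadicInt.unitCoeff_spec hN'
  have hv : (N : ℤ_[ℓ]).valuation = padicValNat ℓ N := by
    zify
    rw [← PadicInt.valuation_coe, PadicInt.coe_natCast, Padic.valuation_natCast]
    simp
  rw [hv] at h
  conv_lhs => rw [h]
  exact Units.mul_left_dvd

lemma zHat_natCast_dvd_iff {N : ℕ} (z : ZHat) :
    (N : ZHat) ∣ z ↔ ∀ ℓ : Nat.Primes, (N : ℤ_[ℓ]) ∣ z ℓ := by
  constructor
  · rintro ⟨w, rfl⟩ ℓ
    exact ⟨w ℓ, rfl⟩
  · intro h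
    choose w hw using h
    exact ⟨w, funext hw⟩

lemma finite_setOf_dvd {N : ℕ} (hN : N ≠ 0) : {ℓ : Nat.Primes | (ℓ : ℕ) ∣ N}.Finite :=
  (N.primeFactors.finite_toSet.preimage Nat.Primes.coe_nat_injective.injOn).subset fun ℓ hℓ =>
    Nat.mem_primeFactors.2 ⟨ℓ.2, hℓ, hN⟩

/-- The multiples of a positive integer form a neighbourhood of `0` in `∏ ℤ_ℓ`. -/
lemma setOf_natCast_dvd_mem_nhds {N : ℕ} (hN : N ≠ 0) : {z : ZHat | (N : ZHat) ∣ z} ∈ 𝓝 0 := by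
  -- Only the finitely many primes dividing `N` impose a condition, which is what makes this a
  -- neighbourhood in the product topology.
  have h1 : Set.pi {ℓ : Nat.Primes | (ℓ : ℕ) ∣ N} (fun ℓ => {z : ℤ_[ℓ] | (N : ℤ_[ℓ]) ∣ z}) ⊆
      {z : ZHat | (N : ZHat) ∣ z} := by
    intro z hz
    refine (zHat_natCast_dvd_iff z).2 fun ℓ => ?_
    by_cases h : (ℓ : ℕ) ∣ N
    · exact hz ℓ h
    · refine (padicInt_natCast_dvd_iff hN _).2 ?_
      rw [padicValNat.eq_zero_of_not_dvd h]
      simpa using (z ℓ).norm_le_one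
  refine mem_of_superset (set_pi_mem_nhds (finite_setOf_dvd hN) fun ℓ _ => ?_) h1
  refine mem_of_superset (Metric.closedBall_mem_nhds (0 : ℤ_[ℓ])
    (ε := (ℓ : ℝ) ^ (-(padicValNat ℓ N : ℤ))) (by have := ℓ.2.pos; positivity)) fun z hz => ?_
  exact (padicInt_natCast_dvd_iff hN _).2 (by simpa using hz)

/-- Every neighbourhood of `0` in `∏ ℤ_ℓ` contains the multiples of a positive integer. -/
lemma exists_natCast_mul_mem {W : Set ZHat} (hW : W ∈ 𝓝 0) :
    ∃ N : ℕ, N ≠ 0 ∧ ∀ z : ZHat, (N : ZHat) * z ∈ W := by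
  rw [nhds_pi, Filter.mem_pi] at hW
  obtain ⟨I, hI, t, ht, hW⟩ := hW
  have h1 : ∀ ℓ : Nat.Primes, ∃ k : ℕ, ∀ z : ℤ_[ℓ], ‖z‖ ≤ (ℓ : ℝ) ^ (-(k : ℤ)) → z ∈ t ℓ := by
    intro ℓ
    obtain ⟨ε, hε, hb⟩ := Metric.mem_nhds_iff.1 (ht ℓ)
    obtain ⟨k, hk⟩ := PadicInt.exists_pow_neg_lt ℓ hε
    exact ⟨k, fun z hz => hb (by simpa using hz.trans_lt hk)⟩
  choose k hk using h1
  refine ⟨∏ ℓ ∈ hI.toFinset, (ℓ : ℕ) ^ k ℓ,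
    Finset.prod_ne_zero_iff.2 fun ℓ _ => pow_ne_zero _ ℓ.2.ne_zero, fun z => hW fun ℓ hℓ => ?_⟩
  refine hk ℓ _ ?_
  rw [PadicInt.norm_le_pow_iff_mem_span_pow, Ideal.mem_span_singleton]
  have h2 : (ℓ : ℕ) ^ k ℓ ∣ ∏ ℓ ∈ hI.toFinset, (ℓ : ℕ) ^ k ℓ :=
    Finset.dvd_prod_of_mem (fun ℓ : Nat.Primes => (ℓ : ℕ) ^ k ℓ) (hI.mem_toFinset.2 hℓ)
  have h3 := map_dvd (Nat.castRingHom ℤ_[ℓ]) h2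
  refine Dvd.dvd.mul_right ?_ _
  simpa using h3

/-- The integers are dense in `∏ ℤ_ℓ`. -/
lemma exists_natCast_dvd_sub {N : ℕ} (hN : N ≠ 0) (x : ZHat) :
    ∃ n : ℕ, (N : ZHat) ∣ x - n := by
  -- Chinese remainders: `appr` gives a natural number close to each component, at the precision
  -- prescribed by `N`.
  obtain ⟨n, hn⟩ := Nat.chineseRemainderOfFinset
    (fun ℓ : Nat.Primes => (x ℓ).appr (padicValNat ℓ N)) (fun ℓ => (ℓ : ℕ) ^ padicValNat ℓ N)
    (finite_setOf_dvd hN).toFinset (fun ℓ _ => pow_ne_zero _ ℓ.2.ne_zero)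
    (fun ℓ _ ℓ' _ h => Nat.Coprime.pow _ _ ((Nat.coprime_primes ℓ.2 ℓ'.2).2
      fun h' => h (Subtype.ext h')))
  refine ⟨n, (zHat_natCast_dvd_iff _).2 fun ℓ => (padicInt_natCast_dvd_iff hN _).2 ?_⟩
  by_cases h : (ℓ : ℕ) ∣ N
  · have h1 := hn ℓ (by simpa using h)
    rw [PadicInt.norm_le_pow_iff_mem_span_pow]
    have h2 := PadicInt.appr_spec (padicValNat ℓ N) (x ℓ)
    have h3 : (((x ℓ).appr (padicValNat ℓ N) : ℕ) : ℤ_[ℓ]) - n ∈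
        Ideal.span {((ℓ : ℕ) : ℤ_[ℓ]) ^ padicValNat ℓ N} := by
      rw [Ideal.mem_span_singleton]
      have h4 := map_dvd (Int.castRingHom ℤ_[ℓ]) h1.dvd
      simpa using h4
    have h5 := Ideal.add_mem _ h2 h3
    rw [sub_add_sub_cancel] at h5
    exact h5
  · rw [padicValNat.eq_zero_of_not_dvd h]
    simpa using ((x - (n : ZHat)) ℓ).norm_le_one

lemma denseRange_natCast_zHat : DenseRange (Nat.cast : ℕ → ZHat) := by
  intro x
  rw [mem_closure_iff_nhds]
  intro W hW
  have h0 : (fun z => x - z) ⁻¹' W ∈ 𝓝 (0 : ZHat) := by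
    have hc : ContinuousAt (fun z : ZHat => x - z) 0 := by fun_prop
    exact hc (by simpa using hW)
  obtain ⟨N, hN, hz⟩ := exists_natCast_mul_mem h0
  obtain ⟨n, z, hn⟩ := exists_natCast_dvd_sub hN x
  refine ⟨n, ?_, n, rfl⟩
  have h1 := hz z
  rw [Set.mem_preimage, ← hn, sub_sub_cancel] at h1
  exact h1

end ZHat

/-! ### Density of the rational numbers in the finite adeles -/

section Rational

lemma isOpenEmbedding_zHatToFinAdele : IsOpenEmbedding zHatToFinAdele :=
  RestrictedProduct.isOpenEmbedding_structureMap factOpen.out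

lemma finAdele_ext {x y : FinAdele} (h : ∀ ℓ, x ℓ = y ℓ) : x = y := Subtype.ext (funext h)

/-- Every finite adele becomes integral after multiplication by a positive integer. -/
lemma exists_natCast_mul_eq_zHat (x : FinAdele) :
    ∃ N : ℕ, N ≠ 0 ∧ ∃ z : ZHat, ratToFinAdele N * x = zHatToFinAdele z := by
  have hfin : {ℓ : Nat.Primes | ¬ ‖x ℓ‖ ≤ 1}.Finite := Filter.eventually_cofinite.1 x.2
  have h1 : ∀ ℓ : Nat.Primes, ∃ k : ℕ, ‖((ℓ : ℕ) : ℚ_[ℓ]) ^ k * x ℓ‖ ≤ 1 := by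
    intro ℓ
    have hlt : (ℓ : ℝ)⁻¹ < 1 := inv_lt_one_of_one_lt₀ (by exact_mod_cast ℓ.2.one_lt)
    have h := (tendsto_pow_atTop_nhds_zero_of_lt_one (by positivity) hlt).mul_const ‖x ℓ‖
    rw [zero_mul] at h
    obtain ⟨k, hk⟩ := (h.eventually (eventually_le_nhds zero_lt_one)).exists
    exact ⟨k, by simpa using hk⟩
  choose k hk using h1
  refine ⟨∏ ℓ ∈ hfin.toFinset, (ℓ : ℕ) ^ k ℓ,
    Finset.prod_ne_zero_iff.2 fun ℓ _ => pow_ne_zero _ ℓ.2.ne_zero, ?_⟩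
  set N := ∏ ℓ ∈ hfin.toFinset, (ℓ : ℕ) ^ k ℓ with hNdef
  have hint : ∀ ℓ : Nat.Primes, ‖(N : ℚ_[ℓ]) * x ℓ‖ ≤ 1 := by
    intro ℓ
    have hn : ∀ m : ℕ, ‖(m : ℚ_[ℓ])‖ ≤ 1 := fun m => by
      simpa using Padic.norm_int_le_one (p := (ℓ : ℕ)) m
    by_cases h : ℓ ∈ hfin.toFinset
    · rw [hNdef, ← Finset.prod_erase_mul _ _ h, Nat.cast_mul, mul_assoc, norm_mul]
      refine mul_le_one₀ (hn _) (norm_nonneg _) ?_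
      simpa using hk ℓ
    · rw [norm_mul]
      refine mul_le_one₀ (hn _) (norm_nonneg _) ?_
      simpa using h
  refine ⟨fun ℓ => ⟨_, hint ℓ⟩, finAdele_ext fun ℓ => ?_⟩
  change (((N : ℕ) : ℚ) : ℚ_[ℓ]) * x ℓ = (N : ℚ_[ℓ]) * x ℓ
  rw [Rat.cast_natCast]

lemma ratToFinAdele_natCast_eq (n : ℕ) : ratToFinAdele n = zHatToFinAdele n := by
  simp

/-- The rational numbers are dense in the finite adeles. -/
lemma denseRange_ratToFinAdele : DenseRange ratToFinAdele := by
  have h1 : ∀ z, zHatToFinAdele z ∈ closure (Set.range ratToFinAdele) := by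
    intro z
    have h := (isOpenEmbedding_zHatToFinAdele.continuous.range_subset_closure_image_dense
      denseRange_natCast_zHat) ⟨z, rfl⟩
    refine closure_mono ?_ h
    rintro _ ⟨_, ⟨n, rfl⟩, rfl⟩
    exact ⟨n, ratToFinAdele_natCast_eq n⟩
  intro x
  obtain ⟨N, hN, z, hz⟩ := exists_natCast_mul_eq_zHat x
  -- Clearing denominators reduces to integral adeles, where the natural numbers are already dense.
  have h2 : x = ratToFinAdele (N : ℚ)⁻¹ * zHatToFinAdele z := by
    rw [← hz, ← mul_assoc, ← map_mul, inv_mul_cancel₀ (by exact_mod_cast hN), map_one, one_mul]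
  rw [h2]
  refine map_mem_closure (f := fun y => ratToFinAdele (N : ℚ)⁻¹ * y) (by fun_prop) (h1 z) ?_
  rintro _ ⟨q, rfl⟩
  exact ⟨(N : ℚ)⁻¹ * q, map_mul _ _ _⟩

end Rational

/-! ### The decomposition of the ideles of `ℚ` -/

section Ideles

lemma not_dvd_den_of_norm_le_one {ℓ : ℕ} [Fact ℓ.Prime] {q : ℚ} (h : ‖(q : ℚ_[ℓ])‖ ≤ 1) :
    ¬ ℓ ∣ q.den := by
  intro hd
  have h1 : ‖(q.den : ℚ_[ℓ])‖ < 1 := Padic.norm_natCast_lt_one_iff.2 hd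
  have h2 : ‖(q.num.natAbs : ℚ_[ℓ])‖ = 1 :=
    Padic.norm_natCast_eq_one_iff.2 (Nat.Coprime.coprime_dvd_left hd q.reduced.symm)
  have h3 : ‖(q.num : ℚ_[ℓ])‖ = ‖(q.num.natAbs : ℚ_[ℓ])‖ := by
    rw [Nat.cast_natAbs]
    rcases abs_choice q.num with h | h <;> simp [h]
  have h4 : (q : ℚ_[ℓ]) * q.den = q.num := by exact_mod_cast Rat.mul_den_eq_num q
  have h5 := congrArg norm h4
  rw [norm_mul, h3, h2] at h5
  nlinarith [norm_nonneg (q : ℚ_[ℓ]), norm_nonneg (q.den : ℚ_[ℓ])]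

/-- A rational number that is integral at all primes is an integer. -/
lemma exists_intCast_of_norm_le_one {q : ℚ} (h : ∀ ℓ : Nat.Primes, ‖(q : ℚ_[ℓ])‖ ≤ 1) :
    ∃ n : ℤ, q = n := by
  have hd : q.den = 1 := Nat.eq_one_iff_not_exists_prime_dvd.2 fun ℓ hℓ =>
    have : Fact ℓ.Prime := ⟨hℓ⟩
    not_dvd_den_of_norm_le_one (h ⟨ℓ, hℓ⟩)
  exact ⟨q.num, (Rat.coe_int_num_of_den_eq_one hd).symm⟩

/-- A positive rational number that is a unit at all primes is `1`. -/
lemma eq_one_of_norm_eq_one {q : ℚ} (hq : 0 < q) (h : ∀ ℓ : Nat.Primes, ‖(q : ℚ_[ℓ])‖ = 1) :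
    q = 1 := by
  obtain ⟨n, hn⟩ := exists_intCast_of_norm_le_one fun ℓ => (h ℓ).le
  obtain ⟨m, hm⟩ := exists_intCast_of_norm_le_one (q := q⁻¹) fun ℓ => by simp [h ℓ]
  have h1 : n * m = 1 := by
    have : (n : ℚ) * m = 1 := by rw [← hn, ← hm, mul_inv_cancel₀ hq.ne']
    exact_mod_cast this
  have h2 : 0 < n := by exact_mod_cast hn ▸ hq
  rw [hn, Int.eq_one_or_neg_one_of_mul_eq_one h1 |>.resolve_right (by lia), Int.cast_one]

lemma finIdele_eval_mul_inv (x : FinAdeleˣ) (ℓ : Nat.Primes) :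
    (x : FinAdele) ℓ * ((x⁻¹ : FinAdeleˣ) : FinAdele) ℓ = 1 :=
  congrArg (fun y : FinAdele => y ℓ) x.mul_inv

lemma finIdele_eval_ne_zero (x : FinAdeleˣ) (ℓ : Nat.Primes) : (x : FinAdele) ℓ ≠ 0 :=
  left_ne_zero_of_mul_eq_one (finIdele_eval_mul_inv x ℓ)

lemma finIdele_eventually_norm_eq_one (x : FinAdeleˣ) :
    ∀ᶠ ℓ in cofinite, ‖(x : FinAdele) ℓ‖ = 1 := by
  filter_upwards [(x : FinAdele).2, ((x⁻¹ : FinAdeleˣ) : FinAdele).2] with ℓ h1 h2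
  have h3 := congrArg norm (finIdele_eval_mul_inv x ℓ)
  rw [norm_mul, norm_one] at h3
  have h1' : ‖(x : FinAdele) ℓ‖ ≤ 1 := h1
  have h2' : ‖((x⁻¹ : FinAdeleˣ) : FinAdele) ℓ‖ ≤ 1 := h2
  exact le_antisymm h1' (by nlinarith [norm_nonneg ((x : FinAdele) ℓ)])

/-- A unit of `∏ ℤ_ℓ` from a finite idele with components of norm one. -/
lemma exists_zHatUnits_of_norm_eq_one {x : FinAdele} (h : ∀ ℓ, ‖x ℓ‖ = 1) :
    ∃ u : ZHatˣ, zHatToFinAdele u = x := by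
  let z : ZHat := fun ℓ => ⟨x ℓ, (h ℓ).le⟩
  have hu : IsUnit z :=
    Pi.isUnit_iff.2 fun ℓ => PadicInt.isUnit_iff.2 (h ℓ)
  exact ⟨hu.unit, finAdele_ext fun ℓ => rfl⟩

/-- This is class number one for `ℚ`: the product of the `ℓ` raised to the valuations of `x` is
finite and has the prescribed absolute values. -/
lemma exists_rat_norm_eq (x : FinAdeleˣ) :
    ∃ q : ℚ, 0 < q ∧ ∀ ℓ : Nat.Primes, ‖(q : ℚ_[ℓ])‖ = ‖(x : FinAdele) ℓ‖ := by
  have hfin : {ℓ : Nat.Primes | ¬ ‖(x : FinAdele) ℓ‖ = 1}.Finite :=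
    Filter.eventually_cofinite.1 (finIdele_eventually_norm_eq_one x)
  refine ⟨∏ ℓ ∈ hfin.toFinset, ((ℓ : ℕ) : ℚ) ^ ((x : FinAdele) ℓ).valuation,
    Finset.prod_pos fun ℓ _ => zpow_pos (by exact_mod_cast ℓ.2.pos) _, fun ℓ => ?_⟩
  have hne : ∀ ℓ' : Nat.Primes, ℓ' ≠ ℓ →
      ‖(((ℓ' : ℕ) : ℚ_[ℓ])) ^ ((x : FinAdele) ℓ').valuation‖ = 1 := by
    intro ℓ' h
    have : ‖((ℓ' : ℕ) : ℚ_[ℓ])‖ = 1 := Padic.norm_natCast_eq_one_iff.2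
      ((Nat.coprime_primes ℓ.2 ℓ'.2).2 fun h' => h (Subtype.ext h'.symm))
    rw [norm_zpow, this, one_zpow]
  rw [Rat.cast_prod, norm_prod]
  simp only [Rat.cast_zpow, Rat.cast_natCast]
  by_cases h : ℓ ∈ hfin.toFinset
  · rw [Finset.prod_eq_single_of_mem ℓ h fun ℓ' _ h' => hne ℓ' h', Padic.norm_p_zpow,
      Padic.norm_eq_zpow_neg_valuation (finIdele_eval_ne_zero x ℓ)]
  · rw [Finset.prod_eq_one fun ℓ' h' => hne ℓ' fun h'' => h (h'' ▸ h')]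
    have h2 : ‖(x : FinAdele) ℓ‖ = 1 := by simpa using h
    rw [h2]

/-- Every idele is the product of a rational number, a positive real number and a unit of
`∏ ℤ_ℓ`. -/
lemma exists_idele_eq (x : Adeleˣ) : ∃ q : ℚˣ, ∃ r ∈ posReal, ∃ u : ZHatˣ,
    x = Units.map ratToAdele.toMonoidHom q * r * zHatUnitsToIdele u := by
  obtain ⟨q, hq, hqx⟩ := exists_rat_norm_eq (MulEquiv.prodUnits x).2
  have hx0 : (x : Adele).1 ≠ 0 :=
    left_ne_zero_of_mul_eq_one (congrArg Prod.fst x.mul_inv : (x : Adele).1 * _ = 1)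
  -- The norms determine `q` up to sign; the sign is chosen to match the real component.
  obtain ⟨q', hq', hqx', hpos⟩ : ∃ q' : ℚ, q' ≠ 0 ∧
      (∀ ℓ : Nat.Primes, ‖(q' : ℚ_[ℓ])‖ = ‖(x : Adele).2 ℓ‖) ∧ 0 < (x : Adele).1 / q' := by
    rcases lt_or_gt_of_ne hx0 with h | h
    · refine ⟨-q, (neg_ne_zero.2 hq.ne'), fun ℓ => ?_, ?_⟩
      · rw [Rat.cast_neg, norm_neg]
        exact hqx ℓ
      · rw [Rat.cast_neg]
        exact div_pos_of_neg_of_neg h (by simpa using hq)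
    · exact ⟨q, hq.ne', hqx, div_pos h (by exact_mod_cast hq)⟩
  obtain ⟨u, hu⟩ := exists_zHatUnits_of_norm_eq_one (x := ratToFinAdele q'⁻¹ * (x : Adele).2)
    fun ℓ => by
      change ‖((q'⁻¹ : ℚ) : ℚ_[ℓ]) * (x : Adele).2 ℓ‖ = 1
      rw [norm_mul, ← hqx', ← norm_mul, ← Rat.cast_mul, inv_mul_cancel₀ hq', Rat.cast_one,
        norm_one]
  refine ⟨Units.mk0 q' hq', MulEquiv.prodUnits.symm (Units.mk0 _ hpos.ne', 1), ⟨hpos, rfl⟩, u,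
    Units.ext (Prod.ext ?_ ?_)⟩
  · change (x : Adele).1 = q' * ((x : Adele).1 / q') * 1
    have : (q' : ℝ) ≠ 0 := by exact_mod_cast hq'
    field_simp
  · change (x : Adele).2 = ratToFinAdele q' * 1 * zHatToFinAdele u
    rw [hu, mul_one, ← mul_assoc, ← map_mul, mul_inv_cancel₀ hq', map_one, one_mul]

lemma zHatUnitsToIdeleQuot_surjective : Function.Surjective zHatUnitsToIdeleQuot := by
  intro y
  obtain ⟨x, rfl⟩ := QuotientGroup.mk_surjective y
  obtain ⟨q, r, hr, u, rfl⟩ := exists_idele_eq x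
  refine ⟨u, (QuotientGroup.eq).2 ?_⟩
  rw [mul_comm (_ * r), inv_mul_cancel_left, mul_comm]
  exact Subgroup.mul_mem_sup hr ⟨q, rfl⟩

/-- A rational number that is positive at infinity and a unit at every prime is `1`. -/
lemma zHatUnitsToIdeleQuot_injective : Function.Injective zHatUnitsToIdeleQuot := by
  rw [injective_iff_map_eq_one]
  intro u hu
  obtain ⟨r, hr, _, ⟨q, rfl⟩, hrq⟩ := Subgroup.mem_sup.1 ((QuotientGroup.eq_one_iff _).1 hu)
  have h1 : (r : Adele).1 * (q : ℚ) = 1 := congrArg (fun x : Adeleˣ => (x : Adele).1) hrq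
  have h2 : (r : Adele).2 * ratToFinAdele q = zHatToFinAdele (u : ZHat) :=
    congrArg (fun x : Adeleˣ => (x : Adele).2) hrq
  rw [hr.2, one_mul] at h2
  have hq : 0 < (q : ℚ) := by
    have : (0 : ℝ) < (q : ℚ) := pos_of_mul_pos_right (h1 ▸ zero_lt_one) hr.1.le
    exact_mod_cast this
  have hq1 : (q : ℚ) = 1 := eq_one_of_norm_eq_one hq fun ℓ => by
    have h3 : (((q : ℚ)) : ℚ_[ℓ]) = ((u : ZHat) ℓ : ℚ_[ℓ]) :=
      congrArg (fun x : FinAdele => x ℓ) h2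
    rw [h3]
    exact PadicInt.isUnit_iff.1 (Pi.isUnit_iff.1 u.isUnit ℓ)
  rw [hq1, map_one, ← map_one zHatToFinAdele] at h2
  exact Units.ext (isOpenEmbedding_zHatToFinAdele.injective h2.symm)

lemma continuous_zHatUnitsToIdele : Continuous zHatUnitsToIdele :=
  (Homeomorph.prodUnits (α := ℝ) (β := FinAdele)).symm.continuous.comp
    (continuous_const.prodMk
      (isOpenEmbedding_zHatToFinAdele.continuous.units_map zHatToFinAdele.toMonoidHom))

lemma isOpenMap_zHatUnitsToIdeleQuot : IsOpenMap zHatUnitsToIdeleQuot := by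
  intro V hV
  have hj : IsOpenMap (Units.map zHatToFinAdele.toMonoidHom) :=
    Units.isOpenMap_map isOpenEmbedding_zHatToFinAdele.injective
      isOpenEmbedding_zHatToFinAdele.isOpenMap
  -- The image of `V` is also the image of the open set of ideles positive at infinity with finite
  -- part in `V`, and the quotient map is open.
  let W : Set Adeleˣ := {x | 0 < (x : Adele).1 ∧
    (MulEquiv.prodUnits x).2 ∈ Units.map zHatToFinAdele.toMonoidHom '' V}
  have hW : IsOpen W := by
    refine IsOpen.inter ?_ ?_
    · exact isOpen_Ioi.preimage (continuous_fst.comp Units.continuous_val)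
    · exact (hj V hV).preimage (continuous_snd.comp
        (Homeomorph.prodUnits (α := ℝ) (β := FinAdele)).continuous)
  convert QuotientGroup.isOpenMap_coe
    (N := posReal ⊔ (Units.map ratToAdele.toMonoidHom).range) W hW using 1
  ext y
  constructor
  · rintro ⟨u, hu, rfl⟩
    exact ⟨zHatUnitsToIdele u, ⟨zero_lt_one, u, hu, rfl⟩, rfl⟩
  · rintro ⟨x, ⟨hx, u, hu, hux⟩, rfl⟩
    refine ⟨u, hu, (QuotientGroup.eq).2 (Subgroup.mem_sup_left ?_)⟩
    refine ⟨?_, ?_⟩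
    · rw [← map_inv]
      change 0 < 1 * (x : Adele).1
      simpa using hx
    · change (((Units.map zHatToFinAdele.toMonoidHom u)⁻¹ * (MulEquiv.prodUnits x).2 :
        FinAdeleˣ) : FinAdele) = 1
      rw [hux, inv_mul_cancel, Units.val_one]

theorem isHomeomorph_zHatUnitsToIdeleQuot : IsHomeomorph zHatUnitsToIdeleQuot where
  continuous := QuotientGroup.continuous_mk.comp continuous_zHatUnitsToIdele
  isOpenMap := isOpenMap_zHatUnitsToIdeleQuot
  bijective := ⟨zHatUnitsToIdeleQuot_injective, zHatUnitsToIdeleQuot_surjective⟩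

end Ideles

/-! ### Elementary matrices -/

section Elementary

variable {R S : Type*} [CommRing R] [CommRing S]

/-- The matrix `(1, a; 0, 1)`. -/
def upper (a : R) : GL (Fin 2) R :=
  ⟨!![1, a; 0, 1], !![1, -a; 0, 1], by simp [Matrix.one_fin_two], by simp [Matrix.one_fin_two]⟩

/-- The matrix `(1, 0; a, 1)`. -/
def lower (a : R) : GL (Fin 2) R :=
  ⟨!![1, 0; a, 1], !![1, 0; -a, 1], by simp [Matrix.one_fin_two], by simp [Matrix.one_fin_two]⟩

/-- The matrix `(s, 0; 0, t)`. -/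
def diag (s t : Rˣ) : GL (Fin 2) R :=
  ⟨!![(s : R), 0; 0, (t : R)], !![((s⁻¹ : Rˣ) : R), 0; 0, ((t⁻¹ : Rˣ) : R)],
    by simp [Matrix.one_fin_two], by simp [Matrix.one_fin_two]⟩

lemma map_upper (f : R →+* S) (a : R) :
    Matrix.GeneralLinearGroup.map f (upper a) = upper (f a) := by
  ext i j; fin_cases i <;> fin_cases j <;> simp [upper]

lemma map_lower (f : R →+* S) (a : R) :
    Matrix.GeneralLinearGroup.map f (lower a) = lower (f a) := by
  ext i j; fin_cases i <;> fin_cases j <;> simp [lower]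

lemma map_diag (f : R →+* S) (s t : Rˣ) :
    Matrix.GeneralLinearGroup.map f (diag s t) =
      diag (Units.map f.toMonoidHom s) (Units.map f.toMonoidHom t) := by
  ext i j; fin_cases i <;> fin_cases j <;> simp [diag]

lemma diag_mul (s t s' t' : Rˣ) : diag (s * s') (t * t') = diag s t * diag s' t' := by
  ext i j; fin_cases i <;> fin_cases j <;> simp [diag]

lemma det_diag (s t : Rˣ) : Matrix.GeneralLinearGroup.det (diag s t) = s * t := by
  ext; simp [diag]

lemma diag_one_one : diag (1 : Rˣ) 1 = 1 := by
  ext i j; fin_cases i <;> fin_cases j <;> simp [diag]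

lemma upper_zero : upper (0 : R) = 1 := by
  ext i j; fin_cases i <;> fin_cases j <;> simp [upper]

lemma lower_zero : lower (0 : R) = 1 := by
  ext i j; fin_cases i <;> fin_cases j <;> simp [lower]

lemma upper_add (a b : R) : upper (a + b) = upper a * upper b := by
  ext i j; fin_cases i <;> fin_cases j <;> simp [upper, add_comm]

lemma upper_mul_apply (a : R) (g : GL (Fin 2) R) (i j : Fin 2) :
    (upper a * g) i j = g i j + if i = 0 then a * g 1 j else 0 := by
  fin_cases i <;> simp [upper, Matrix.mul_apply, Fin.sum_univ_two]

/-- An upper triangular matrix is a product of a unipotent and a diagonal matrix. -/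
lemma borel_eq (b : borel R) : (b : GL (Fin 2) R) =
    upper ((b : GL (Fin 2) R) 0 1 * ((borelSnd b)⁻¹ : Rˣ)) * diag (borelFst b) (borelSnd b) := by
  have h10 : (b : GL (Fin 2) R) 1 0 = 0 := b.2
  have h00 : (b : GL (Fin 2) R) 0 0 = borelFst b := rfl
  have h11 : (b : GL (Fin 2) R) 1 1 = borelSnd b := rfl
  ext i j
  fin_cases i <;> fin_cases j <;> simp [upper_mul_apply, diag, h00, h10, h11]

/-- A function on `GL₂(R)` that is invariant under elementary matrices is invariant under every
matrix `g` of determinant one for which some `c + t a` is a unit, where `(a, c)` is the first column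
of `g`. -/
lemma eq_of_elementary_invariant {Y : Type*} {φ : GL (Fin 2) R → Y}
    (hu : ∀ a x, φ (upper a * x) = φ x) (hl : ∀ a x, φ (lower a * x) = φ x)
    (g x : GL (Fin 2) R) (hg : Matrix.GeneralLinearGroup.det g = 1)
    (h : ∃ t, IsUnit (g 1 0 + t * g 0 0)) : φ (g * x) = φ x := by
  obtain ⟨t, c, hc⟩ := h
  have hdet : g 0 0 * g 1 1 - g 0 1 * g 1 0 = 1 := by
    have := congrArg Units.val hg
    rwa [Matrix.GeneralLinearGroup.val_det_apply, Matrix.det_fin_two] at this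
  have hcc : (c : R) * ((c⁻¹ : Rˣ) : R) = 1 := c.mul_inv
  set ci : R := ((c⁻¹ : Rˣ) : R)
  -- Multiplying by `lower t` makes the lower left entry a unit `c`. A matrix `(a, b; c, d)` of
  -- determinant one with `c` a unit is `upper ((a - 1) / c) * lower c * upper ((d - 1) / c)`.
  have key : g = lower (-t) * (upper ((g 0 0 - 1) * ci) * (lower (c : R) *
      upper ((g 1 1 + t * g 0 1 - 1) * ci))) := by
    ext i j
    fin_cases i <;> fin_cases j <;>
      simp [upper, lower, Matrix.mul_apply, Fin.sum_univ_two]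
    · linear_combination (-(g 0 0 - 1)) * hcc
    · linear_combination (-(g 0 1 + (g 0 0 - 1) * (g 1 1 + t * g 0 1 - 1) * ci)) * hcc - ci * hdet +
        ci * g 0 1 * hc
    · linear_combination t * (g 0 0 - 1) * hcc - hc
    · linear_combination (t * (g 0 1 + (g 0 0 - 1) * (g 1 1 + t * g 0 1 - 1) * ci) -
        (g 1 1 + t * g 0 1 - 1)) * hcc + t * ci * hdet - t * ci * g 0 1 * hc
  rw [key]
  simp only [mul_assoc]
  rw [hl, hu, hl, hu]

end Elementary

section Continuity

variable {R : Type*} [CommRing R] [TopologicalSpace R] [IsTopologicalRing R]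

lemma continuous_upper : Continuous (upper : R → GL (Fin 2) R) := by
  refine Units.continuous_iff.2 ⟨?_, ?_⟩ <;> refine continuous_matrix fun i j => ?_ <;>
    fin_cases i <;> fin_cases j <;> simp [upper] <;> fun_prop

lemma continuous_lower : Continuous (lower : R → GL (Fin 2) R) := by
  refine Units.continuous_iff.2 ⟨?_, ?_⟩ <;> refine continuous_matrix fun i j => ?_ <;>
    fin_cases i <;> fin_cases j <;> simp [lower] <;> fun_prop

lemma continuous_diag : Continuous fun s : Rˣ × Rˣ => diag s.1 s.2 := by
  refine Units.continuous_iff.2 ⟨?_, ?_⟩ <;> refine continuous_matrix fun i j => ?_ <;>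
    fin_cases i <;> fin_cases j <;> simp [diag]
  · exact Units.continuous_val.comp continuous_fst
  · exact continuous_const
  · exact continuous_const
  · exact Units.continuous_val.comp continuous_snd
  · exact Units.continuous_val.comp continuous_fst.inv
  · exact continuous_const
  · exact continuous_const
  · exact Units.continuous_val.comp continuous_snd.inv

end Continuity

section Evaluation

/-- The component of an adele at a prime. -/
def evalFin (ℓ : Nat.Primes) : Adele →+* ℚ_[ℓ] where
  toFun x := x.2 ℓ
  map_zero' := rfl
  map_one' := rfl
  map_add' _ _ := rfl
  map_mul' _ _ := rfl

lemma continuous_evalFin (ℓ : Nat.Primes) : Continuous (evalFin ℓ) :=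
  (RestrictedProduct.continuous_eval ℓ).comp continuous_snd

lemma eventually_norm_evalFin_le_one (x : Adele) : ∀ᶠ ℓ in cofinite, ‖evalFin ℓ x‖ ≤ 1 := x.2.2

lemma eventually_norm_evalFin_eq_one {x : Adele} (hx : IsUnit x) :
    ∀ᶠ ℓ in cofinite, ‖evalFin ℓ x‖ = 1 :=
  finIdele_eventually_norm_eq_one (Prod.isUnit_iff.1 hx).2.unit

lemma isUnit_adele {x : Adele} (h0 : x.1 ≠ 0) (h : ∀ ℓ, evalFin ℓ x ≠ 0)
    (h1 : ∀ᶠ ℓ in cofinite, ‖evalFin ℓ x‖ = 1) : IsUnit x := by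
  refine Prod.isUnit_iff.2 ⟨isUnit_iff_ne_zero.2 h0, ?_⟩
  refine RestrictedProduct.isUnit_of_eventually_isUnit (fun ℓ => isUnit_iff_ne_zero.2 (h ℓ)) ?_
  filter_upwards [h1] with ℓ hℓ
  exact ⟨hℓ.le, PadicInt.isUnit_iff.2 hℓ⟩

lemma isUnit_det_fin_two (g : GL (Fin 2) Adele) :
    IsUnit (g 0 0 * g 1 1 - g 0 1 * g 1 0) := by
  rw [← Matrix.det_fin_two]
  exact (Matrix.isUnit_iff_isUnit_det _).1 g.isUnit

end Evaluation

/-! ### From rational to adelic invariance -/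

section Invariance

variable {Y : Type*} [TopologicalSpace Y] [TotallyDisconnectedSpace Y]

/-- A continuous function on the adeles with values in a totally disconnected space which is
constant on the rational numbers is constant. -/
lemma eq_zero_apply_of_rat [T2Space Y] {ψ : Adele → Y} (hψ : Continuous ψ)
    (h : ∀ q : ℚ, ψ (ratToAdele q) = ψ 0) (a : Adele) : ψ a = ψ 0 := by
  -- The real line is connected, so the real component is invisible in `Y`; the density of `ℚ` then
  -- settles the finite part.
  have h1 : ∀ (r s : ℝ) (f : FinAdele), ψ (r, f) = ψ (s, f) := fun r s f =>
    (isPreconnected_range (f := fun r : ℝ => ψ (r, f)) (by fun_prop)).subsingleton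
      (Set.mem_range_self r) (Set.mem_range_self s)
  have h2 : (fun f : FinAdele => ψ (0, f)) = fun _ => ψ 0 := by
    refine denseRange_ratToFinAdele.equalizer (by fun_prop) continuous_const (funext fun q => ?_)
    exact (h1 0 q _).trans (h q)
  exact (h1 a.1 0 a.2).trans (congrFun h2 a.2)

/-- A positive real number as an idele. -/
noncomputable def expIdele (t : ℝ) : Adeleˣ :=
  MulEquiv.prodUnits.symm (Units.mk0 (Real.exp t) (Real.exp_pos t).ne', 1)

lemma continuous_expIdele : Continuous expIdele := by
  refine (Homeomorph.prodUnits (α := ℝ) (β := FinAdele)).symm.continuous.comp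
    (Continuous.prodMk (Units.continuous_iff.2 ⟨Real.continuous_exp, ?_⟩) continuous_const)
  exact Real.continuous_exp.inv₀ fun t => (Real.exp_pos t).ne'

lemma exists_expIdele_eq {r : Adeleˣ} (hr : r ∈ posReal) : ∃ t, expIdele t = r :=
  ⟨Real.log (r : Adele).1, Units.ext (Prod.ext (Real.exp_log hr.1) hr.2.symm)⟩

lemma eq_one_apply_of_mem_posReal {ψ : Adeleˣ → Y} (hψ : Continuous ψ) {r : Adeleˣ}
    (hr : r ∈ posReal) : ψ r = ψ 1 := by
  obtain ⟨t, rfl⟩ := exists_expIdele_eq hr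
  obtain ⟨s, hs⟩ := exists_expIdele_eq posReal.one_mem
  rw [← hs]
  exact (isPreconnected_range (hψ.comp continuous_expIdele)).subsingleton
    (Set.mem_range_self t) (Set.mem_range_self s)

variable {φ : GL (Fin 2) Adele → Y}

lemma upper_invariant [T2Space Y] (hφ : Continuous φ)
    (h : ∀ (q : ℚ) x, φ (upper (ratToAdele q) * x) = φ x) (a : Adele) (x : GL (Fin 2) Adele) :
    φ (upper a * x) = φ x := by
  have h1 := eq_zero_apply_of_rat (ψ := fun a => φ (upper a * x))
    (hφ.comp (continuous_upper.mul continuous_const))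
    (fun q => by simpa only [upper_zero, one_mul] using h q x) a
  simpa only [upper_zero, one_mul] using h1

lemma lower_invariant [T2Space Y] (hφ : Continuous φ)
    (h : ∀ (q : ℚ) x, φ (lower (ratToAdele q) * x) = φ x) (a : Adele) (x : GL (Fin 2) Adele) :
    φ (lower a * x) = φ x := by
  have h1 := eq_zero_apply_of_rat (ψ := fun a => φ (lower a * x))
    (hφ.comp (continuous_lower.mul continuous_const))
    (fun q => by simpa only [lower_zero, one_mul] using h q x) a
  simpa only [lower_zero, one_mul] using h1

/-- In a column of an invertible adelic matrix, some combination is an idele. -/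
lemma exists_isUnit_add_mul (g : GL (Fin 2) Adele) : ∃ t : Adele, IsUnit (g 1 0 + t * g 0 0) := by
  classical
  have hu := isUnit_det_fin_two g
  -- With entries `a` above `c`, the scalar `t` is `0` or `1` at each place: at `ℓ` so that `|c + t
  -- a| = max |a| |c|`, and at infinity so that `c + t a` is nonzero.
  let tf : FinAdele := ⟨fun ℓ => if ‖evalFin ℓ (g 0 0)‖ ≤ ‖evalFin ℓ (g 1 0)‖ then 0 else 1,
    .of_forall fun ℓ => by dsimp only; split_ifs; exacts [zero_mem _, one_mem _]⟩
  let t : Adele := (if (g 1 0).1 = 0 then 1 else 0, tf)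
  have hn : ∀ ℓ, ‖evalFin ℓ (g 1 0 + t * g 0 0)‖ =
      max ‖evalFin ℓ (g 0 0)‖ ‖evalFin ℓ (g 1 0)‖ := by
    intro ℓ
    have ht : evalFin ℓ t = if ‖evalFin ℓ (g 0 0)‖ ≤ ‖evalFin ℓ (g 1 0)‖ then 0 else 1 := rfl
    rw [map_add, map_mul, ht]
    split_ifs with h
    · simp [max_eq_right h]
    · rw [one_mul, Padic.add_eq_max_of_ne (by linarith [not_le.1 h]), max_comm]
  refine ⟨t, isUnit_adele ?_ (fun ℓ h0 => ?_) ?_⟩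
  · have h1 := (Prod.isUnit_iff.1 hu).1.ne_zero
    change (g 1 0).1 + (if (g 1 0).1 = 0 then 1 else 0) * (g 0 0).1 ≠ 0
    change (g 0 0).1 * (g 1 1).1 - (g 0 1).1 * (g 1 0).1 ≠ 0 at h1
    split_ifs with h
    · rw [h] at h1 ⊢
      intro h2
      simp_all
    · simpa using h
  · have h1 := (hu.map (evalFin ℓ)).ne_zero
    have h2 := hn ℓ
    rw [h0, norm_zero] at h2
    have ha : evalFin ℓ (g 0 0) = 0 := norm_le_zero_iff.1 (h2 ▸ le_max_left _ _)
    have hc : evalFin ℓ (g 1 0) = 0 := norm_le_zero_iff.1 (h2 ▸ le_max_right _ _)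
    simp [ha, hc] at h1
  -- At almost every prime the matrix is integral with unit determinant, which forces an entry of
  -- the first column to be a unit.
  · filter_upwards [eventually_norm_evalFin_eq_one hu, eventually_norm_evalFin_le_one (g 0 0),
      eventually_norm_evalFin_le_one (g 0 1), eventually_norm_evalFin_le_one (g 1 0),
      eventually_norm_evalFin_le_one (g 1 1)] with ℓ h ha hb hc hd
    rw [hn]
    refine le_antisymm (max_le ha hc) ?_
    rw [← h, map_sub, map_mul, map_mul]
    rw [sub_eq_add_neg]
    refine (Padic.nonarchimedean _ _).trans (max_le_max ?_ ((norm_neg _).trans_le ?_)) <;>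
      rw [norm_mul]
    · exact mul_le_of_le_one_right (norm_nonneg _) hd
    · exact mul_le_of_le_one_left (norm_nonneg _) hb

/-- Strong approximation for `SL₂`, in terms of functions: invariance extends from rational to
adelic elementary matrices, and these act transitively enough by `eq_of_elementary_invariant`. -/
lemma det_invariant [T2Space Y] (hφ : Continuous φ) (h : ∀ (γ : GL (Fin 2) ℚ) x,
      φ (Matrix.GeneralLinearGroup.map ratToAdele γ * x) = φ x)
    (x y : GL (Fin 2) Adele)
    (hxy : Matrix.GeneralLinearGroup.det x = Matrix.GeneralLinearGroup.det y) : φ x = φ y := by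
  have h1 := eq_of_elementary_invariant (φ := φ)
    (upper_invariant hφ fun q x => by rw [← map_upper, h])
    (lower_invariant hφ fun q x => by rw [← map_lower, h]) (x * y⁻¹) y
    (by rw [map_mul, map_inv, hxy, mul_inv_cancel]) (exists_isUnit_add_mul _)
  rwa [inv_mul_cancel_right] at h1

end Invariance

/-! ### Open subgroups of `GL₂(𝔸)` -/

section Subgroups

lemma det_fin_two_val {R : Type*} [CommRing R] (g : GL (Fin 2) R) :
    (Matrix.GeneralLinearGroup.det g : R) = g 0 0 * g 1 1 - g 0 1 * g 1 0 :=
  Matrix.det_fin_two _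

lemma mul_apply_fin_two {R : Type*} [CommRing R] (g h : GL (Fin 2) R) (i j : Fin 2) :
    (g * h) i j = g i 0 * h 0 j + g i 1 * h 1 j := by
  simp [Matrix.mul_apply, Fin.sum_univ_two]

lemma inv_apply_fin_two {R : Type*} [CommRing R] (g : GL (Fin 2) R) :
    ((g⁻¹ : GL (Fin 2) R) : Matrix (Fin 2) (Fin 2) R) =
      ((Matrix.GeneralLinearGroup.det g⁻¹ : Rˣ) : R) • !![g 1 1, -g 0 1; -g 1 0, g 0 0] := by
  rw [Matrix.coe_units_inv, Matrix.inv_def, Matrix.adjugate_fin_two]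
  congr 1
  have h : (g : Matrix (Fin 2) (Fin 2) R).det = (Matrix.GeneralLinearGroup.det g : R) := rfl
  rw [h, Ring.inverse_unit, map_inv]

section Local

variable (ℓ : ℕ) [Fact ℓ.Prime]

/-- The subgroup `GL₂(ℤ_ℓ)` of `GL₂(ℚ_ℓ)`. -/
def integralGL : Subgroup (GL (Fin 2) ℚ_[ℓ]) where
  carrier := {g | (∀ i j, ‖g i j‖ ≤ 1) ∧ ‖(Matrix.GeneralLinearGroup.det g : ℚ_[ℓ])‖ = 1}
  one_mem' := ⟨fun i j => by fin_cases i <;> fin_cases j <;> simp, by simp⟩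
  mul_mem' {g h} hg hh := by
    refine ⟨fun i j => ?_, ?_⟩
    · rw [mul_apply_fin_two]
      refine (Padic.nonarchimedean _ _).trans (max_le ?_ ?_) <;> rw [norm_mul] <;>
        exact mul_le_one₀ (hg.1 _ _) (norm_nonneg _) (hh.1 _ _)
    · rw [map_mul, Units.val_mul, norm_mul, hg.2, hh.2, one_mul]
  inv_mem' {g} hg := by
    have h1 : ‖((Matrix.GeneralLinearGroup.det g⁻¹ : ℚ_[ℓ]ˣ) : ℚ_[ℓ])‖ = 1 := by
      rw [map_inv, Units.val_inv_eq_inv_val, norm_inv, hg.2, inv_one]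
    refine ⟨fun i j => ?_, h1⟩
    rw [inv_apply_fin_two, Matrix.smul_apply, norm_smul, h1, one_mul]
    fin_cases i <;> fin_cases j <;> simp [hg.1]

/-- The matrices in `GL₂(ℤ_ℓ)` with `|a - 1| ≤ 1/4` and off-diagonal entries bounded by `1/2`. -/
def sanovLocal : Subgroup (GL (Fin 2) ℚ_[ℓ]) where
  carrier := {g | g ∈ integralGL ℓ ∧ ‖g 0 0 - 1‖ ≤ 1 / 4 ∧ ‖g 0 1‖ ≤ 1 / 2 ∧ ‖g 1 0‖ ≤ 1 / 2}
  one_mem' := ⟨one_mem _, by simp, by simp, by simp⟩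
  mul_mem' {g h} hg hh := by
    obtain ⟨hg0, hga, hgb, hgc⟩ := hg
    obtain ⟨hh0, hha, hhb, hhc⟩ := hh
    refine ⟨mul_mem hg0 hh0, ?_, ?_, ?_⟩
    -- The product of two off-diagonal entries is bounded by `1/2 * 1/2`, so the condition on the
    -- diagonal entry is stable exactly at the bound `1/4`.
    · rw [mul_apply_fin_two, show g 0 0 * h 0 0 + g 0 1 * h 1 0 - 1 =
        (g 0 0 * (h 0 0 - 1) + (g 0 0 - 1)) + g 0 1 * h 1 0 by ring]
      refine (Padic.nonarchimedean _ _).trans (max_le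
        ((Padic.nonarchimedean _ _).trans (max_le ?_ hga)) ?_)
      · rw [norm_mul]
        exact (mul_le_of_le_one_left (norm_nonneg _) (hg0.1 0 0)).trans hha
      · rw [norm_mul]
        nlinarith [norm_nonneg (g 0 1), norm_nonneg (h 1 0)]
    · rw [mul_apply_fin_two]
      refine (Padic.nonarchimedean _ _).trans (max_le ?_ ?_) <;> rw [norm_mul]
      · exact (mul_le_of_le_one_left (norm_nonneg _) (hg0.1 0 0)).trans hhb
      · exact (mul_le_of_le_one_right (norm_nonneg _) (hh0.1 1 1)).trans hgb
    · rw [mul_apply_fin_two]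
      refine (Padic.nonarchimedean _ _).trans (max_le ?_ ?_) <;> rw [norm_mul]
      · exact (mul_le_of_le_one_right (norm_nonneg _) (hh0.1 0 0)).trans hgc
      · exact (mul_le_of_le_one_left (norm_nonneg _) (hg0.1 1 1)).trans hhc
  inv_mem' {g} hg := by
    obtain ⟨hg0, hga, hgb, hgc⟩ := hg
    have h1 : ‖((Matrix.GeneralLinearGroup.det g⁻¹ : ℚ_[ℓ]ˣ) : ℚ_[ℓ])‖ = 1 := by
      rw [map_inv, Units.val_inv_eq_inv_val, norm_inv, hg0.2, inv_one]
    have h2 : ((Matrix.GeneralLinearGroup.det g⁻¹ : ℚ_[ℓ]ˣ) : ℚ_[ℓ]) *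
        (g 0 0 * g 1 1 - g 0 1 * g 1 0) = 1 := by
      rw [← det_fin_two_val, map_inv, Units.inv_mul]
    refine ⟨inv_mem hg0, ?_, ?_, ?_⟩ <;> rw [inv_apply_fin_two]
    · rw [Matrix.smul_apply, smul_eq_mul, ← h2, ← mul_sub, norm_mul, h1, one_mul]
      change ‖g 1 1 - (g 0 0 * g 1 1 - g 0 1 * g 1 0)‖ ≤ 1 / 4
      rw [show g 1 1 - (g 0 0 * g 1 1 - g 0 1 * g 1 0) =
        -((g 0 0 - 1) * g 1 1) + g 0 1 * g 1 0 by ring]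
      refine (Padic.nonarchimedean _ _).trans (max_le ?_ ?_)
      · rw [norm_neg, norm_mul]
        exact (mul_le_of_le_one_right (norm_nonneg _) (hg0.1 1 1)).trans hga
      · rw [norm_mul]
        nlinarith [norm_nonneg (g 0 1), norm_nonneg (g 1 0)]
    · rw [Matrix.smul_apply, norm_smul, h1, one_mul]
      simpa using hgb
    · rw [Matrix.smul_apply, norm_smul, h1, one_mul]
      simpa using hgc

end Local

/-- The subgroup `GL₂(ℝ)⁺ × ∏ GL₂(ℤ_ℓ)` of `GL₂(𝔸)`. -/
noncomputable def integralOpen : Subgroup (GL (Fin 2) Adele) :=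
  (Matrix.GLPos (Fin 2) ℝ).comap (Matrix.GeneralLinearGroup.map (RingHom.fst ℝ FinAdele)) ⊓
    ⨅ ℓ : Nat.Primes, (integralGL ℓ).comap (Matrix.GeneralLinearGroup.map (evalFin ℓ))

lemma mem_integralOpen {x : GL (Fin 2) Adele} : x ∈ integralOpen ↔
    0 < (Matrix.GeneralLinearGroup.det x : Adele).1 ∧
      ∀ ℓ : Nat.Primes, (∀ i j, ‖evalFin ℓ (x i j)‖ ≤ 1) ∧
        ‖evalFin ℓ (Matrix.GeneralLinearGroup.det x)‖ = 1 := by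
  have h1 : ∀ ℓ : Nat.Primes, (Matrix.GeneralLinearGroup.det
      (Matrix.GeneralLinearGroup.map (evalFin ℓ) x) : ℚ_[ℓ]) =
      evalFin ℓ (Matrix.GeneralLinearGroup.det x) := fun ℓ =>
    congrArg Units.val (Matrix.GeneralLinearGroup.map_det (evalFin ℓ) x)
  have h2 : (Matrix.GeneralLinearGroup.det
      (Matrix.GeneralLinearGroup.map (RingHom.fst ℝ FinAdele) x) : ℝ) =
      (Matrix.GeneralLinearGroup.det x : Adele).1 :=
    congrArg Units.val (Matrix.GeneralLinearGroup.map_det (RingHom.fst ℝ FinAdele) x)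
  rw [integralOpen, Subgroup.mem_inf, Subgroup.mem_comap, Matrix.mem_glpos, h2, Subgroup.mem_iInf]
  refine and_congr_right' (forall_congr' fun ℓ => ?_)
  rw [Subgroup.mem_comap, ← h1]
  rfl

lemma isOpen_setOf_integral : IsOpen {x : Adele | ∀ ℓ, ‖evalFin ℓ x‖ ≤ 1} :=
  (RestrictedProduct.isOpen_forall_mem factOpen.out).preimage continuous_snd

lemma continuous_gl_apply {R : Type*} [CommRing R] [TopologicalSpace R] (i j : Fin 2) :
    Continuous fun x : GL (Fin 2) R => x i j :=
  Units.continuous_val.matrix_elem i j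

lemma continuous_gl_det {R : Type*} [CommRing R] [TopologicalSpace R] [IsTopologicalRing R] :
    Continuous (Matrix.GeneralLinearGroup.det : GL (Fin 2) R → Rˣ) := by
  have h : Continuous fun x : GL (Fin 2) R => (Matrix.GeneralLinearGroup.det x : R) :=
    Units.continuous_val.matrix_det
  refine Units.continuous_iff.2 ⟨h, ?_⟩
  have h2 : Continuous fun x : GL (Fin 2) R => (Matrix.GeneralLinearGroup.det x⁻¹ : R) :=
    h.comp continuous_inv
  refine h2.congr fun x => ?_
  rw [map_inv]

lemma isOpen_integralOpen : IsOpen (integralOpen : Set (GL (Fin 2) Adele)) := by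
  have hdet : Continuous fun x : GL (Fin 2) Adele => (Matrix.GeneralLinearGroup.det x : Adele) :=
    Units.continuous_val.comp continuous_gl_det
  -- Unit determinant is rephrased as integrality of the determinant and of its inverse. This leaves
  -- finitely many preimages of the open ring of integral adeles, instead of an intersection over
  -- all primes.
  have h : (integralOpen : Set (GL (Fin 2) Adele)) =
      {x | 0 < (Matrix.GeneralLinearGroup.det x : Adele).1} ∩
      ((⋂ i, ⋂ j, {x | ∀ ℓ, ‖evalFin ℓ (x i j)‖ ≤ 1}) ∩
      ({x | ∀ ℓ, ‖evalFin ℓ (Matrix.GeneralLinearGroup.det x)‖ ≤ 1} ∩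
      {x | ∀ ℓ, ‖evalFin ℓ (Matrix.GeneralLinearGroup.det x⁻¹)‖ ≤ 1})) := by
    ext x
    simp only [SetLike.mem_coe, mem_integralOpen, Set.mem_inter_iff, Set.mem_ofPred_eq,
      Set.mem_iInter]
    have hinv : ∀ ℓ, ‖evalFin ℓ (Matrix.GeneralLinearGroup.det x)‖ *
        ‖evalFin ℓ (Matrix.GeneralLinearGroup.det x⁻¹)‖ = 1 := by
      intro ℓ
      rw [← norm_mul, ← map_mul, map_inv, Units.mul_inv, map_one, norm_one]
    constructor
    · rintro ⟨h0, h⟩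
      refine ⟨h0, fun i j ℓ => (h ℓ).1 i j, fun ℓ => (h ℓ).2.le, fun ℓ => ?_⟩
      have := hinv ℓ
      rw [(h ℓ).2, one_mul] at this
      exact this.le
    · rintro ⟨h0, h1, h2, h3⟩
      refine ⟨h0, fun ℓ => ⟨fun i j => h1 i j ℓ, le_antisymm (h2 ℓ) ?_⟩⟩
      rw [← hinv ℓ]
      exact mul_le_of_le_one_right (norm_nonneg _) (h3 ℓ)
  rw [h]
  refine ((isOpen_Ioi.preimage (continuous_fst.comp hdet))).inter (IsOpen.inter ?_ (IsOpen.inter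
    (isOpen_setOf_integral.preimage hdet)
    (isOpen_setOf_integral.preimage (hdet.comp continuous_inv))))
  exact isOpen_iInter_of_finite fun i => isOpen_iInter_of_finite fun j =>
    isOpen_setOf_integral.preimage (continuous_gl_apply i j)

/-- The prime `2`. -/
abbrev primeTwo : Nat.Primes := ⟨2, Nat.prime_two⟩

/-- The matrices in `GL₂(ℝ)⁺ × ∏ GL₂(ℤ_ℓ)` with a congruence condition at `2`. -/
noncomputable def sanovOpen : Subgroup (GL (Fin 2) Adele) :=
  integralOpen ⊓ (sanovLocal primeTwo).comap (Matrix.GeneralLinearGroup.map (evalFin primeTwo))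

lemma mem_sanovOpen {x : GL (Fin 2) Adele} : x ∈ sanovOpen ↔ x ∈ integralOpen ∧
    ‖evalFin primeTwo (x 0 0) - 1‖ ≤ 1 / 4 ∧ ‖evalFin primeTwo (x 0 1)‖ ≤ 1 / 2 ∧
      ‖evalFin primeTwo (x 1 0)‖ ≤ 1 / 2 := by
  rw [sanovOpen, Subgroup.mem_inf]
  refine and_congr_right fun h => ?_
  have h1 : x ∈ (integralGL primeTwo).comap (Matrix.GeneralLinearGroup.map (evalFin primeTwo)) :=
    Subgroup.mem_iInf.1 (Subgroup.mem_inf.1 h).2 primeTwo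
  exact and_iff_right h1

lemma isOpen_setOf_norm_sub_le {ℓ : ℕ} [Fact ℓ.Prime] {X : Type*} [TopologicalSpace X]
    {f : X → ℚ_[ℓ]} (hf : Continuous f) (a : ℚ_[ℓ]) {r : ℝ} (hr : r ≠ 0) :
    IsOpen {x | ‖f x - a‖ ≤ r} := by
  have h := (IsUltrametricDist.isOpen_closedBall a hr).preimage hf
  convert h using 1
  ext x
  simp [dist_eq_norm]

lemma isOpen_sanovOpen : IsOpen (sanovOpen : Set (GL (Fin 2) Adele)) := by
  have h : (sanovOpen : Set (GL (Fin 2) Adele)) = (integralOpen : Set (GL (Fin 2) Adele)) ∩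
      ({x : GL (Fin 2) Adele | ‖evalFin primeTwo (x 0 0) - 1‖ ≤ 1 / 4} ∩
      ({x : GL (Fin 2) Adele | ‖evalFin primeTwo (x 0 1) - 0‖ ≤ 1 / 2} ∩
      {x : GL (Fin 2) Adele | ‖evalFin primeTwo (x 1 0) - 0‖ ≤ 1 / 2})) := by
    ext x
    simp only [SetLike.mem_coe, mem_sanovOpen, Set.mem_inter_iff, Set.mem_ofPred_eq, sub_zero]
  have hc : ∀ i j, Continuous fun x : GL (Fin 2) Adele => evalFin primeTwo (x i j) := fun i j =>
    (continuous_evalFin _).comp (continuous_gl_apply i j)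
  rw [h]
  exact isOpen_integralOpen.inter ((isOpen_setOf_norm_sub_le (hc _ _) 1 (by norm_num)).inter
    ((isOpen_setOf_norm_sub_le (hc _ _) 0 (by norm_num)).inter
    (isOpen_setOf_norm_sub_le (hc _ _) 0 (by norm_num))))

end Subgroups

/-! ### Coverings by rational translates of open subgroups -/

section Covering

section Generic

variable {H X : Type*} [Group H] [Group X] [TopologicalSpace X] [ContinuousMul X]

lemma isOpen_of_mul_mem (U : Subgroup X) (hU : IsOpen (U : Set X)) {S : Set X}
    (h : ∀ x ∈ S, ∀ u ∈ U, x * u ∈ S) : IsOpen S := by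
  refine isOpen_iff_mem_nhds.2 fun x hx => ?_
  have h1 : (fun y => x⁻¹ * y) ⁻¹' U ∈ 𝓝 x := (hU.preimage (continuous_const_mul x⁻¹)).mem_nhds
    (by simp [U.one_mem])
  filter_upwards [h1] with y hy
  simpa using h x hx _ hy

/-- The union of the translates of an open subgroup is open and closed. -/
lemma isClopen_setOf_exists_mul_mem (j : H →* X) (U : Subgroup X) (hU : IsOpen (U : Set X)) :
    IsClopen {x | ∃ h, j h * x ∈ U} := by
  -- The union of the translates and its complement are both stable under right multiplication by
  -- the open subgroup.
  have h1 : ∀ x, ∀ u ∈ U, (x * u ∈ {x | ∃ h, j h * x ∈ U} ↔ x ∈ {x | ∃ h, j h * x ∈ U}) := by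
    intro x u hu
    refine exists_congr fun h => ?_
    rw [← mul_assoc]
    exact U.mul_mem_cancel_right hu
  refine ⟨⟨isOpen_of_mul_mem U hU fun x hx u hu => ?_⟩, isOpen_of_mul_mem U hU fun x hx u hu => ?_⟩
  · exact fun h => hx ((h1 x u hu).1 h)
  · exact (h1 x u hu).2 hx

end Generic

lemma exists_mul_mem_mul_iff {H X : Type*} [Group H] [Group X] (j : H →* X) (U : Subgroup X)
    (g : H) (x : X) : (∃ h, j h * (j g * x) ∈ U) ↔ ∃ h, j h * x ∈ U := by
  constructor
  · rintro ⟨h, hh⟩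
    exact ⟨h * g, by rwa [map_mul, mul_assoc]⟩
  · rintro ⟨h, hh⟩
    exact ⟨h * g⁻¹, by rwa [← mul_assoc, ← map_mul, inv_mul_cancel_right]⟩

lemma evalFin_posReal_mul_zHatUnits {r : Adeleˣ} (hr : r ∈ posReal) (u : ZHatˣ) (ℓ : Nat.Primes) :
    evalFin ℓ (r * zHatUnitsToIdele u : Adeleˣ) = (u : ZHat) ℓ := by
  rw [Units.val_mul, map_mul]
  have h1 : evalFin ℓ (r : Adele) = 1 := congrArg (fun y : FinAdele => y ℓ) hr.2
  rw [h1, one_mul]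
  rfl

lemma norm_zHatUnits_apply (u : ZHatˣ) (ℓ : Nat.Primes) : ‖(((u : ZHat) ℓ : ℤ_[ℓ]) : ℚ_[ℓ])‖ = 1 :=
  PadicInt.isUnit_iff.1 (Pi.isUnit_iff.1 u.isUnit ℓ)

lemma diag_mem_integralOpen {r s : Adeleˣ} (hr : r ∈ posReal) (hs : s ∈ posReal) (u v : ZHatˣ) :
    diag (r * zHatUnitsToIdele u) (s * zHatUnitsToIdele v) ∈ integralOpen := by
  rw [mem_integralOpen, det_diag]
  refine ⟨?_, fun ℓ => ⟨fun i j => ?_, ?_⟩⟩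
  · change 0 < ((r : Adele).1 * 1) * ((s : Adele).1 * 1)
    rw [mul_one, mul_one]
    exact mul_pos hr.1 hs.1
  · have h1 := (congrArg norm (evalFin_posReal_mul_zHatUnits hr u ℓ)).trans
      (norm_zHatUnits_apply u ℓ)
    have h2 := (congrArg norm (evalFin_posReal_mul_zHatUnits hs v ℓ)).trans
      (norm_zHatUnits_apply v ℓ)
    fin_cases i <;> fin_cases j <;> simp only [diag]
    · exact h1.le
    · change ‖evalFin ℓ 0‖ ≤ 1
      simp
    · change ‖evalFin ℓ 0‖ ≤ 1
      simp
    · exact h2.le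
  · rw [Units.val_mul, map_mul, evalFin_posReal_mul_zHatUnits hr, evalFin_posReal_mul_zHatUnits hs,
      norm_mul, norm_zHatUnits_apply, norm_zHatUnits_apply, one_mul]

/-- The indicator function of the union of the translates is continuous and `GL₂(ℚ)`-invariant, so
it depends only on the determinant. That determinant is a rational number times one realised by a
diagonal matrix in `sanovOpen`. -/
lemma exists_mul_mem_sanovOpen (x : GL (Fin 2) Adele) :
    ∃ γ, Matrix.GeneralLinearGroup.map ratToAdele γ * x ∈ sanovOpen := by
  set j := Matrix.GeneralLinearGroup.map (n := Fin 2) ratToAdele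
  set W : Set (GL (Fin 2) Adele) := {x | ∃ γ, j γ * x ∈ sanovOpen} with hW
  have hc : Continuous W.boolIndicator := (continuous_boolIndicator_iff_isClopen W).2
    (isClopen_setOf_exists_mul_mem j sanovOpen isOpen_sanovOpen)
  have hinv : ∀ γ y, W.boolIndicator (j γ * y) = W.boolIndicator y := by
    intro γ y
    rw [Bool.eq_iff_iff, ← Set.mem_iff_boolIndicator, ← Set.mem_iff_boolIndicator]
    exact exists_mul_mem_mul_iff j sanovOpen γ y
  obtain ⟨q, r, hr, u, hq⟩ := exists_idele_eq (Matrix.GeneralLinearGroup.det x)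
  have h1 : W.boolIndicator x = W.boolIndicator (diag 1 (r * zHatUnitsToIdele u)) := by
    refine Eq.trans ?_ (hinv (diag 1 q) _)
    refine det_invariant hc hinv _ _ ?_
    rw [map_mul, map_diag, det_diag, det_diag, hq, map_one, one_mul, one_mul, mul_assoc]
  change x ∈ W
  rw [Set.mem_iff_boolIndicator, h1, ← Set.mem_iff_boolIndicator]
  refine ⟨1, ?_⟩
  rw [map_one, one_mul, mem_sanovOpen]
  refine ⟨?_, ?_⟩
  · simpa using diag_mem_integralOpen posReal.one_mem hr 1 u
  · simp [diag]

/-- A vector in `ℚ_ℓ²` can be moved to a multiple of `(0, 1)` by `GL₂(ℤ_ℓ)`. -/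
lemma exists_integral_matrix {ℓ : ℕ} [Fact ℓ.Prime] (c d : ℚ_[ℓ]) :
    ∃ m : Matrix (Fin 2) (Fin 2) ℚ_[ℓ], (∀ i j, ‖m i j‖ ≤ 1) ∧ ‖m.det‖ = 1 ∧
      c * m 0 0 + d * m 1 0 = 0 := by
  -- Dividing by the entry of larger norm keeps the column operation integral.
  by_cases h : ‖c‖ ≤ ‖d‖
  · by_cases hd : d = 0
    · have hc : c = 0 := by simpa [hd] using h
      refine ⟨1, fun i j => ?_, by simp, by simp [hd, hc]⟩
      fin_cases i <;> fin_cases j <;> simp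
    · refine ⟨!![1, 0; -c / d, 1], fun i j => ?_, by simp [Matrix.det_fin_two], ?_⟩
      · fin_cases i <;> fin_cases j <;> simp
        exact div_le_one_of_le₀ h (norm_nonneg _)
      · simp
        field_simp
        ring
  · have hc : c ≠ 0 := by
      rintro rfl
      simp at h
    refine ⟨!![-d / c, 1; 1, 0], fun i j => ?_, by simp [Matrix.det_fin_two], ?_⟩
    · fin_cases i <;> fin_cases j <;> simp
      exact div_le_one_of_le₀ (not_le.1 h).le (norm_nonneg _)
    · simp
      field_simp
      ring

/-- The Iwasawa decomposition. -/
lemma exists_integralOpen_mul_apply_eq_zero (x : GL (Fin 2) Adele) :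
    ∃ k ∈ integralOpen, (x * k) 1 0 = 0 := by
  choose m hm1 hm2 hm3 using fun ℓ : Nat.Primes =>
    exists_integral_matrix (evalFin ℓ (x 1 0)) (evalFin ℓ (x 1 1))
  let c : ℝ := (x 1 0).1
  let d : ℝ := (x 1 1).1
  -- At infinity the rotation matrix is left unnormalised: its determinant `c² + d²` is positive,
  -- which is all that is required.
  let mR : Matrix (Fin 2) (Fin 2) ℝ := !![d, c; -c, d]
  let M : Matrix (Fin 2) (Fin 2) Adele := Matrix.of fun i j =>
    (mR i j, ⟨fun ℓ => m ℓ i j, .of_forall fun ℓ => hm1 ℓ i j⟩)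
  have hMdet : ∀ ℓ, evalFin ℓ M.det = (m ℓ).det := by
    intro ℓ
    rw [Matrix.det_fin_two, Matrix.det_fin_two, map_sub, map_mul, map_mul]
    rfl
  have hpos : 0 < M.det.1 := by
    have h1 : M.det.1 = d * d - c * -c := by
      rw [Matrix.det_fin_two]
      rfl
    have h2 := (Prod.isUnit_iff.1 (isUnit_det_fin_two x)).1.ne_zero
    change (x 0 0).1 * d - (x 0 1).1 * c ≠ 0 at h2
    rw [h1]
    by_contra hn
    have hc : c = 0 := by nlinarith [sq_nonneg c, sq_nonneg d]
    have hd : d = 0 := by nlinarith [sq_nonneg c, sq_nonneg d]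
    simp [hc, hd] at h2
  have hunit : IsUnit M.det := isUnit_adele hpos.ne'
    (fun ℓ h => by simpa [← hMdet, h] using hm2 ℓ)
    (.of_forall fun ℓ => by rw [hMdet, hm2])
  refine ⟨Matrix.GeneralLinearGroup.mk'' M hunit, ?_, ?_⟩
  · refine mem_integralOpen.2 ⟨hpos, fun ℓ => ⟨fun i j => hm1 ℓ i j, ?_⟩⟩
    exact (congrArg norm (hMdet ℓ)).trans (hm2 ℓ)
  · rw [mul_apply_fin_two]
    refine Prod.ext ?_ (finAdele_ext fun ℓ => hm3 ℓ)
    change c * d + d * -c = 0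
    ring

/-- The indicator argument again: the Iwasawa decomposition reduces to upper triangular matrices,
adelic unipotents do not change the indicator, and the diagonal part is handled by the decomposition
of ideles. -/
lemma exists_borel_mul_mem_integralOpen (x : GL (Fin 2) Adele) :
    ∃ b : borel ℚ, Matrix.GeneralLinearGroup.map ratToAdele b.1 * x ∈ integralOpen := by
  set j : borel ℚ →* GL (Fin 2) Adele :=
    (Matrix.GeneralLinearGroup.map ratToAdele).comp (borel ℚ).subtype
  set W : Set (GL (Fin 2) Adele) := {x | ∃ b, j b * x ∈ integralOpen} with hW
  have hc : Continuous W.boolIndicator := (continuous_boolIndicator_iff_isClopen W).2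
    (isClopen_setOf_exists_mul_mem j integralOpen isOpen_integralOpen)
  have hinv : ∀ b y, W.boolIndicator (j b * y) = W.boolIndicator y := by
    intro b y
    rw [Bool.eq_iff_iff, ← Set.mem_iff_boolIndicator, ← Set.mem_iff_boolIndicator]
    exact exists_mul_mem_mul_iff j integralOpen b y
  have hup : ∀ a y, W.boolIndicator (upper a * y) = W.boolIndicator y :=
    upper_invariant hc fun q y => by
      rw [← map_upper]
      exact hinv ⟨upper q, by simp [borel, upper]⟩ y
  obtain ⟨k, hk, hxk⟩ := exists_integralOpen_mul_apply_eq_zero x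
  obtain ⟨q, r, hr, u, hq⟩ := exists_idele_eq (borelFst ⟨x * k, hxk⟩)
  obtain ⟨q', r', hr', u', hq'⟩ := exists_idele_eq (borelSnd ⟨x * k, hxk⟩)
  have h1 : x * k ∈ W := by
    have h2 := borel_eq ⟨x * k, hxk⟩
    dsimp only at h2
    rw [h2, Set.mem_iff_boolIndicator, hup, hq, hq', mul_assoc, mul_assoc, diag_mul, ← map_diag]
    rw [show Matrix.GeneralLinearGroup.map ratToAdele (diag q q') =
      j ⟨diag q q', by simp [borel, diag]⟩ from rfl, hinv, ← Set.mem_iff_boolIndicator]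
    exact ⟨1, by simpa using diag_mem_integralOpen hr hr' u u'⟩
  obtain ⟨b, hb⟩ := h1
  refine ⟨b, ?_⟩
  rw [← mul_assoc] at hb
  exact (integralOpen.mul_mem_cancel_right hk).1 hb

end Covering

/-! ### The free group `sanovGroup` and the cohomology of `GL₂(ℚ)` -/

section Sanov

lemma lower_mul_apply {R : Type*} [CommRing R] (a : R) (g : GL (Fin 2) R) (i j : Fin 2) :
    (lower a * g) i j = g i j + if i = 1 then a * g 0 j else 0 := by
  fin_cases i <;> simp [lower, Matrix.mul_apply, Fin.sum_univ_two, add_comm]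

lemma inv_upper {R : Type*} [CommRing R] (a : R) : (upper a)⁻¹ = upper (-a) :=
  inv_eq_of_mul_eq_one_right (by rw [← upper_add, add_neg_cancel, upper_zero])

lemma inv_lower {R : Type*} [CommRing R] (a : R) : (lower a)⁻¹ = lower (-a) := by
  ext i j; fin_cases i <;> fin_cases j <;> simp [lower]

lemma det_upper {R : Type*} [CommRing R] (a : R) :
    Matrix.GeneralLinearGroup.det (upper a) = 1 := by
  ext; simp [upper]

lemma det_lower {R : Type*} [CommRing R] (a : R) :
    Matrix.GeneralLinearGroup.det (lower a) = 1 := by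
  ext; simp [lower]

/-- The integral matrices in `GL₂⁺(ℚ)` have integral entries and determinant one. -/
lemma exists_int_of_mem_integralOpen {γ : GL (Fin 2) ℚ}
    (h : Matrix.GeneralLinearGroup.map ratToAdele γ ∈ integralOpen) :
    ∃ a b c d : ℤ, γ 0 0 = a ∧ γ 0 1 = b ∧ γ 1 0 = c ∧ γ 1 1 = d ∧ a * d - b * c = 1 := by
  rw [mem_integralOpen] at h
  have hint : ∀ i j, ∃ n : ℤ, γ i j = n := fun i j =>
    exists_intCast_of_norm_le_one fun ℓ => (h.2 ℓ).1 i j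
  have hd : (Matrix.GeneralLinearGroup.det (Matrix.GeneralLinearGroup.map ratToAdele γ) : Adele) =
      ratToAdele (Matrix.GeneralLinearGroup.det γ : ℚ) :=
    congrArg Units.val (Matrix.GeneralLinearGroup.map_det ratToAdele γ)
  rw [hd] at h
  have hdet : (Matrix.GeneralLinearGroup.det γ : ℚ) = 1 :=
    eq_one_of_norm_eq_one (Rat.cast_pos.1 (h.1 : (0 : ℝ) < _)) fun ℓ => (h.2 ℓ).2
  obtain ⟨a, ha⟩ := hint 0 0
  obtain ⟨b, hb⟩ := hint 0 1
  obtain ⟨c, hc⟩ := hint 1 0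
  obtain ⟨d, hd⟩ := hint 1 1
  refine ⟨a, b, c, d, ha, hb, hc, hd, ?_⟩
  rw [det_fin_two_val, ha, hb, hc, hd] at hdet
  exact_mod_cast hdet

lemma mem_integralOpen_of_int {γ : GL (Fin 2) ℚ} (h : ∀ i j, ∃ n : ℤ, γ i j = n)
    (hdet : Matrix.GeneralLinearGroup.det γ = 1) :
    Matrix.GeneralLinearGroup.map ratToAdele γ ∈ integralOpen := by
  have hd : Matrix.GeneralLinearGroup.det (Matrix.GeneralLinearGroup.map ratToAdele γ) = 1 := by
    refine (Matrix.GeneralLinearGroup.map_det ratToAdele γ).trans ?_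
    rw [hdet, map_one]
  rw [mem_integralOpen, hd]
  refine ⟨zero_lt_one, fun ℓ => ⟨fun i j => ?_, by simp⟩⟩
  obtain ⟨n, hn⟩ := h i j
  change ‖((γ i j : ℚ) : ℚ_[ℓ])‖ ≤ 1
  rw [hn, Rat.cast_intCast]
  exact Padic.norm_int_le_one n

/-- The matrices in `SL₂(ℤ)` congruent to `(1, 0; 0, 1)` modulo `(4, 2; 2, 4)`. -/
noncomputable def sanovGroup : Subgroup (GL (Fin 2) ℚ) :=
  sanovOpen.comap (Matrix.GeneralLinearGroup.map ratToAdele)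

lemma exists_int_of_mem_sanovGroup {γ : GL (Fin 2) ℚ} (h : γ ∈ sanovGroup) :
    ∃ a b c d : ℤ, γ 0 0 = a ∧ γ 0 1 = b ∧ γ 1 0 = c ∧ γ 1 1 = d ∧ a * d - b * c = 1 ∧
      4 ∣ a - 1 ∧ 2 ∣ b ∧ 2 ∣ c := by
  obtain ⟨h0, h1, h2, h3⟩ := mem_sanovOpen.1 (Subgroup.mem_comap.1 h)
  obtain ⟨a, b, c, d, ha, hb, hc, hd, hdet⟩ := exists_int_of_mem_integralOpen h0
  have key : ∀ n : ℤ, ∀ m : ℕ, ‖(n : ℚ_[2])‖ ≤ (2 : ℝ) ^ (-m : ℤ) → (2 ^ m : ℤ) ∣ n := fun n m hn =>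
    (Padic.norm_int_le_pow_iff_dvd (p := 2) n m).1 (by exact_mod_cast hn)
  refine ⟨a, b, c, d, ha, hb, hc, hd, hdet, key _ 2 ?_, key _ 1 ?_, key _ 1 ?_⟩
  · change ‖((γ 0 0 : ℚ) : ℚ_[2]) - 1‖ ≤ 1 / 4 at h1
    rw [ha] at h1
    norm_num at h1 ⊢
    exact h1
  · change ‖((γ 0 1 : ℚ) : ℚ_[2])‖ ≤ 1 / 2 at h2
    rw [hb] at h2
    norm_num at h2 ⊢
    exact h2
  · change ‖((γ 1 0 : ℚ) : ℚ_[2])‖ ≤ 1 / 2 at h3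
    rw [hc] at h3
    norm_num at h3 ⊢
    exact h3

lemma norm_two_padic : ‖((2 : ℚ) : ℚ_[2])‖ = 2⁻¹ := by
  have := Padic.norm_p (p := 2)
  norm_num at this ⊢
  exact this

lemma upper_two_mem_sanovGroup : upper (2 : ℚ) ∈ sanovGroup := by
  refine mem_sanovOpen.2 ⟨mem_integralOpen_of_int (fun i j => ?_) (det_upper _), ?_, ?_, ?_⟩
  · fin_cases i <;> fin_cases j
    exacts [⟨1, by simp [upper]⟩, ⟨2, by simp [upper]⟩, ⟨0, by simp [upper]⟩, ⟨1, by simp [upper]⟩]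
  · simp [upper]
  · simp [upper]
    exact norm_two_padic.le
  · simp [upper]

lemma lower_two_mem_sanovGroup : lower (2 : ℚ) ∈ sanovGroup := by
  refine mem_sanovOpen.2 ⟨mem_integralOpen_of_int (fun i j => ?_) (det_lower _), ?_, ?_, ?_⟩
  · fin_cases i <;> fin_cases j
    exacts [⟨1, by simp [lower]⟩, ⟨0, by simp [lower]⟩, ⟨2, by simp [lower]⟩, ⟨1, by simp [lower]⟩]
  · simp [lower]
  · simp [lower]
  · simp [lower]
    exact norm_two_padic.le

lemma upper_zpow {R : Type*} [CommRing R] (a : R) (n : ℤ) : upper a ^ n = upper (n * a) := by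
  induction n using Int.induction_on with
  | zero => simp [upper_zero]
  | succ n ih => rw [zpow_add_one, ih, ← upper_add]; congr 1; push_cast; ring
  | pred n ih => rw [zpow_sub_one, ih, inv_upper, ← upper_add]; congr 1; push_cast; ring

/-- The Euclidean algorithm for the first column of a matrix in the Sanov group. -/
lemma mem_of_mem_sanovGroup {K : Subgroup (GL (Fin 2) ℚ)} (hA : upper 2 ∈ K) (hB : lower 2 ∈ K)
    (n : ℕ) : ∀ γ ∈ sanovGroup, ∀ a c : ℤ, γ 0 0 = a → γ 1 0 = c →
      a.natAbs + c.natAbs = n → γ ∈ K := by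
  induction n using Nat.strong_induction_on with
  | _ n ih =>
    intro γ hγ a c ha hc hn
    obtain ⟨a', b, c', d, ha', hb, hc', hd, hdet, h4, h2b, h2c⟩ := exists_int_of_mem_sanovGroup hγ
    obtain rfl : a = a' := by exact_mod_cast ha.symm.trans ha'
    obtain rfl : c = c' := by exact_mod_cast hc.symm.trans hc'
    have hA' : upper (-2) ∈ K := inv_upper (2 : ℚ) ▸ K.inv_mem hA
    have hB' : lower (-2) ∈ K := inv_lower (2 : ℚ) ▸ K.inv_mem hB
    have hAΓ : upper (-2) ∈ sanovGroup :=
      inv_upper (2 : ℚ) ▸ sanovGroup.inv_mem upper_two_mem_sanovGroup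
    have hBΓ : lower (-2) ∈ sanovGroup :=
      inv_lower (2 : ℚ) ▸ sanovGroup.inv_mem lower_two_mem_sanovGroup
    by_cases hc0 : c = 0
    · have had : a * d = 1 := by rw [hc0] at hdet; linarith
      -- The congruence modulo 4 excludes `a = -1`.
      have ha1 : a = 1 := by rcases Int.eq_one_or_neg_one_of_mul_eq_one had with h | h <;> omega
      have hd1 : d = 1 := by rwa [ha1, one_mul] at had
      obtain ⟨m, rfl⟩ := h2b
      have hγ' : γ = upper (2 : ℚ) ^ m := by
        rw [upper_zpow, mul_comm]
        ext i j
        fin_cases i <;> fin_cases j <;> simp [upper, ha, hb, hc, hd, ha1, hd1, hc0]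
      rw [hγ']
      exact K.zpow_mem hA m
    have hstep : ∀ g ∈ K, g ∈ sanovGroup → ∀ a₁ c₁ : ℤ, (g * γ) 0 0 = a₁ → (g * γ) 1 0 = c₁ →
        a₁.natAbs + c₁.natAbs < n → γ ∈ K := fun g hgK hg a₁ c₁ h1 h2 h3 =>
      (K.mul_mem_cancel_left hgK).1 (ih _ h3 (g * γ) (mul_mem hg hγ) a₁ c₁ h1 h2 rfl)
    -- Since `a` is odd and `c` even, `|a| ≠ |c|`. Adding or subtracting twice the smaller entry,
    -- according to the signs, strictly decreases the larger one.
    rcases lt_or_ge c.natAbs a.natAbs with hlt | hge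
    · by_cases hs : (0 < a ↔ 0 < c)
      · refine hstep _ hA' hAΓ (a - 2 * c) c ?_ ?_ (by omega)
        · rw [upper_mul_apply, ha, hc]; push_cast; simp; ring
        · rw [upper_mul_apply, hc]; simp
      · refine hstep _ hA upper_two_mem_sanovGroup (a + 2 * c) c ?_ ?_ (by omega)
        · rw [upper_mul_apply, ha, hc]; push_cast; simp
        · rw [upper_mul_apply, hc]; simp
    · by_cases hs : (0 < a ↔ 0 < c)
      · refine hstep _ hB' hBΓ a (c - 2 * a) ?_ ?_ (by omega)
        · rw [lower_mul_apply, ha]; simp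
        · rw [lower_mul_apply, ha, hc]; push_cast; simp; ring
      · refine hstep _ hB lower_two_mem_sanovGroup a (c + 2 * a) ?_ ?_ (by omega)
        · rw [lower_mul_apply, ha]; simp
        · rw [lower_mul_apply, ha, hc]; push_cast; simp

/-- The two generators of the Sanov group. -/
noncomputable def sanovGen (i : Bool) : sanovGroup :=
  bif i then ⟨upper 2, upper_two_mem_sanovGroup⟩ else ⟨lower 2, lower_two_mem_sanovGroup⟩

lemma fst_column_ne_zero (g : GL (Fin 2) ℚ) : g 0 0 ≠ 0 ∨ g 1 0 ≠ 0 := by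
  by_contra! h
  have h1 := (Matrix.GeneralLinearGroup.det g).ne_zero
  rw [det_fin_two_val, h.1, h.2] at h1
  simp at h1

/-- Ping-pong on the ratio `a / c` of the first column. The four sets partition the projective line:
`XA` is `[1, ∞]`, `YA` is `(-∞, -1)`, `XB` is `[0, 1)` and `YB` is `[-1, 0)`. The generator `upper
2` adds 2 to `a / c`, and `lower 2` adds 2 to `c / a`. -/
lemma sanovGen_lift_injective : Function.Injective (FreeGroup.lift sanovGen) := by
  let XA : Set (GL (Fin 2) ℚ) := {g | g 1 0 ^ 2 ≤ g 0 0 * g 1 0}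
  let YA : Set (GL (Fin 2) ℚ) := {g | g 0 0 * g 1 0 < -g 1 0 ^ 2}
  let XB : Set (GL (Fin 2) ℚ) := {g | 0 ≤ g 0 0 * g 1 0 ∧ g 0 0 * g 1 0 < g 1 0 ^ 2}
  let YB : Set (GL (Fin 2) ℚ) := {g | -g 1 0 ^ 2 ≤ g 0 0 * g 1 0 ∧ g 0 0 * g 1 0 < 0}
  refine FreeGroup.injective_lift_of_ping_pong sanovGen (fun i => bif i then XA else XB)
    (fun i => bif i then YA else YB) ?_ ?_ ?_ ?_ ?_ ?_
  · rintro (_ | _)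
    · exact ⟨lower 2, by simp [XB, lower]; norm_num⟩
    · exact ⟨1, by simp [XA]⟩
  · rintro (_ | _) (_ | _) hij
    all_goals
      refine Set.disjoint_left.2 fun g h1 h2 => ?_
      simp only [XA, XB, cond_true, cond_false, Set.mem_ofPred_eq] at h1 h2
      grind
  · rintro (_ | _) (_ | _) hij
    all_goals
      refine Set.disjoint_left.2 fun g h1 h2 => ?_
      simp only [YA, YB, cond_true, cond_false, Set.mem_ofPred_eq] at h1 h2
      grind
  · rintro (_ | _) (_ | _)
    all_goals
      refine Set.disjoint_left.2 fun g h1 h2 => ?_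
      simp only [XA, XB, YA, YB, cond_true, cond_false, Set.mem_ofPred_eq] at h1 h2
      have := sq_nonneg (g 1 0)
      grind
  · rintro (_ | _) _ ⟨g, hg, rfl⟩
    · have h0 := fst_column_ne_zero g
      have e0 : (lower (2 : ℚ) * g) 0 0 = g 0 0 := by simp [lower_mul_apply]
      have e1 : (lower (2 : ℚ) * g) 1 0 = g 1 0 + 2 * g 0 0 := by simp [lower_mul_apply]
      change lower 2 * g ∈ XB
      change ¬ (_ ∧ _) at hg
      change 0 ≤ (lower (2 : ℚ) * g) 0 0 * (lower (2 : ℚ) * g) 1 0 ∧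
        (lower (2 : ℚ) * g) 0 0 * (lower (2 : ℚ) * g) 1 0 < (lower (2 : ℚ) * g) 1 0 ^ 2
      rw [e0, e1]
      generalize g 0 0 = a at *
      generalize g 1 0 = c at *
      have hp : 0 < a ^ 2 + c ^ 2 := by
        rcases h0 with h | h
        · nlinarith [sq_nonneg c, sq_pos_of_ne_zero h]
        · nlinarith [sq_nonneg a, sq_pos_of_ne_zero h]
      rcases lt_or_ge (a * c) (-c ^ 2) with h | h
      · exact ⟨by nlinarith [sq_nonneg (a + c)], by nlinarith [sq_nonneg (a + c)]⟩
      · have h' : 0 ≤ a * c := by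
          by_contra hn
          exact hg ⟨h, not_le.1 hn⟩
        exact ⟨by nlinarith [sq_nonneg a], by nlinarith [sq_nonneg a]⟩
    · have e0 : (upper (2 : ℚ) * g) 0 0 = g 0 0 + 2 * g 1 0 := by simp [upper_mul_apply]
      have e1 : (upper (2 : ℚ) * g) 1 0 = g 1 0 := by simp [upper_mul_apply]
      change ¬ (g 0 0 * g 1 0 < -g 1 0 ^ 2) at hg
      change (upper (2 : ℚ) * g) 1 0 ^ 2 ≤ (upper (2 : ℚ) * g) 0 0 * (upper (2 : ℚ) * g) 1 0
      rw [e0, e1]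
      nlinarith
  · rintro (_ | _) _ ⟨g, hg, rfl⟩
    · have h0 := fst_column_ne_zero g
      have e : ((sanovGen⁻¹ false : sanovGroup) • g : GL (Fin 2) ℚ) = lower (-2) * g :=
        congrArg (· * g) (inv_lower (2 : ℚ))
      have e0 : (lower (-2 : ℚ) * g) 0 0 = g 0 0 := by simp [lower_mul_apply]
      have e1 : (lower (-2 : ℚ) * g) 1 0 = g 1 0 - 2 * g 0 0 := by
        simp [lower_mul_apply, sub_eq_add_neg]
      change ¬ (_ ∧ _) at hg
      change (sanovGen⁻¹ false : sanovGroup) • g ∈ YB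
      rw [e]
      change -(lower (-2 : ℚ) * g) 1 0 ^ 2 ≤ (lower (-2 : ℚ) * g) 0 0 * (lower (-2 : ℚ) * g) 1 0 ∧
        (lower (-2 : ℚ) * g) 0 0 * (lower (-2 : ℚ) * g) 1 0 < 0
      rw [e0, e1]
      generalize g 0 0 = a at *
      generalize g 1 0 = c at *
      have hp : 0 < a ^ 2 + c ^ 2 := by
        rcases h0 with h | h
        · nlinarith [sq_nonneg c, sq_pos_of_ne_zero h]
        · nlinarith [sq_nonneg a, sq_pos_of_ne_zero h]
      rcases lt_or_ge (a * c) 0 with h | h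
      · exact ⟨by nlinarith [sq_nonneg a], by nlinarith [sq_nonneg a]⟩
      · have h' : c ^ 2 ≤ a * c := by
          by_contra hn
          exact hg ⟨h, not_le.1 hn⟩
        exact ⟨by nlinarith [sq_nonneg (a - c)], by nlinarith [sq_nonneg (a - c)]⟩
    · have e : ((sanovGen⁻¹ true : sanovGroup) • g : GL (Fin 2) ℚ) = upper (-2) * g :=
        congrArg (· * g) (inv_upper (2 : ℚ))
      have e0 : (upper (-2 : ℚ) * g) 0 0 = g 0 0 - 2 * g 1 0 := by
        simp [upper_mul_apply, sub_eq_add_neg]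
      have e1 : (upper (-2 : ℚ) * g) 1 0 = g 1 0 := by simp [upper_mul_apply]
      change ¬ (g 1 0 ^ 2 ≤ g 0 0 * g 1 0) at hg
      change (sanovGen⁻¹ true : sanovGroup) • g ∈ YA
      rw [e]
      change (upper (-2 : ℚ) * g) 0 0 * (upper (-2 : ℚ) * g) 1 0 < -(upper (-2 : ℚ) * g) 1 0 ^ 2
      rw [e0, e1]
      nlinarith

lemma sanovGen_lift_surjective : Function.Surjective (FreeGroup.lift sanovGen) := by
  rintro ⟨γ, hγ⟩
  have hK : ∀ i, (sanovGen i : GL (Fin 2) ℚ) ∈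
      (FreeGroup.lift sanovGen).range.map sanovGroup.subtype := fun i =>
    ⟨sanovGen i, ⟨FreeGroup.of i, FreeGroup.lift_apply_of⟩, rfl⟩
  obtain ⟨a, b, c, d, ha, hb, hc, hd, -⟩ := exists_int_of_mem_sanovGroup hγ
  obtain ⟨_, ⟨w, rfl⟩, hw⟩ := mem_of_mem_sanovGroup (hK true) (hK false) _ γ hγ a c ha hc rfl
  exact ⟨w, Subtype.ext hw⟩

/-- Sanov's theorem: the matrices `(1, 2; 0, 1)` and `(1, 0; 2, 1)` generate `sanovGroup` freely. -/
noncomputable def sanovEquiv : FreeGroup Bool ≃* sanovGroup :=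
  MulEquiv.ofBijective _ ⟨sanovGen_lift_injective, sanovGen_lift_surjective⟩

lemma isZero_groupCohomology_contFun (L : Type) [NormedField L] (n : ℕ) :
    Limits.IsZero (groupCohomology (contFun L) (n + 2)) :=
  (isZero_leftRep_iff L (j := Matrix.GeneralLinearGroup.map (n := Fin 2) ratToAdele)
    (U := (sanovOpen : Set (GL (Fin 2) Adele))) (Γ := sanovGroup)
    (fun _ _ hx => sanovOpen.mul_mem_cancel_right hx)
    isOpen_sanovOpen exists_mul_mem_sanovOpen (n + 2)).2
    (isZero_groupCohomology_of_free sanovEquiv n _)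

end Sanov

/-! ### Reduction from `B(ℚ)` to an infinite cyclic group -/

section BorelOpen

/-- The prime `3`. -/
abbrev primeThree : Nat.Primes := ⟨3, Nat.prime_three⟩

/-- The elements of `GL₂(ℝ)⁺ × ∏ GL₂(ℤ_ℓ)` whose bottom row at `3` has first nonzero residue
`1`. -/
def borelOpen : Set (GL (Fin 2) Adele) :=
  {x | x ∈ integralOpen ∧ (‖evalFin primeThree (x 1 0) - 1‖ < 1 ∨
    (‖evalFin primeThree (x 1 0)‖ < 1 ∧ ‖evalFin primeThree (x 1 1) - 1‖ < 1))}

lemma isOpen_borelOpen : IsOpen borelOpen := by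
  have hc : ∀ i j, Continuous fun x : GL (Fin 2) Adele => evalFin primeThree (x i j) := fun i j =>
    (continuous_evalFin _).comp (continuous_gl_apply i j)
  have h1 : ∀ i j, ∀ a : ℚ_[3],
      IsOpen {x : GL (Fin 2) Adele | ‖evalFin primeThree (x i j) - a‖ < 1} := fun i j a =>
    isOpen_lt ((hc i j).sub continuous_const).norm continuous_const
  have h2 : IsOpen {x : GL (Fin 2) Adele | ‖evalFin primeThree (x 1 0)‖ < 1} := by
    simpa using h1 1 0 0
  exact isOpen_integralOpen.inter ((h1 1 0 1).union (h2.inter (h1 1 1 1)))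

lemma norm_three_trichotomy {z : ℚ_[3]} (hz : ‖z‖ ≤ 1) :
    ‖z‖ < 1 ∨ ‖z - 1‖ < 1 ∨ ‖-z - 1‖ < 1 := by
  obtain ⟨n, hn, hzn⟩ := PadicInt.exists_mem_range (⟨z, hz⟩ : ℤ_[3])
  rw [PadicInt.maximalIdeal_eq_span_p, Ideal.mem_span_singleton,
    ← PadicInt.norm_lt_one_iff_dvd] at hzn
  replace hzn : ‖z - n‖ < 1 := hzn
  interval_cases n
  · exact Or.inl (by simpa using hzn)
  · exact Or.inr (Or.inl (by simpa using hzn))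
  · refine Or.inr (Or.inr ?_)
    rw [show -z - 1 = -(z - (2 : ℕ)) + -(3 : ℕ) by push_cast; ring]
    refine (Padic.nonarchimedean _ _).trans_lt (max_lt (by rwa [norm_neg]) ?_)
    rw [norm_neg]
    exact Padic.norm_natCast_lt_one_iff.2 (dvd_refl 3)

lemma upper_mem_integralOpen {w : Adele} (hw : ∀ ℓ, ‖evalFin ℓ w‖ ≤ 1) :
    upper w ∈ integralOpen := by
  rw [mem_integralOpen, det_upper]
  refine ⟨zero_lt_one, fun ℓ => ⟨fun i j => ?_, by simp⟩⟩
  fin_cases i <;> fin_cases j <;> simp [upper, hw]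

/-- The condition at 3 involves only the bottom row, which unipotent matrices fix; so all integral
adelic translations act, not just the rational ones. -/
lemma upper_mul_mem_borelOpen {w : Adele} (hw : ∀ ℓ, ‖evalFin ℓ w‖ ≤ 1)
    {x : GL (Fin 2) Adele} (hx : x ∈ borelOpen) : upper w * x ∈ borelOpen := by
  have h1 : ∀ i, (upper w * x) 1 i = x 1 i := fun i => by simp [upper_mul_apply]
  refine ⟨integralOpen.mul_mem (upper_mem_integralOpen hw) hx.1, ?_⟩
  rw [h1, h1]
  exact hx.2

/-- The matrix `(1, -1; 0, 1)` as an element of `B(ℚ)`. -/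
def borelGen : borel ℚ := ⟨upper (-1), by simp [borel, upper]⟩

lemma borelGen_zpow (n : ℤ) : (borelGen ^ n : borel ℚ).1 = upper (-n : ℚ) := by
  rw [SubgroupClass.coe_zpow, borelGen, upper_zpow, mul_neg_one]

lemma zpowersHom_borelGen_injective : Function.Injective (zpowersHom (borel ℚ) borelGen) := by
  intro m n h
  have h1 := congrArg (fun g : borel ℚ => g.1 0 1) h
  simp only [zpowersHom_apply, borelGen_zpow] at h1
  have h2 : (-(m.toAdd : ℤ) : ℚ) = -(n.toAdd : ℤ) := by simpa [upper] using h1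
  have h3 : m.toAdd = n.toAdd := by exact_mod_cast neg_injective h2
  exact h3

/-- The group of integral unipotent upper triangular matrices. -/
def unipotentGroup : Subgroup (borel ℚ) := (zpowersHom (borel ℚ) borelGen).range

/-- The group of integral unipotent upper triangular matrices is infinite cyclic. -/
noncomputable def unipotentEquiv : FreeGroup Unit ≃* unipotentGroup :=
  FreeGroup.mulEquivIntOfUnique.trans (MonoidHom.ofInjective zpowersHom_borelGen_injective)

/-- The inclusion of `B(ℚ)` in `GL₂(𝔸)`. -/
noncomputable def borelToAdele : borel ℚ →* GL (Fin 2) Adele :=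
  (Matrix.GeneralLinearGroup.map ratToAdele).comp (borel ℚ).subtype

lemma mem_borelOpen_of_mem_unipotentGroup {b : borel ℚ} (hb : b ∈ unipotentGroup)
    {x : GL (Fin 2) Adele} (hx : x ∈ borelOpen) : borelToAdele b * x ∈ borelOpen := by
  obtain ⟨n, rfl⟩ := hb
  have h1 : borelToAdele (zpowersHom (borel ℚ) borelGen n) =
      upper (ratToAdele (-(n.toAdd : ℤ) : ℚ)) := by
    rw [← map_upper, ← borelGen_zpow]
    rfl
  rw [h1]
  refine upper_mul_mem_borelOpen (fun ℓ => ?_) hx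
  change ‖((-(n.toAdd : ℤ) : ℚ) : ℚ_[ℓ])‖ ≤ 1
  rw [Rat.cast_neg, norm_neg, Rat.cast_intCast]
  exact Padic.norm_int_le_one _

/-- An integral element of `B(ℚ)` of determinant one has diagonal `(1, 1)` or `(-1, -1)`. The second
would negate the leading residue of the bottom row, and `-1 ≠ 1` modulo 3. -/
lemma mem_unipotentGroup_of_mem_borelOpen {b : borel ℚ} {x : GL (Fin 2) Adele} (hx : x ∈ borelOpen)
    (hbx : borelToAdele b * x ∈ borelOpen) : b ∈ unipotentGroup := by
  have hb : borelToAdele b ∈ integralOpen := (integralOpen.mul_mem_cancel_right hx.1).1 hbx.1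
  obtain ⟨a, e, c, d, ha, he, hc, hd, hdet⟩ := exists_int_of_mem_integralOpen (γ := b.1) hb
  have hc0 : c = 0 := by exact_mod_cast hc.symm.trans b.2
  have had : a * d = 1 := by rw [hc0] at hdet; linarith
  have hrow : ∀ i, evalFin primeThree ((borelToAdele b * x) 1 i) =
      d * evalFin primeThree (x 1 i) := by
    intro i
    rw [mul_apply_fin_two, map_add, map_mul, map_mul]
    have h1 : evalFin primeThree (borelToAdele b 1 0) = ((b.1 1 0 : ℚ) : ℚ_[3]) := rfl
    have h2 : evalFin primeThree (borelToAdele b 1 1) = ((b.1 1 1 : ℚ) : ℚ_[3]) := rfl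
    rw [h1, h2, hc, hd, hc0]
    simp
  have hd1 : d = 1 := by
    rcases Int.eq_one_or_neg_one_of_mul_eq_one' had with h | h
    · exact h.2
    exfalso
    have h2 := hx.2
    have h3 := hbx.2
    rw [hrow, hrow, h.2] at h3
    -- In each of the four cases the sum of two elements of norm less than 1 is `-2` or `-1`, a unit
    -- at 3.
    have key : ∀ y z w : ℚ_[3], ‖y‖ < 1 → ‖z‖ < 1 → w = y + z → ‖w‖ = 1 → False := by
      intro y z w hy hz hw h1
      have := Padic.nonarchimedean y z
      rw [← hw, h1] at this
      exact absurd this (not_le.2 (max_lt hy hz))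
    have hn2 : ‖(-2 : ℚ_[3])‖ = 1 := by
      rw [norm_neg]
      exact_mod_cast (Padic.norm_natCast_eq_one_iff (p := 3) (n := 2)).2 (by norm_num)
    push_cast at h3
    rcases h2 with h2 | ⟨h2, h2'⟩ <;> rcases h3 with h3 | ⟨h3, h3'⟩
    · exact key _ _ _ h2 h3 (by ring) hn2
    · exact key _ _ (-1) h2 h3 (by ring) (by simp)
    · exact key _ _ (-1) h2 h3 (by ring) (by simp)
    · exact key _ _ _ h2' h3' (by ring) hn2
  have ha1 : a = 1 := by rwa [hd1, mul_one] at had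
  refine ⟨Multiplicative.ofAdd (-e), Subtype.ext ?_⟩
  rw [zpowersHom_apply, borelGen_zpow]
  ext i j
  fin_cases i <;> fin_cases j <;> simp [upper, ha, he, hc, hd, ha1, hd1, hc0]

/-- The bottom row is nonzero modulo 3, so its leading residue is `1` or `-1`; the rational scalar
`-1` exchanges the two. -/
lemma exists_mul_mem_borelOpen (x : GL (Fin 2) Adele) : ∃ b, borelToAdele b * x ∈ borelOpen := by
  obtain ⟨b, hb⟩ := exists_borel_mul_mem_integralOpen x
  change borelToAdele b * x ∈ integralOpen at hb
  set y := borelToAdele b * x with hy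
  let s : borel ℚ := ⟨diag (-1) (-1), by simp [borel, diag]⟩
  have hs : borelToAdele s ∈ integralOpen := by
    refine mem_integralOpen_of_int (fun i j => ?_) ?_
    · fin_cases i <;> fin_cases j
      exacts [⟨-1, by simp [s, diag]⟩, ⟨0, by simp [s, diag]⟩, ⟨0, by simp [s, diag]⟩,
        ⟨-1, by simp [s, diag]⟩]
    · simp [s, det_diag]
  have hsy : ∀ i, evalFin primeThree ((borelToAdele s * y) 1 i) =
      - evalFin primeThree (y 1 i) := by
    intro i
    rw [mul_apply_fin_two, map_add, map_mul, map_mul]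
    have h1 : evalFin primeThree (borelToAdele s 1 0) = ((0 : ℚ) : ℚ_[3]) := rfl
    have h2 : evalFin primeThree (borelToAdele s 1 1) = ((-1 : ℚ) : ℚ_[3]) := rfl
    rw [h1, h2]
    simp
  have hor : y ∈ borelOpen ∨ borelToAdele s * y ∈ borelOpen := by
    obtain ⟨hint, hdet⟩ := (mem_integralOpen.1 hb).2 primeThree
    rw [det_fin_two_val, map_sub, map_mul, map_mul] at hdet
    have hs' := integralOpen.mul_mem hs hb
    rcases norm_three_trichotomy (hint 1 0) with h | h | h
    · rcases norm_three_trichotomy (hint 1 1) with h' | h' | h'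
      · exfalso
        have h1 := Padic.nonarchimedean (evalFin primeThree (y 0 0) * evalFin primeThree (y 1 1))
          (-(evalFin primeThree (y 0 1) * evalFin primeThree (y 1 0)))
        rw [← sub_eq_add_neg, hdet, norm_neg, norm_mul, norm_mul] at h1
        refine absurd h1 (not_le.2 (max_lt ?_ ?_))
        · exact (mul_le_of_le_one_left (norm_nonneg _) (hint 0 0)).trans_lt h'
        · exact (mul_le_of_le_one_left (norm_nonneg _) (hint 0 1)).trans_lt h
      · exact Or.inl ⟨hb, Or.inr ⟨h, h'⟩⟩
      · exact Or.inr ⟨hs', Or.inr ⟨by rwa [hsy, norm_neg], by rwa [hsy]⟩⟩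
    · exact Or.inl ⟨hb, Or.inl h⟩
    · exact Or.inr ⟨hs', Or.inl (by rwa [hsy])⟩
  rcases hor with h | h
  · exact ⟨b, h⟩
  · exact ⟨s * b, by rwa [map_mul, mul_assoc]⟩

lemma borelToAdele_mul_mem_borelOpen_iff (b : borel ℚ) (x : GL (Fin 2) Adele)
    (hx : x ∈ borelOpen) : borelToAdele b * x ∈ borelOpen ↔ b ∈ unipotentGroup :=
  ⟨mem_unipotentGroup_of_mem_borelOpen hx, fun hb => mem_borelOpen_of_mem_unipotentGroup hb hx⟩

lemma isZero_groupCohomology_borel_iff (L : Type) [NormedField L] (n : ℕ) :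
    Limits.IsZero (groupCohomology (Rep.res (borel ℚ).subtype (contFun L)) n) ↔
      Limits.IsZero (groupCohomology (leftRepOn L borelToAdele_mul_mem_borelOpen_iff) n) :=
  isZero_leftRep_iff L (j := borelToAdele) (Γ := unipotentGroup)
    borelToAdele_mul_mem_borelOpen_iff isOpen_borelOpen exists_mul_mem_borelOpen n

lemma isZero_groupCohomology_borel_add_two (L : Type) [NormedField L] (n : ℕ) :
    Limits.IsZero (groupCohomology (Rep.res (borel ℚ).subtype (contFun L)) (n + 2)) :=
  (isZero_groupCohomology_borel_iff L (n + 2)).2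
    (isZero_groupCohomology_of_free unipotentEquiv n _)

end BorelOpen

/-! ### The difference equation on `∏ ℤ_ℓ` -/

section DifferenceEquation

lemma intCast_dvd_of_zHat {N : ℕ} (hN : N ≠ 0) {k : ℤ} (h : (N : ZHat) ∣ (k : ZHat)) :
    (N : ℤ) ∣ k := by
  obtain ⟨w, hw⟩ := h
  have hN' : (N : ℚ) ≠ 0 := Nat.cast_ne_zero.2 hN
  obtain ⟨m, hm⟩ := exists_intCast_of_norm_le_one (q := (k : ℚ) / N) fun ℓ => by
    have h1 : ((k : ℤ_[ℓ]) : ℚ_[ℓ]) = ((N : ℤ_[ℓ]) : ℚ_[ℓ]) * (w ℓ : ℚ_[ℓ]) := by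
      rw [← PadicInt.coe_mul]
      exact congrArg _ (congrFun hw ℓ)
    have h2 : (N : ℚ_[ℓ]) ≠ 0 := Nat.cast_ne_zero.2 hN
    push_cast at h1 ⊢
    rw [h1, mul_div_cancel_left₀ _ h2]
    exact (w ℓ).2
  refine ⟨m, ?_⟩
  rw [div_eq_iff hN'] at hm
  have : (k : ℚ) = ((N * m : ℤ) : ℚ) := by rw [hm]; push_cast; ring
  exact_mod_cast this

variable {L : Type*} [NormedField L]

/-- The partial sums of a continuous function on `∏ ℤ_ℓ`. -/
noncomputable def partialSum (g : C(ZHat, L)) (n : ℕ) : L := ∑ k ∈ Finset.range n, g k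

lemma partialSum_succ (g : C(ZHat, L)) (n : ℕ) : partialSum g (n + 1) = partialSum g n + g n :=
  Finset.sum_range_succ _ _

variable [IsUltrametricDist L]

lemma norm_sub_le_of_norm_sub_le {x y z : L} {r : ℝ} (h1 : ‖x - y‖ ≤ r) (h2 : ‖y - z‖ ≤ r) :
    ‖x - z‖ ≤ r := by
  rw [← sub_add_sub_cancel x y z]
  exact (IsUltrametricDist.norm_add_le_max _ _).trans (max_le h1 h2)

lemma norm_partialSum_sub_le {g g' : C(ZHat, L)} {r : ℝ} (hr : 0 ≤ r)
    (h : ∀ z, ‖g z - g' z‖ ≤ r) (n : ℕ) : ‖partialSum g n - partialSum g' n‖ ≤ r := by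
  rw [partialSum, partialSum, ← Finset.sum_sub_distrib]
  exact IsUltrametricDist.norm_sum_le_of_forall_le_of_nonneg hr fun k _ => h k

/-- The partial sums of a continuous function are almost periodic. -/
lemma exists_partialSum_period {p : ℕ} (hp0 : p ≠ 0) (hlt : ‖(p : L)‖ < 1)
    (g : C(ZHat, L)) {r : ℝ} (hr : 0 < r) :
    ∃ M : ℕ, M ≠ 0 ∧ ∀ n j, ‖partialSum g (n + j * M) - partialSum g n‖ ≤ r := by
  have huc : UniformContinuous g := CompactSpace.uniformContinuous_of_continuous g.continuous
  have h1 : {q : ZHat × ZHat | dist (g q.1) (g q.2) < r} ∈ uniformity ZHat :=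
    huc (Metric.dist_mem_uniformity hr)
  rw [uniformity_eq_comap_nhds_zero] at h1
  obtain ⟨W, hW, hWs⟩ := h1
  obtain ⟨N, hN, hNW⟩ := exists_natCast_mul_mem hW
  have h2 : ∀ z w : ZHat, ‖g (z + N * w) - g z‖ ≤ r := by
    intro z w
    have h3 : (z, z + N * w) ∈ {q : ZHat × ZHat | dist (g q.1) (g q.2) < r} := hWs (by
      simpa using hNW w)
    rw [← dist_eq_norm, dist_comm]
    exact h3.le
  -- Near `N`-periodicity of `g` makes the sum over any `N` consecutive integers nearly constant;
  -- the ultrametric inequality keeps errors from accumulating.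
  have h3 : ∀ n, ‖partialSum g (n + N) - partialSum g n - partialSum g N‖ ≤ r := by
    intro n
    induction n with
    | zero => simpa [partialSum] using hr.le
    | succ n ih =>
      rw [show n + 1 + N = n + N + 1 by ring, partialSum_succ, partialSum_succ]
      rw [show partialSum g (n + N) + g ↑(n + N) - (partialSum g n + g n) - partialSum g N =
        (partialSum g (n + N) - partialSum g n - partialSum g N) +
          (g (n + N * 1) - g n) by push_cast; ring_nf]
      exact (IsUltrametricDist.norm_add_le_max _ _).trans (max_le ih (h2 _ _))
  have h4 : ∀ j n, ‖partialSum g (n + j * N) - partialSum g n - j * partialSum g N‖ ≤ r := by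
    intro j n
    induction j with
    | zero => simpa using hr.le
    | succ j ih =>
      rw [show n + (j + 1) * N = (n + j * N) + N by ring]
      rw [show partialSum g (n + j * N + N) - partialSum g n - ((j + 1 : ℕ) : L) * partialSum g N =
        (partialSum g (n + j * N + N) - partialSum g (n + j * N) - partialSum g N) +
        (partialSum g (n + j * N) - partialSum g n - j * partialSum g N) by push_cast; ring]
      exact (IsUltrametricDist.norm_add_le_max _ _).trans (max_le (h3 _) ih)
  -- Here `‖p‖ < 1` enters: lengthening the period by `p ^ k` multiplies the drift `partialSum g N`
  -- by `p ^ k`.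
  obtain ⟨k, hk⟩ : ∃ k : ℕ, ‖((p ^ k : ℕ) : L) * partialSum g N‖ ≤ r := by
    have ht : Tendsto (fun k : ℕ => ‖(p : L)‖ ^ k * ‖partialSum g N‖) atTop (𝓝 0) := by
      simpa using (tendsto_pow_atTop_nhds_zero_of_lt_one (norm_nonneg _) hlt).mul_const _
    obtain ⟨k, hk⟩ := (ht.eventually (ge_mem_nhds hr)).exists
    exact ⟨k, by simpa using hk⟩
  have h5 : ∀ n, ‖partialSum g (n + p ^ k * N) - partialSum g n‖ ≤ r := by
    intro n
    have h6 := h4 (p ^ k) n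
    rw [show partialSum g (n + p ^ k * N) - partialSum g n =
      (partialSum g (n + p ^ k * N) - partialSum g n - ((p ^ k : ℕ) : L) * partialSum g N) +
        ((p ^ k : ℕ) : L) * partialSum g N by ring]
    exact (IsUltrametricDist.norm_add_le_max _ _).trans (max_le h6 hk)
  refine ⟨p ^ k * N, mul_ne_zero (pow_ne_zero _ hp0) hN, fun n j => ?_⟩
  induction j with
  | zero => simpa using hr.le
  | succ j ih =>
    rw [show n + (j + 1) * (p ^ k * N) = n + j * (p ^ k * N) + p ^ k * N by ring]
    exact norm_sub_le_of_norm_sub_le (h5 _) ih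

lemma exists_norm_partialSum_sub_le {p : ℕ} (hp0 : p ≠ 0) (hlt : ‖(p : L)‖ < 1)
    (g : C(ZHat, L)) {r : ℝ} (hr : 0 < r) :
    ∃ M : ℕ, M ≠ 0 ∧ ∀ n m : ℕ, (M : ZHat) ∣ (n : ZHat) - m →
      ‖partialSum g n - partialSum g m‖ ≤ r := by
  obtain ⟨M, hM, h⟩ := exists_partialSum_period hp0 hlt g hr
  have key : ∀ n m : ℕ, m ≤ n → (M : ℤ) ∣ (n : ℤ) - m →
      ‖partialSum g n - partialSum g m‖ ≤ r := by
    intro n m hmn hd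
    obtain ⟨j, hj⟩ : M ∣ n - m := by
      rw [← Int.natCast_dvd_natCast, Nat.cast_sub hmn]
      exact hd
    have h1 : n = m + j * M := by rw [mul_comm j, ← hj]; omega
    rw [h1]
    exact h m j
  refine ⟨M, hM, fun n m hd => ?_⟩
  have hd' : (M : ℤ) ∣ (n : ℤ) - m := intCast_dvd_of_zHat hM (by push_cast; exact hd)
  rcases le_total m n with hmn | hmn
  · exact key n m hmn hd'
  · rw [norm_sub_rev]
    exact key m n hmn (by rwa [dvd_sub_comm])

lemma exists_extension_partialSum [CompleteSpace L] {p : ℕ} (hp0 : p ≠ 0) (hlt : ‖(p : L)‖ < 1)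
    (g : C(ZHat, L)) :
    ∃ h : C(ZHat, L), ∀ n : ℕ, h n = partialSum g n := by
  let s : Set ZHat := Set.range (Nat.cast : ℕ → ZHat)
  have hs : Dense s := denseRange_natCast_zHat
  -- Any natural number representing the point will do: equal images have difference `0`, divisible
  -- by every `M`, so their partial sums agree up to every `r`.
  choose c hc using fun x : s => x.2
  have huc : UniformContinuous fun x : s => partialSum g (c x) := by
    intro u hu
    obtain ⟨r, hr, hru⟩ := Metric.uniformity_basis_dist_le.mem_iff.1 hu
    obtain ⟨M, hM, h⟩ := exists_norm_partialSum_sub_le hp0 hlt g hr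
    have h1 : {q : ZHat × ZHat | (M : ZHat) ∣ q.2 - q.1} ∈ uniformity ZHat := by
      rw [uniformity_eq_comap_nhds_zero]
      exact preimage_mem_comap (setOf_natCast_dvd_mem_nhds hM)
    refine mem_map.2 (mem_of_superset (preimage_mem_comap h1) fun q hq => hru ?_)
    change dist (partialSum g (c q.1)) (partialSum g (c q.2)) ≤ r
    rw [dist_comm, dist_eq_norm]
    refine h _ _ ?_
    rw [hc, hc]
    exact hq
  refine ⟨⟨hs.extend _, (hs.uniformContinuous_extend huc).continuous⟩, fun n => ?_⟩
  have h1 := hs.extend_of_ind huc ⟨n, n, rfl⟩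
  refine h1.trans (eq_of_forall_dist_le fun r hr => ?_)
  obtain ⟨M, -, hM⟩ := exists_norm_partialSum_sub_le hp0 hlt g hr
  rw [dist_eq_norm]
  refine hM _ _ ?_
  rw [hc, sub_self]
  exact dvd_zero _

/-- Every continuous function on `∏ ℤ_ℓ` is of the form `z ↦ h (z + 1) - h z`, with `h` depending
continuously on it. -/
theorem exists_continuous_antidifference [CompleteSpace L] {p : ℕ} (hp0 : p ≠ 0)
    (hlt : ‖(p : L)‖ < 1) :
    ∃ S : C(ZHat, L) → C(ZHat, L), Continuous S ∧ ∀ g z, S g (z + 1) - S g z = g z := by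
  choose S hS using exists_extension_partialSum (L := L) hp0 hlt
  refine ⟨S, ?_, fun g z => ?_⟩
  -- Summation does not increase ultrametric distances, so `S` is 1-Lipschitz. Continuity of `S` is
  -- what later permits solving the equation in families.
  · have h1 : ∀ g g', dist (S g) (S g') ≤ dist g g' := by
      intro g g'
      rw [ContinuousMap.dist_le dist_nonneg]
      intro z
      induction z using denseRange_natCast_zHat.induction_on with
      | hp => exact isClosed_le (by fun_prop) continuous_const
      | ih n =>
        rw [hS, hS, dist_eq_norm]
        refine norm_partialSum_sub_le dist_nonneg (fun z => ?_) n
        rw [← dist_eq_norm]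
        exact ContinuousMap.dist_apply_le_dist z
    exact (LipschitzWith.mk_one h1).continuous
  · induction z using denseRange_natCast_zHat.induction_on with
    | hp => exact isClosed_eq (by fun_prop) (by fun_prop)
    | ih n =>
      have h1 := hS g (n + 1)
      rw [Nat.cast_add_one] at h1
      rw [h1, hS, partialSum_succ, add_sub_cancel_left]

end DifferenceEquation

/-! ### Unipotent translations of `borelOpen` -/

section Translation

/-- The adele with real component `r` and integral finite component `z`. -/
noncomputable def integralAdele (r : ℝ) (z : ZHat) : Adele := (r, zHatToFinAdele z)

lemma integralAdele_add (r s : ℝ) (z w : ZHat) :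
    integralAdele (r + s) (z + w) = integralAdele r z + integralAdele s w :=
  Prod.ext rfl (map_add zHatToFinAdele z w)

lemma integralAdele_zero : integralAdele 0 0 = 0 := Prod.ext rfl (map_zero zHatToFinAdele)

lemma integralAdele_one : integralAdele 1 1 = 1 := Prod.ext rfl (map_one zHatToFinAdele)

lemma continuous_integralAdele : Continuous fun q : ℝ × ZHat => integralAdele q.1 q.2 :=
  continuous_fst.prodMk (isOpenEmbedding_zHatToFinAdele.continuous.comp continuous_snd)

/-- The action of integral unipotent matrices on `borelOpen`. -/
noncomputable def translate (r : ℝ) (z : ZHat) (x : borelOpen) : borelOpen :=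
  ⟨upper (integralAdele r z) * x, upper_mul_mem_borelOpen (fun ℓ => (z ℓ).2) x.2⟩

lemma translate_translate (r s : ℝ) (z w : ZHat) (x : borelOpen) :
    translate r z (translate s w x) = translate (r + s) (z + w) x := by
  refine Subtype.ext ?_
  change upper _ * (upper _ * x.1) = upper _ * x.1
  rw [integralAdele_add, upper_add, mul_assoc]

lemma translate_zero (x : borelOpen) : translate 0 0 x = x := by
  refine Subtype.ext ?_
  change upper _ * x.1 = x.1
  rw [integralAdele_zero, upper_zero, one_mul]

lemma continuous_translate {X : Type*} [TopologicalSpace X] {r : X → ℝ} {z : X → ZHat}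
    {x : X → borelOpen} (hr : Continuous r) (hz : Continuous z) (hx : Continuous x) :
    Continuous fun t => translate (r t) (z t) (x t) :=
  Continuous.subtype_mk ((continuous_upper.comp (continuous_integralAdele.comp
    (hr.prodMk hz))).mul (continuous_subtype_val.comp hx)) _

/-- A continuous function with values in a totally disconnected space does not see the real
component of a translation. -/
lemma apply_translate_eq {Y : Type*} [TopologicalSpace Y] [TotallyDisconnectedSpace Y]
    (f : C(borelOpen, Y)) (r s : ℝ) (z : ZHat) (x : borelOpen) :
    f (translate r z x) = f (translate s z x) := by
  have hc : Continuous fun r : ℝ => f (translate r z x) :=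
    f.continuous.comp (continuous_translate continuous_id continuous_const continuous_const)
  exact (isPreconnected_range hc).subsingleton (Set.mem_range_self r) (Set.mem_range_self s)

end Translation

/-! ### An equivariant coordinate and the difference equation on `borelOpen` -/

section Slope

/-- `b / d` if `d` is a unit, and `a / c` otherwise. -/
noncomputable def slopeLocal (ℓ : Nat.Primes) (x : GL (Fin 2) Adele) : ℚ_[ℓ] :=
  open Classical in if ‖evalFin ℓ (x 1 1)‖ = 1 then evalFin ℓ (x 0 1) / evalFin ℓ (x 1 1)
    else evalFin ℓ (x 0 0) / evalFin ℓ (x 1 0)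

lemma slopeLocal_of_eq {ℓ : Nat.Primes} {x : GL (Fin 2) Adele} (h : ‖evalFin ℓ (x 1 1)‖ = 1) :
    slopeLocal ℓ x = evalFin ℓ (x 0 1) / evalFin ℓ (x 1 1) := if_pos h

lemma slopeLocal_of_ne {ℓ : Nat.Primes} {x : GL (Fin 2) Adele} (h : ‖evalFin ℓ (x 1 1)‖ ≠ 1) :
    slopeLocal ℓ x = evalFin ℓ (x 0 0) / evalFin ℓ (x 1 0) := if_neg h

/-- The determinant is a unit, so the two integral entries of the bottom row cannot both be
nonunits. -/
lemma norm_eq_one_of_norm_ne_one {x : GL (Fin 2) Adele} (hx : x ∈ integralOpen) {ℓ : Nat.Primes}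
    (h : ‖evalFin ℓ (x 1 1)‖ ≠ 1) : ‖evalFin ℓ (x 1 0)‖ = 1 := by
  obtain ⟨hint, hdet⟩ := (mem_integralOpen.1 hx).2 ℓ
  rw [det_fin_two_val, map_sub, map_mul, map_mul] at hdet
  refine le_antisymm (hint 1 0) ?_
  have h1 := Padic.nonarchimedean (evalFin ℓ (x 0 0) * evalFin ℓ (x 1 1))
    (-(evalFin ℓ (x 0 1) * evalFin ℓ (x 1 0)))
  rw [← sub_eq_add_neg, hdet, norm_neg, norm_mul, norm_mul] at h1
  rcases le_max_iff.1 h1 with h2 | h2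
  · exact absurd (h2.trans (mul_le_of_le_one_left (norm_nonneg _) (hint 0 0)))
      (not_le.2 (lt_of_le_of_ne (hint 1 1) h))
  · exact h2.trans (mul_le_of_le_one_left (norm_nonneg _) (hint 0 1))

lemma norm_slopeLocal_le {x : GL (Fin 2) Adele} (hx : x ∈ integralOpen) (ℓ : Nat.Primes) :
    ‖slopeLocal ℓ x‖ ≤ 1 := by
  obtain ⟨hint, -⟩ := (mem_integralOpen.1 hx).2 ℓ
  by_cases h : ‖evalFin ℓ (x 1 1)‖ = 1
  · rw [slopeLocal_of_eq h, norm_div, h, div_one]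
    exact hint 0 1
  · rw [slopeLocal_of_ne h, norm_div, norm_eq_one_of_norm_ne_one hx h, div_one]
    exact hint 0 0

/-- The bottom row, hence the branch, is unchanged, and in either branch `w` times the denominator
is added to the numerator. -/
lemma slopeLocal_upper_mul {x : GL (Fin 2) Adele} (hx : x ∈ integralOpen) (w : Adele)
    (ℓ : Nat.Primes) : slopeLocal ℓ (upper w * x) = slopeLocal ℓ x + evalFin ℓ w := by
  have h1 : ∀ i, (upper w * x) 1 i = x 1 i := fun i => by simp [upper_mul_apply]
  have h0 : ∀ i, (upper w * x) 0 i = x 0 i + w * x 1 i := fun i => by simp [upper_mul_apply]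
  by_cases h : ‖evalFin ℓ (x 1 1)‖ = 1
  · have hd : evalFin ℓ (x 1 1) ≠ 0 := norm_ne_zero_iff.1 (h ▸ one_ne_zero)
    rw [slopeLocal_of_eq h, slopeLocal_of_eq (by rwa [h1]), h0, h1, map_add, map_mul, add_div,
      mul_div_cancel_right₀ _ hd]
  · have hc : evalFin ℓ (x 1 0) ≠ 0 :=
      norm_ne_zero_iff.1 (norm_eq_one_of_norm_ne_one hx h ▸ one_ne_zero)
    rw [slopeLocal_of_ne h, slopeLocal_of_ne (by rwa [h1]), h0, h1, map_add, map_mul, add_div,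
      mul_div_cancel_right₀ _ hc]

/-- On `integralOpen` both branches are open conditions, namely `|d| = 1` and `|d| < 1`, so the case
distinction is locally constant. -/
lemma continuousOn_slopeLocal (ℓ : Nat.Primes) :
    ContinuousOn (slopeLocal ℓ) (integralOpen : Set (GL (Fin 2) Adele)) := by
  intro x hx
  refine ContinuousAt.continuousWithinAt ?_
  have hc : ∀ i j, Continuous fun x : GL (Fin 2) Adele => evalFin ℓ (x i j) := fun i j =>
    (continuous_evalFin _).comp (continuous_gl_apply i j)
  by_cases h : ‖evalFin ℓ (x 1 1)‖ = 1
  · have hd : evalFin ℓ (x 1 1) ≠ 0 := norm_ne_zero_iff.1 (h ▸ one_ne_zero)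
    have hev : ∀ᶠ y : GL (Fin 2) Adele in 𝓝 x, ‖evalFin ℓ (y 1 1)‖ = 1 := by
      filter_upwards [((IsUltrametricDist.isOpen_sphere (0 : ℚ_[ℓ]) one_ne_zero).preimage
        (hc 1 1)).mem_nhds (by simpa using h)] with y hy
      simpa using hy
    refine ((hc 0 1).continuousAt.div (hc 1 1).continuousAt hd).congr ?_
    filter_upwards [hev] with y hy
    exact (slopeLocal_of_eq hy).symm
  · have hc0 : evalFin ℓ (x 1 0) ≠ 0 :=
      norm_ne_zero_iff.1 (norm_eq_one_of_norm_ne_one hx h ▸ one_ne_zero)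
    have hlt : ‖evalFin ℓ (x 1 1)‖ < 1 :=
      lt_of_le_of_ne (((mem_integralOpen.1 hx).2 ℓ).1 1 1) h
    have hev : ∀ᶠ y : GL (Fin 2) Adele in 𝓝 x, ‖evalFin ℓ (y 1 1)‖ < 1 :=
      (hc 1 1).norm.continuousAt.eventually_lt continuousAt_const hlt
    refine ((hc 0 0).continuousAt.div (hc 1 0).continuousAt hc0).congr ?_
    filter_upwards [hev] with y hy
    exact (slopeLocal_of_ne hy.ne).symm

/-- A coordinate on `borelOpen` that moves with the translations. -/
noncomputable def slope (x : borelOpen) : ZHat :=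
  fun ℓ => ⟨slopeLocal ℓ x, norm_slopeLocal_le x.2.1 ℓ⟩

lemma continuous_slope : Continuous slope :=
  continuous_pi fun ℓ => Continuous.subtype_mk
    ((continuousOn_slopeLocal ℓ).comp_continuous continuous_subtype_val fun x => x.2.1) _

lemma slope_translate (r : ℝ) (z : ZHat) (x : borelOpen) :
    slope (translate r z x) = slope x + z :=
  funext fun ℓ => Subtype.ext (slopeLocal_upper_mul x.2.1 _ ℓ)

variable {L : Type*} [NormedField L] [IsUltrametricDist L] [CompleteSpace L]

/-- The difference equation along the translations of `borelOpen` is solvable. -/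
theorem exists_translate_sub_eq {p : ℕ} (hp0 : p ≠ 0) (hlt : ‖(p : L)‖ < 1)
    (f : C(borelOpen, L)) : ∃ φ : C(borelOpen, L), ∀ x, φ (translate 1 1 x) - φ x = f x := by
  obtain ⟨S, hS, hSg⟩ := exists_continuous_antidifference (L := L) hp0 hlt
  -- `σ` moves each point along its orbit to slope `0`, and `F x` records `f` along the orbit of
  -- `x`. The solution is the antidifference of `F (σ x)` taken at `slope x`.
  let σ : C(borelOpen, borelOpen) := ⟨fun x => translate 0 (-slope x) x,
    continuous_translate continuous_const continuous_slope.neg continuous_id⟩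
  let F : C(borelOpen, C(ZHat, L)) := ContinuousMap.curry ⟨fun q => f (translate 0 q.2 q.1),
    f.continuous.comp (continuous_translate continuous_const continuous_snd continuous_fst)⟩
  -- The points `σ (translate 1 1 x)` and `σ x` differ by a real translation only, which `f` does
  -- not see.
  have hF : ∀ x z, F x z = f (translate 0 z x) := fun _ _ => rfl
  have hσ : ∀ x, F (σ (translate 1 1 x)) = F (σ x) := by
    intro x
    ext z
    change f (translate 0 z (translate 0 (-slope (translate 1 1 x)) (translate 1 1 x))) =
      f (translate 0 z (translate 0 (-slope x) x))
    rw [translate_translate, translate_translate, translate_translate, slope_translate,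
      apply_translate_eq f _ 0, apply_translate_eq f (0 + 0) 0]
    congr 2
    abel
  refine ⟨⟨fun x => S (F (σ x)) (slope x),
    ContinuousEval.continuous_eval.comp ((hS.comp (F.continuous.comp σ.continuous)).prodMk
      continuous_slope)⟩, fun x => ?_⟩
  change S (F (σ (translate 1 1 x))) (slope (translate 1 1 x)) - S (F (σ x)) (slope x) = f x
  rw [hσ, slope_translate, hSg, hF]
  change f (translate 0 (slope x) (translate 0 (-slope x) x)) = f x
  rw [translate_translate, add_neg_cancel, add_zero, translate_zero]

end Slope

/-! ### Vanishing of the higher cohomology of `B(ℚ)` -/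

section Vanishing

variable (L : Type) [NormedField L] [IsUltrametricDist L] [CompleteSpace L]

lemma isZero_groupCohomology_borel_one {p : ℕ} (hp0 : p ≠ 0) (hlt : ‖(p : L)‖ < 1) :
    Limits.IsZero (groupCohomology (Rep.res (borel ℚ).subtype (contFun L)) 1) := by
  rw [isZero_groupCohomology_borel_iff]
  refine isZero_groupCohomology_one_of_zpowers
    ⟨borelGen, Multiplicative.ofAdd 1, by simp⟩ ?_ _ fun f : C(borelOpen, L) => ?_
  · rintro ⟨_, n, rfl⟩
    exact ⟨n.toAdd, Subtype.ext (zpowersHom_apply _ borelGen n).symm⟩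
  · obtain ⟨φ, hφ⟩ := exists_translate_sub_eq hp0 hlt f
    refine ⟨φ, ContinuousMap.ext fun x => ?_⟩
    rw [← hφ x]
    refine congrArg (fun y => φ y - φ x) (Subtype.ext ?_)
    -- The action involves the inverse, so the entry `-1` of `borelGen` produces translation by
    -- `+1`.
    change borelToAdele borelGen⁻¹ * x.1 = upper (integralAdele 1 1) * x.1
    have h1 : borelToAdele borelGen⁻¹ = upper (ratToAdele 1) := by
      rw [← map_upper, ← neg_neg (1 : ℚ), ← inv_upper]
      rfl
    rw [h1, map_one, integralAdele_one]

lemma isZero_groupCohomology_borel {p : ℕ} (hp0 : p ≠ 0) (hlt : ‖(p : L)‖ < 1) (n : ℕ) :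
    Limits.IsZero (groupCohomology (Rep.res (borel ℚ).subtype (contFun L)) (n + 1)) := by
  cases n with
  | zero => exact isZero_groupCohomology_borel_one L hp0 hlt
  | succ n => exact isZero_groupCohomology_borel_add_two L n

end Vanishing

/-! ### Descent to `𝔸ˣ / ℝ₊ˣ ℚˣ` -/

section Descent

variable {Y : Type*} [TopologicalSpace Y] [TotallyDisconnectedSpace Y]

/-- Rational invariance is assumed; invariance under positive reals is automatic, since they form a
connected group. -/
lemma apply_mul_of_mem {ψ : Adeleˣ → Y} (hψ : Continuous ψ)
    (h : ∀ (q : ℚˣ) z, ψ (Units.map ratToAdele.toMonoidHom q * z) = ψ z) {n : Adeleˣ}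
    (hn : n ∈ posReal ⊔ (Units.map ratToAdele.toMonoidHom).range) (z : Adeleˣ) :
    ψ (n * z) = ψ z := by
  obtain ⟨r, hr, _, ⟨q, rfl⟩, rfl⟩ := Subgroup.mem_sup.1 hn
  have h1 := eq_one_apply_of_mem_posReal
    (ψ := fun w => ψ (w * (Units.map ratToAdele.toMonoidHom q * z)))
    (hψ.comp (continuous_id.mul continuous_const)) hr
  rw [mul_assoc]
  exact h1.trans ((congrArg ψ (one_mul _)).trans (h q z))

lemma apply_eq_of_mk_eq {ψ : Adeleˣ → Y} (hψ : Continuous ψ)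
    (h : ∀ (q : ℚˣ) z, ψ (Units.map ratToAdele.toMonoidHom q * z) = ψ z) {z w : Adeleˣ}
    (hzw : (z : IdeleQuot) = w) : ψ z = ψ w := by
  rw [← apply_mul_of_mem hψ h (QuotientGroup.eq.1 hzw) z, mul_comm, mul_inv_cancel_left]

lemma mk_ratToAdele (q : ℚˣ) :
    ((Units.map ratToAdele.toMonoidHom q : Adeleˣ) : IdeleQuot) = 1 :=
  (QuotientGroup.eq_one_iff _).2 (Subgroup.mem_sup_right ⟨q, rfl⟩)

variable {φ : GL (Fin 2) Adele → Y}

/-- A function on `GL₂(𝔸)` that is invariant under `B(ℚ)` is invariant under diagonal matrices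
which are trivial in `𝔸ˣ / ℝ₊ˣ ℚˣ`. -/
lemma apply_diag_mul_eq (hφ : Continuous φ) (h : ∀ (b : borel ℚ) x, φ (borelToAdele b * x) = φ x)
    {s s' t t' : Adeleˣ} (hs : (s : IdeleQuot) = s') (ht : (t : IdeleQuot) = t')
    (x : GL (Fin 2) Adele) : φ (diag s t * x) = φ (diag s' t' * x) := by
  have hq : ∀ (q q' : ℚˣ) y, φ (diag (Units.map ratToAdele.toMonoidHom q)
      (Units.map ratToAdele.toMonoidHom q') * y) = φ y := fun q q' y => by
    rw [← map_diag]
    exact h ⟨diag q q', by simp [borel, diag]⟩ y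
  have h1 : φ (diag s t * x) = φ (diag s' t * x) :=
    apply_eq_of_mk_eq (ψ := fun z => φ (diag z t * x))
      (hφ.comp ((continuous_diag.comp (continuous_id.prodMk continuous_const)).mul
        continuous_const))
      (fun q z => by
        have h2 := hq q 1 (diag z t * x)
        rwa [map_one, ← mul_assoc, ← diag_mul, one_mul] at h2) hs
  refine h1.trans (apply_eq_of_mk_eq (ψ := fun z => φ (diag s' z * x))
      (hφ.comp ((continuous_diag.comp (continuous_const.prodMk continuous_id)).mul
        continuous_const))
      (fun q z => ?_) ht)
  have h2 := hq 1 q (diag s' z * x)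
  rwa [map_one, ← mul_assoc, ← diag_mul, one_mul] at h2

lemma diag_mul_upper {R : Type*} [CommRing R] (s t : Rˣ) (a : R) :
    diag s t * upper a = upper (s * a * (t⁻¹ : Rˣ)) * diag s t := by
  ext i j
  fin_cases i <;> fin_cases j <;> simp [diag, upper]

lemma det_borel {R : Type*} [CommRing R] (b : borel R) :
    Matrix.GeneralLinearGroup.det b.1 = borelFst b * borelSnd b := by
  rw [borel_eq b, map_mul, det_upper, one_mul, det_diag]

end Descent

/-! ### The maps of the exact sequence -/

section Maps

variable (L : Type) [NormedField L]

lemma leviRep_apply (b : borel Adele) (h : C(IdeleQuot × IdeleQuot, L)) (s t : IdeleQuot) :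
    leviRep L b h (s, t) = h (s * (borelFst b : Adeleˣ), t * (borelSnd b : Adeleˣ)) := rfl

/-- The value at `(1, 1)` of an element of the induced representation. -/
noncomputable def evalOne : inducedSpace L →ₗ[L] C(GL (Fin 2) Adele, L) where
  toFun Φ := ⟨fun x => Φ.1 x (1, 1),
    (ContinuousEvalConst.continuous_eval_const _).comp Φ.1.continuous⟩
  map_add' _ _ := rfl
  map_smul' _ _ := rfl

variable {L}

lemma evalOne_apply (Φ : inducedSpace L) (x : GL (Fin 2) Adele) :
    evalOne L Φ x = Φ.1 x (1, 1) := rfl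

/-- Frobenius reciprocity: equivariance under diagonal matrices recovers `Φ` from its values at `(1,
1)`. -/
lemma inducedSpace_apply (Φ : inducedSpace L) (x : GL (Fin 2) Adele) (s t : Adeleˣ) :
    Φ.1 x ((s : IdeleQuot), (t : IdeleQuot)) = evalOne L Φ (diag s t * x) := by
  have h1 := Φ.2 ⟨diag s t, by simp [borel, diag]⟩ x
  rw [evalOne_apply, h1, leviRep_apply]
  refine congrArg (Φ.1 x) (Prod.ext ?_ ?_)
  · have h2 : s = borelFst ⟨diag s t, by simp [borel, diag]⟩ := Units.ext rfl
    exact (congrArg (fun z : Adeleˣ => (z : IdeleQuot)) h2).trans (one_mul (_ : IdeleQuot)).symm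
  · have h2 : t = borelSnd ⟨diag s t, by simp [borel, diag]⟩ := Units.ext rfl
    exact (congrArg (fun z : Adeleˣ => (z : IdeleQuot)) h2).trans (one_mul (_ : IdeleQuot)).symm

lemma evalOne_borel (Φ : inducedSpace L) (b : borel ℚ) (x : GL (Fin 2) Adele) :
    evalOne L Φ (borelToAdele b * x) = evalOne L Φ x := by
  have hb : borelToAdele b ∈ borel Adele := by
    change ratToAdele (b.1 1 0) = 0
    rw [b.2, map_zero]
  have h1 := Φ.2 ⟨borelToAdele b, hb⟩ x
  rw [evalOne_apply, evalOne_apply, h1, leviRep_apply]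
  have h2 : borelFst ⟨borelToAdele b, hb⟩ = Units.map ratToAdele.toMonoidHom (borelFst b) :=
    Units.ext rfl
  have h3 : borelSnd ⟨borelToAdele b, hb⟩ = Units.map ratToAdele.toMonoidHom (borelSnd b) :=
    Units.ext rfl
  rw [h2, h3]
  exact congrArg (Φ.1 x) (Prod.ext ((one_mul _).trans (mk_ratToAdele _))
    ((one_mul _).trans (mk_ratToAdele _)))

variable (L)

/-- The map from the induced representation to the boundary cohomology. -/
noncomputable def evalOneInvariants : inducedSpace L →ₗ[L]
    (Rep.res (borel ℚ).subtype (contFun L)).ρ.invariants :=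
  (evalOne L).codRestrict _ fun Φ b => ContinuousMap.ext fun x => evalOne_borel Φ b⁻¹ x

/-- The connecting map from the induced representation to compactly supported cohomology. -/
noncomputable def boundaryMap : boundaryRep L ⟶ compactCohomology L 1 :=
  Rep.ofHom (ρ := (boundaryRep L).ρ) (σ := (compactCohomology L 1).ρ)
    ⟨boundaryClass (B := borel ℚ) (A := contFun L) ∘ₗ evalOneInvariants L, fun g =>
      LinearMap.ext fun Φ => (boundaryClass_naturality (adelicAction L g) (evalOneInvariants L Φ)
        (evalOneInvariants L ((boundaryRep L).ρ g Φ)) rfl).symm⟩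

/-- The class of the determinant in `𝔸ˣ / ℝ₊ˣ ℚˣ`. -/
noncomputable def detClass : C(GL (Fin 2) Adele, IdeleQuot) :=
  ⟨fun x => (Matrix.GeneralLinearGroup.det x : Adeleˣ),
    QuotientGroup.continuous_mk.comp continuous_gl_det⟩

lemma detClass_mul (x y : GL (Fin 2) Adele) : detClass (x * y) = detClass x * detClass y :=
  congrArg (QuotientGroup.mk' _) (map_mul Matrix.GeneralLinearGroup.det x y)

/-- The map `h ↦ (x ↦ ((s, t) ↦ h (s t det x)))`. -/
noncomputable def detToInduced : C(IdeleQuot, L) →ₗ[L] inducedSpace L where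
  toFun h := ⟨ContinuousMap.curry ⟨fun q => h (q.2.1 * q.2.2 * detClass q.1), by fun_prop⟩, by
    intro b x
    ext ⟨s, t⟩
    rw [leviRep_apply]
    change h (s * t * detClass (b * x)) = h (s * _ * (t * _) * detClass x)
    have h1 : detClass b = ((borelFst b : Adeleˣ) : IdeleQuot) * (borelSnd b : Adeleˣ) :=
      congrArg (QuotientGroup.mk' _) (det_borel b)
    rw [detClass_mul, h1, ← mul_assoc]
    exact congrArg (fun z => h (z * detClass x)) (mul_mul_mul_comm s t _ _)⟩
  map_add' _ _ := rfl
  map_smul' _ _ := rfl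

/-- The map `h ↦ (x ↦ ((s, t) ↦ h (s t det x)))` of representations. -/
noncomputable def detMap : detRep L ⟶ boundaryRep L :=
  Rep.ofHom (ρ := (detRep L).ρ) (σ := (boundaryRep L).ρ)
    ⟨detToInduced L, fun g => LinearMap.ext fun (h : C(IdeleQuot, L)) => Subtype.ext <| by
      refine ContinuousMap.ext fun x => ContinuousMap.ext fun q => ?_
      change h (q.1 * q.2 * detClass x * detClass g) = h (q.1 * q.2 * detClass (x * g))
      rw [detClass_mul, mul_assoc]⟩

lemma detMap_injective : Function.Injective (detMap L).hom := by
  intro (h : C(IdeleQuot, L)) (h' : C(IdeleQuot, L)) hh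
  refine ContinuousMap.ext fun z => ?_
  obtain ⟨z, rfl⟩ := QuotientGroup.mk_surjective z
  have h1 : detToInduced L h = detToInduced L h' := hh
  have h2 := congrArg (fun Φ : inducedSpace L => Φ.1 (diag 1 z) (1, 1)) h1
  have h3 : detClass (diag 1 z) = (z : IdeleQuot) :=
    congrArg (QuotientGroup.mk' _) ((det_diag 1 z).trans (one_mul z))
  have h4 : 1 * 1 * detClass (diag 1 z) = (z : IdeleQuot) :=
    (congrArg (· * detClass _) (one_mul 1)).trans ((one_mul _).trans h3)
  exact (congrArg h h4).symm.trans (h2.trans (congrArg h' h4))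

variable {L} [TotallyDisconnectedSpace L]

/-- Every continuous function on `GL₂(𝔸)` that is invariant under `B(ℚ)` comes from the induced
representation. -/
lemma exists_evalOne_eq (φ : C(GL (Fin 2) Adele, L))
    (h : ∀ (b : borel ℚ) x, φ (borelToAdele b * x) = φ x) : ∃ Φ, evalOne L Φ = φ := by
  let mkC : C(GL (Fin 2) Adele × Adeleˣ × Adeleˣ, GL (Fin 2) Adele × IdeleQuot × IdeleQuot) :=
    ⟨Prod.map id (Prod.map QuotientGroup.mk QuotientGroup.mk),
      continuous_id.prodMap (QuotientGroup.continuous_mk.prodMap QuotientGroup.continuous_mk)⟩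
  -- A product of quotient maps need not be a quotient map, but a product of open ones is.
  have hmk : IsQuotientMap mkC :=
    (IsOpenQuotientMap.id.prodMap ((QuotientGroup.isOpenQuotientMap_mk).prodMap
      QuotientGroup.isOpenQuotientMap_mk)).isQuotientMap
  let k : C(GL (Fin 2) Adele × Adeleˣ × Adeleˣ, L) := ⟨fun q => φ (diag q.2.1 q.2.2 * q.1),
    φ.continuous.comp ((continuous_diag.comp continuous_snd).mul continuous_fst)⟩
  have hk : Function.FactorsThrough k mkC := by
    rintro ⟨x, s, t⟩ ⟨x', s', t'⟩ hq
    obtain rfl : x = x' := congrArg Prod.fst hq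
    exact apply_diag_mul_eq φ.continuous h (congrArg (fun q => q.2.1) hq)
      (congrArg (fun q => q.2.2) hq) x
  let Ψ : C(GL (Fin 2) Adele, C(IdeleQuot × IdeleQuot, L)) := (hmk.lift k hk).curry
  have hΨ : ∀ x (s t : Adeleˣ), Ψ x ((s : IdeleQuot), (t : IdeleQuot)) = φ (diag s t * x) :=
    fun x s t => DFunLike.congr_fun (hmk.lift_comp k hk) (x, s, t)
  have hup := upper_invariant φ.continuous fun q x => by
    rw [← map_upper]
    exact h ⟨upper q, by simp [borel, upper]⟩ x
  refine ⟨⟨Ψ, fun b x => ContinuousMap.ext fun ⟨s, t⟩ => ?_⟩, ContinuousMap.ext fun x => ?_⟩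
  · obtain ⟨s, rfl⟩ := QuotientGroup.mk_surjective s
    obtain ⟨t, rfl⟩ := QuotientGroup.mk_surjective t
    -- The unipotent part of `b` passes to the left of `diag s t` as another unipotent, under which
    -- `φ` is invariant; the diagonal parts multiply.
    rw [leviRep_apply, ← QuotientGroup.mk_mul, ← QuotientGroup.mk_mul, hΨ, hΨ, borel_eq b,
      mul_assoc, ← mul_assoc (diag s t), diag_mul_upper, mul_assoc (upper _), hup, ← mul_assoc,
      diag_mul]
  · refine (hΨ x 1 1).trans ?_
    rw [diag_one_one, one_mul]

/-- A continuous function on `GL₂(𝔸)` that is invariant under `GL₂(ℚ)` is a function of the class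
of the determinant. -/
lemma exists_detClass_eq (φ : C(GL (Fin 2) Adele, L)) (h : ∀ (γ : GL (Fin 2) ℚ) x,
      φ (Matrix.GeneralLinearGroup.map ratToAdele γ * x) = φ x) :
    ∃ η : C(IdeleQuot, L), ∀ x, η (detClass x) = φ x := by
  have hc : Continuous fun z : Adeleˣ => φ (diag 1 z) :=
    φ.continuous.comp (continuous_diag.comp (continuous_const.prodMk continuous_id))
  let mkC : C(Adeleˣ, IdeleQuot) := ⟨QuotientGroup.mk, QuotientGroup.continuous_mk⟩
  have hmk : IsQuotientMap mkC := QuotientGroup.isQuotientMap_mk _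
  have hk : Function.FactorsThrough (⟨fun z : Adeleˣ => φ (diag 1 z), hc⟩ : C(Adeleˣ, L)) mkC :=
    fun z w hzw => apply_eq_of_mk_eq hc (fun q z => by
      rw [← h (diag 1 q) (diag 1 z), map_diag, map_one, ← diag_mul, one_mul]) hzw
  refine ⟨hmk.lift _ hk, fun x => ?_⟩
  refine (DFunLike.congr_fun (hmk.lift_comp _ hk) (Matrix.GeneralLinearGroup.det x)).trans ?_
  refine det_invariant φ.continuous h _ _ ?_
  rw [det_diag, one_mul]

/-- The kernel of the boundary map consists of the `Φ` whose value at `(1, 1)` is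
`GL₂(ℚ)`-invariant, that is, a function of the class of the determinant. -/
lemma exact_detMap_boundaryMap : Function.Exact (detMap L).hom (boundaryMap L).hom := by
  intro (Φ : inducedSpace L)
  refine (boundaryClass_eq_zero_iff (evalOneInvariants L Φ)).trans ?_
  have h1 : (∀ g, (contFun L).ρ g (evalOneInvariants L Φ).1 = (evalOneInvariants L Φ).1) ↔
      ∀ (γ : GL (Fin 2) ℚ) x, evalOne L Φ (Matrix.GeneralLinearGroup.map ratToAdele γ * x) =
        evalOne L Φ x := by
    constructor
    · intro h γ x
      have h2 := DFunLike.congr_fun (F := C(GL (Fin 2) Adele, L)) (h γ⁻¹) x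
      rw [← inv_inv γ]
      exact h2
    · exact fun h γ => ContinuousMap.ext fun x => h γ⁻¹ x
  rw [h1]
  constructor
  · intro h
    obtain ⟨η, hη⟩ := exists_detClass_eq (evalOne L Φ) h
    refine ⟨η, Subtype.ext (ContinuousMap.ext fun x => ContinuousMap.ext fun ⟨s, t⟩ => ?_)⟩
    obtain ⟨s, rfl⟩ := QuotientGroup.mk_surjective s
    obtain ⟨t, rfl⟩ := QuotientGroup.mk_surjective t
    rw [inducedSpace_apply, ← hη, detClass_mul]
    refine congrArg (fun z => η (z * detClass x)) ?_
    exact (congrArg (QuotientGroup.mk' _) (det_diag s t)).symm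
  · rintro ⟨η, rfl⟩ γ x
    change DFunLike.coe (F := C(IdeleQuot, L)) η (1 * 1 * detClass (_ * x)) =
      DFunLike.coe (F := C(IdeleQuot, L)) η (1 * 1 * detClass x)
    have h2 : detClass (Matrix.GeneralLinearGroup.map ratToAdele γ) = 1 :=
      (congrArg (QuotientGroup.mk' _) (Matrix.GeneralLinearGroup.map_det ratToAdele γ)).trans
        (mk_ratToAdele _)
    rw [detClass_mul, h2]
    exact congrArg (fun z => DFunLike.coe (F := C(IdeleQuot, L)) η (1 * 1 * z))
      (one_mul (detClass x))

lemma exact_boundaryMap [IsUltrametricDist L] [CompleteSpace L] :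
    Function.Exact (boundaryMap L).hom (compactToCohomology L 1).hom := by
  intro x
  refine (forgetSupports_eq_zero_iff x).trans ?_
  constructor
  · rintro ⟨⟨φ, hφ⟩, rfl⟩
    obtain ⟨Φ, hΦ⟩ := exists_evalOne_eq φ fun b x => by
      have h2 := DFunLike.congr_fun (F := C(GL (Fin 2) Adele, L)) (hφ b⁻¹) x
      rw [← inv_inv b]
      exact h2
    exact ⟨Φ, congrArg boundaryClass (Subtype.ext hΦ)⟩
  · rintro ⟨Φ, rfl⟩
    exact ⟨_, rfl⟩

end Maps

end AdelicCohomology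

/-- The representations are built from functions on `IdeleQuot`; the homeomorphism in the first
conjunct justifies reading them as functions on the units of `∏ ℤ_ℓ`. -/
theorem mainTheorem6 (p : ℕ) [Fact p.Prime] (L : Type) [NormedField L] [NormedAlgebra ℚ_[p] L]
    [FiniteDimensional ℚ_[p] L] :
    IsHomeomorph zHatUnitsToIdeleQuot ∧
    (∀ i : ℕ, i ≠ 1 → Subsingleton (compactCohomology L i)) ∧
    ∃ (f : detRep L ⟶ boundaryRep L) (g : boundaryRep L ⟶ compactCohomology L 1),
      Function.Injective f.hom ∧
      Function.Exact f.hom g.hom ∧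
      Function.Exact g.hom (compactToCohomology L 1).hom ∧
      Function.Surjective (compactToCohomology L 1).hom := by
  have : IsUltrametricDist L := IsUltrametricDist.of_normedAlgebra ℚ_[p]
  have : CompleteSpace L := FiniteDimensional.complete ℚ_[p] L
  have hp0 : p ≠ 0 := (Fact.out : p.Prime).ne_zero
  have hlt : ‖(p : L)‖ < 1 := by
    rw [← map_natCast (algebraMap ℚ_[p] L) p, norm_algebraMap']
    exact Padic.norm_p_lt_one
  exact ⟨isHomeomorph_zHatUnitsToIdeleQuot,
    subsingleton_compactCohomology (isZero_groupCohomology_contFun L)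
      (isZero_groupCohomology_borel L hp0 hlt),
    detMap L, boundaryMap L, detMap_injective L, exact_detMap_boundaryMap, exact_boundaryMap,
    forgetSupports_surjective (isZero_groupCohomology_borel L hp0 hlt 0)⟩
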